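/- **Setting.** $N$ agents are the vertices of an undirected graph; $\mathcal N_k$ denotes the set consisting of $k$ and its neighbours. The agents are partitioned into groups $\mathcal G_1,\dots,\mathcal G_G$, each nonempty and inducing a connected subgraph, of sizes $N_m=|\mathcal G_m|$; agents are indexed so that groups are consecutive. Agent $k$ has a strictly convex, twice differentiable cost $J_k:\mathbb R^M\to\mathbb R$ with minimizer $w_k^o$, and agents in the same group have the same minimizer. Write $\mathrm{col}$ for stacking, $\mathcal W^o=\mathrm{col}\{w_1^o,\dots,w_N^o\}$, and $\|\cdot\|$ for the Euclidean norm of vectors and the induced 2-norm of matrices. Assume: * *Costs.* $\lambda_{k,L}I\le\nabla^2J_k(w)\le\lambda_{k,U}I$ for all $w$, with $0\le\lambda_{k,L}\le\lambda_{k,U}<\infty$; every group contains an agent with $\lambda_{k,L}>0$; and $\mathcal W=\mathrm{col}\{w_k\}\mapsto\mathrm{diag}\{\nabla^2J_1(w_1),\dots,\nabla^2J_N(w_N)\}$ is Lipschitz. * *Combination weights.* $A=[a_{\ell k}]$ with $a_{\ell k}>0$ if $\ell\in\mathcal N_k$ lies in the group of $k$, $a_{\ell k}=0$ otherwise, and $\sum_\ell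 a_{\ell k}=1$ for every $k$. * *Gradient noise.* At iteration $i\ge0$ agent $k$ has a random approximation $\widehat{\nabla J}_{k,i}(w)$ of $\nabla J_k(w)$; let $\mathcal S_i(\mathcal W)=\mathrm{col}\{\widehat{\nabla J}_{k,i}(w_k)-\nabla J_k(w_k)\}_{k=1}^N$. There is a filtration $\{\mathbb F_i\}_{i\ge-1}$ and constants $\alpha,\sigma_s,\kappa_s\ge0$, $0<\gamma_s\le4$ such that, for all $i$ and every $\mathbb F_{i-1}$-measurable random $\mathcal W$ with finite fourth moment, $\mathcal S_i(\mathcal W)$ is $\mathbb F_i$-measurable with finite fourth moment and, almost surely, $\mathbb E[\mathcal S_i(\mathcal W)\mid\mathbb F_{i-1}]=0$, $\mathbb E[\|\mathcal S_i(\mathcal W)\|^4\mid\mathbb F_{i-1}]\le\alpha^2\|\mathcal W^o-\mathcal W\|^4+\sigma_s^4$ and $\|\mathcal R_{s,i}(\mathcal W^o)-\mathcal R_{s,i}(\mathcal W)\|\le\kappa_s\|\mathcal W^o-\mathcal W\|^{\gamma_s}$, where $\mathcal R_{s,i}(\mathcal W)=\mathbb E[\mathcal S_i(\mathcal W)\mathcal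 S_i(\mathcal W)^{\mathsf T}\mid\mathbb F_{i-1}]$. Moreover $\mathcal R_{s,i}(\mathcal W^o)\to\mathcal R_s$ almost surely as $i\to\infty$, with $\mathcal R_s$ a deterministic symmetric positive definite matrix. * *Step-sizes.* $\mu_k=\mu_{\max}\tau_k$ with fixed $\tau_k\in(0,1]$ and $\max_k\tau_k=1$. The iterates are $\boldsymbol w_{k,-1}=0$ and, for $i\ge0$, $\boldsymbol\psi_{k,i}=\boldsymbol w_{k,i-1}-\mu_k\widehat{\nabla J}_{k,i}(\boldsymbol w_{k,i-1})$, $\boldsymbol w_{k,i}=\sum_{\ell}a_{\ell k}\boldsymbol\psi_{\ell,i}$. Put $\widetilde{\mathcal W}_i=\mathcal W^o-\mathrm{col}\{\boldsymbol w_{1,i},\dots,\boldsymbol w_{N,i}\}$ and $\Pi_i=\mu_{\max}^{-1}\,\mathbb E[\widetilde{\mathcal W}_i\widetilde{\mathcal W}_i^{\mathsf T}]$. **Theorem (Block structure).** The second moments $\mathbb E\|\widetilde{\mathcal W}_i\|^2$ are finite. There is a unique vector $p=(p_1,\dots,p_N)$ with positive entries, $Ap=p$ and $\sum_{k\in\mathcal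 G_m}p_k=1$ for every $m$. Let $\bar{\mathcal H}=\mathrm{diag}\{\bar H_1,\dots,\bar H_G\}$ with $\bar H_m=\sum_{k\in\mathcal G_m}p_k\tau_k\nabla^2J_k(w_k^o)$, let $p_m^g=\mathrm{col}\{p_k;k\in\mathcal G_m\}$, $\mathcal P=\mathrm{diag}\{p_1^g,\dots,p_G^g\}\otimes I_M$, $\mathcal T=\mathrm{diag}\{\tau_1,\dots,\tau_N\}\otimes I_M$ and $\bar{\mathcal R}=\mathcal P^{\mathsf T}\mathcal T\mathcal R_s\mathcal T\mathcal P$. The continuous Lyapunov equation $$\bar{\mathcal H}\Phi+\Phi\bar{\mathcal H}=\bar{\mathcal R}$$ has a unique solution $\Phi\in\mathbb R^{GM\times GM}$. Let $\Phi_{m,r}$ be its $M\times M$ blocks and let $\Pi\in\mathbb R^{NM\times NM}$ be the matrix whose block with rows in $\mathcal G_m$ and columns in $\mathcal G_r$ is $(\mathbf 1_{N_m}\mathbf 1_{N_r}^{\mathsf T})\otimes\Phi_{m,r}$. Then $$\lim_{\mu_{\max}\to0}\ \limsup_{i\to\infty}\ \|\Pi_i-\Pi\|=0 .$$ -/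

import Mathlib

open MeasureTheory Filter Topology
open scoped ENNReal Kronecker Matrix.Norms.L2Operator

namespace DiffusionNet

/-- The parameter space of one agent, with the Euclidean norm. -/
abbrev Vec (M : ℕ) : Type := EuclideanSpace ℝ (Fin M)

/-- `col {w_1, …, w_N}`: the agents' vectors stacked into one Euclidean vector of length `N M`. -/
noncomputable def col {N M : ℕ} (w : Fin N → Vec M) : EuclideanSpace ℝ (Fin N × Fin M) :=
  WithLp.toLp 2 fun p => w p.1 p.2

/-- The Hessian matrix of `f` at `w`. -/
noncomputable def hessian {M : ℕ} (f : Vec M → ℝ) (w : Vec M) : Matrix (Fin M) (Fin M) ℝ :=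
  Matrix.of fun a b =>
    fderiv ℝ (fderiv ℝ f) w (EuclideanSpace.single a 1) (EuclideanSpace.single b 1)

/-- The network Hessian `diag {∇² J_1(w_1), …, ∇² J_N(w_N)}`. -/
noncomputable def netHessian {N M : ℕ} (J : Fin N → Vec M → ℝ) (w : Fin N → Vec M) :
    Matrix (Fin N × Fin M) (Fin N × Fin M) ℝ :=
  Matrix.of fun p q => if p.1 = q.1 then hessian (J p.1) (w p.1) p.2 q.2 else 0

/-- The groups partition the agents (`grp k` is the group of agent `k`); each group is a nonempty
connected part of the topology, and its members share one minimizer, that is, they belong to one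
cluster (the clusters being the classes of agents with equal minimizers). -/
structure IsGrouping {N G M : ℕ} (T : SimpleGraph (Fin N)) (grp : Fin N → Fin G)
    (wo : Fin N → Vec M) : Prop where
  connected : ∀ m, (T.induce {k | grp k = m}).Connected
  common_minimizer : ∀ k l, grp k = grp l → wo k = wo l

/-- The combination coefficients `A l k = a_{lk}`: positive exactly on the neighbours `l` of `k`
(`k` itself included) in the group of `k`, zero elsewhere, with columns adding up to one. -/
structure IsCombination {N G : ℕ} (T : SimpleGraph (Fin N)) (grp : Fin N → Fin G)
    (A : Matrix (Fin N) (Fin N) ℝ) : Prop where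
  pos : ∀ l k, (l = k ∨ T.Adj l k) ∧ grp l = grp k → 0 < A l k
  zero : ∀ l k, ¬ ((l = k ∨ T.Adj l k) ∧ grp l = grp k) → A l k = 0
  sum_one : ∀ k, ∑ l, A l k = 1

/-- The conditions on the individual costs `J k` and their minimizers `wo k`. -/
structure CostCondition {N G M : ℕ} (grp : Fin N → Fin G) (J : Fin N → Vec M → ℝ)
    (wo : Fin N → Vec M) (lamL lamU : Fin N → ℝ) (κH : ℝ) : Prop where
  strictConvex : ∀ k, StrictConvexOn ℝ Set.univ (J k)
  minimizer : ∀ k, IsMinOn (J k) Set.univ (wo k)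
  differentiable : ∀ k, Differentiable ℝ (J k)
  differentiable_fderiv : ∀ k, Differentiable ℝ (fderiv ℝ (J k))
  lamL_nonneg : ∀ k, 0 ≤ lamL k
  lamL_le_lamU : ∀ k, lamL k ≤ lamU k
  hessian_lower : ∀ k w, (hessian (J k) w - lamL k • (1 : Matrix (Fin M) (Fin M) ℝ)).PosSemidef
  hessian_upper : ∀ k w, (lamU k • (1 : Matrix (Fin M) (Fin M) ℝ) - hessian (J k) w).PosSemidef
  strong : ∀ m, ∃ k, grp k = m ∧ 0 < lamL k
  κH_nonneg : 0 ≤ κH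
  hessian_lipschitz : ∀ w₁ w₂ : Fin N → Vec M,
    ‖netHessian J w₁ - netHessian J w₂‖ ≤ κH * ‖col w₁ - col w₂‖

/-- The network gradient noise at a (deterministic) network parameter `w`:
approximate minus true gradient, stacked over the agents. -/
noncomputable def netNoise {N M : ℕ} {Ω : Type*} (J : Fin N → Vec M → ℝ)
    (ghat : ℕ → Fin N → Vec M → Ω → Vec M) (n : ℕ) (w : Fin N → Vec M) (ω : Ω) :
    EuclideanSpace ℝ (Fin N × Fin M) :=
  col fun k => ghat n k (w k) ω - gradient (J k) (w k)

/-- The conditional second moment matrix `E[S Sᵀ | m]`, entry by entry. -/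
noncomputable def condCov {ι Ω : Type*} {mΩ : MeasurableSpace Ω} (P : Measure Ω)
    (m : MeasurableSpace Ω) (S : Ω → EuclideanSpace ℝ ι) (ω : Ω) : Matrix ι ι ℝ :=
  Matrix.of fun p q => (P[fun ω' => S ω' p * S ω' q | m]) ω

/-- The conditions on the gradient noise. `ℱ n` is the information available before the `n`-th
update (`n = 0, 1, …`), and `ghat n` is the random gradient approximation used in that update. As
usual the conditions are imposed on all `ℱ n`-measurable arguments `W`; those with a finite fourth
moment are enough, and for them the conditional expectations are ordinary ones. -/
structure NoiseCondition {N M : ℕ} {Ω : Type*} {mΩ : MeasurableSpace Ω} (P : Measure Ω)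
    (ℱ : Filtration ℕ mΩ) (J : Fin N → Vec M → ℝ) (wo : Fin N → Vec M)
    (ghat : ℕ → Fin N → Vec M → Ω → Vec M) (α σs κs γs : ℝ)
    (Rs : Matrix (Fin N × Fin M) (Fin N × Fin M) ℝ) : Prop where
  α_nonneg : 0 ≤ α
  σs_nonneg : 0 ≤ σs
  κs_nonneg : 0 ≤ κs
  γs_pos : 0 < γs
  γs_le : γs ≤ 4
  adapted : ∀ (n : ℕ) (W : Ω → Fin N → Vec M), StronglyMeasurable[ℱ n] W →
    MemLp (fun ω => col (W ω)) 4 P →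
    StronglyMeasurable[ℱ (n + 1)] fun ω => netNoise J ghat n (W ω) ω
  memLp : ∀ (n : ℕ) (W : Ω → Fin N → Vec M), StronglyMeasurable[ℱ n] W →
    MemLp (fun ω => col (W ω)) 4 P →
    MemLp (fun ω => netNoise J ghat n (W ω) ω) 4 P
  martingale_difference : ∀ (n : ℕ) (W : Ω → Fin N → Vec M), StronglyMeasurable[ℱ n] W →
    MemLp (fun ω => col (W ω)) 4 P →
    ∀ᵐ ω ∂P, (P[fun ω' => netNoise J ghat n (W ω') ω' | ℱ n]) ω = 0
  fourth_moment : ∀ (n : ℕ) (W : Ω → Fin N → Vec M), StronglyMeasurable[ℱ n] W →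
    MemLp (fun ω => col (W ω)) 4 P →
    ∀ᵐ ω ∂P, (P[fun ω' => ‖netNoise J ghat n (W ω') ω'‖ ^ 4 | ℱ n]) ω
      ≤ α ^ 2 * ‖col wo - col (W ω)‖ ^ 4 + σs ^ 4
  lipschitz_cov : ∀ (n : ℕ) (W : Ω → Fin N → Vec M), StronglyMeasurable[ℱ n] W →
    MemLp (fun ω => col (W ω)) 4 P →
    ∀ᵐ ω ∂P, ‖condCov P (ℱ n) (fun ω' => netNoise J ghat n wo ω') ω
        - condCov P (ℱ n) (fun ω' => netNoise J ghat n (W ω') ω') ω‖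
      ≤ κs * ‖col wo - col (W ω)‖ ^ γs
  convergent_cov : ∀ᵐ ω ∂P,
    Tendsto (fun n => condCov P (ℱ n) (fun ω' => netNoise J ghat n wo ω') ω) atTop (𝓝 Rs)
  Rs_posDef : Rs.PosDef

/-- The step-size profile: agent `k` uses the step-size `μ_k = μ_max τ_k`, with `max_k τ_k = 1`. -/
structure IsStepProfile {N : ℕ} (τ : Fin N → ℝ) : Prop where
  pos : ∀ k, 0 < τ k
  le_one : ∀ k, τ k ≤ 1
  attained : ∃ k, τ k = 1

/-- The adapt-then-combine diffusion iterates with step-sizes `μ_k = μ τ_k`, started at zero;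
`estimate … n` is the vector of estimates after `n` updates. -/
noncomputable def estimate {N M : ℕ} {Ω : Type*} (A : Matrix (Fin N) (Fin N) ℝ) (τ : Fin N → ℝ)
    (ghat : ℕ → Fin N → Vec M → Ω → Vec M) (μ : ℝ) : ℕ → Ω → Fin N → Vec M
  | 0 => fun _ _ => 0
  | n + 1 => fun ω k =>
      ∑ l, A l k • (estimate A τ ghat μ n ω l
        - (μ * τ l) • ghat n l (estimate A τ ghat μ n ω l) ω)

/-- The network error vector `W̃ = W° - W` after `n` updates. -/
noncomputable def netError {N M : ℕ} {Ω : Type*} (A : Matrix (Fin N) (Fin N) ℝ) (τ : Fin N → ℝ)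
    (ghat : ℕ → Fin N → Vec M → Ω → Vec M) (wo : Fin N → Vec M) (μ : ℝ) (n : ℕ) (ω : Ω) :
    EuclideanSpace ℝ (Fin N × Fin M) :=
  col wo - col (estimate A τ ghat μ n ω)

/-- The normalized covariance `c⁻¹ E[X Xᵀ]`. -/
noncomputable def normalizedCov {ι Ω : Type*} {mΩ : MeasurableSpace Ω} (P : Measure Ω) (c : ℝ)
    (X : Ω → EuclideanSpace ℝ ι) : Matrix ι ι ℝ :=
  Matrix.of fun p q => c⁻¹ * ∫ ω, X ω p * X ω q ∂P

/-- The stacked Perron vector: each group part is a positive eigenvector of the group's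
combination matrix for the eigenvalue one, with entries adding up to one. -/
structure IsPerron {N G : ℕ} (grp : Fin N → Fin G) (A : Matrix (Fin N) (Fin N) ℝ)
    (p : Fin N → ℝ) : Prop where
  pos : ∀ k, 0 < p k
  eigen : A.mulVec p = p
  sum_one : ∀ m, ∑ k with grp k = m, p k = 1

/-- `H̄ = diag {H̄_1, …, H̄_G}` with `H̄_m = ∑_{k ∈ G_m} p_k (μ_k / μ_max) ∇² J_k(w_k°)`. -/
noncomputable def Hbar {N G M : ℕ} (grp : Fin N → Fin G) (J : Fin N → Vec M → ℝ)
    (wo : Fin N → Vec M) (τ p : Fin N → ℝ) : Matrix (Fin G × Fin M) (Fin G × Fin M) ℝ :=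
  Matrix.of fun x y =>
    if x.1 = y.1 then (∑ k with grp k = x.1, (p k * τ k) • hessian (J k) (wo k)) x.2 y.2 else 0

/-- `diag {p_1^g, …, p_G^g} ⊗ I_M`. -/
noncomputable def bigP {N G : ℕ} (M : ℕ) (grp : Fin N → Fin G) (p : Fin N → ℝ) :
    Matrix (Fin N × Fin M) (Fin G × Fin M) ℝ :=
  (Matrix.of fun k m => if grp k = m then p k else 0) ⊗ₖ (1 : Matrix (Fin M) (Fin M) ℝ)

/-- `μ_max⁻¹ diag {μ_1, …, μ_N} ⊗ I_M`. -/
noncomputable def bigT {N : ℕ} (M : ℕ) (τ : Fin N → ℝ) :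
    Matrix (Fin N × Fin M) (Fin N × Fin M) ℝ :=
  Matrix.diagonal τ ⊗ₖ (1 : Matrix (Fin M) (Fin M) ℝ)

/-- `R̄ = μ_max⁻² 𝒫ᵀ ℳ R_s ℳ 𝒫`. -/
noncomputable def Rbar {N G M : ℕ} (grp : Fin N → Fin G) (τ p : Fin N → ℝ)
    (Rs : Matrix (Fin N × Fin M) (Fin N × Fin M) ℝ) :
    Matrix (Fin G × Fin M) (Fin G × Fin M) ℝ :=
  (bigP M grp p).transpose * bigT M τ * Rs * bigT M τ * bigP M grp p

/-- `Φ` solves the continuous Lyapunov equation `H̄ Φ + Φ H̄ = R̄`. -/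
def IsLyapunovSolution {N G M : ℕ} (grp : Fin N → Fin G) (J : Fin N → Vec M → ℝ)
    (wo : Fin N → Vec M) (τ p : Fin N → ℝ) (Rs : Matrix (Fin N × Fin M) (Fin N × Fin M) ℝ)
    (Φ : Matrix (Fin G × Fin M) (Fin G × Fin M) ℝ) : Prop :=
  Hbar grp J wo τ p * Φ + Φ * Hbar grp J wo τ p = Rbar grp τ p Rs

/-- The `M × M` block `Φ_{m,r}`. -/
def block {G M : ℕ} (Φ : Matrix (Fin G × Fin M) (Fin G × Fin M) ℝ) (m r : Fin G) :
    Matrix (Fin M) (Fin M) ℝ :=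
  Matrix.of fun a b => Φ (m, a) (r, b)

/-- The part of a network matrix whose rows belong to group `m` and columns to group `r`. -/
def groupBlock {N G M : ℕ} (grp : Fin N → Fin G)
    (X : Matrix (Fin N × Fin M) (Fin N × Fin M) ℝ) (m r : Fin G) :
    Matrix ({k // grp k = m} × Fin M) ({k // grp k = r} × Fin M) ℝ :=
  Matrix.of fun x y => X (x.1.1, x.2) (y.1.1, y.2)

/-- `Π` has the block structure given by `Φ`: its `(m,r)` group block is `(1 1ᵀ) ⊗ Φ_{m,r}`. -/
def HasBlockStructure {N G M : ℕ} (grp : Fin N → Fin G)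
    (Φ : Matrix (Fin G × Fin M) (Fin G × Fin M) ℝ)
    (Pi : Matrix (Fin N × Fin M) (Fin N × Fin M) ℝ) : Prop :=
  ∀ m r, groupBlock grp Pi m r =
    (Matrix.of fun _ _ => (1 : ℝ) : Matrix {k // grp k = m} {k // grp k = r} ℝ) ⊗ₖ block Φ m r

end DiffusionNet

open DiffusionNet

/-! With `e = w° - w`, one iteration reads `e' = comb (e + μ • drift e) + μ • noise`; the common
minimizer inside each group makes `w°` invariant under combination. The combination step fixes
vectors that are constant on groups and preserves the Perron-weighted group averages. Hence `e =
spread (avg e) + dev e`, an orthogonal splitting for the weighted square `wsq`, and the two parts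
live on different scales.

On deviations `comb` is a strict contraction whose rate does not depend on `μ`
(`IsPerron.exists_contraction`, a compactness argument resting on connectedness of the groups).
Drift and noise enter with a factor `μ`, so the deviations have second moment `O(μ²)`
(`exists_eventually_dev_moment_le`) and disappear after division by `μ`. The whole error contracts
at a rate proportional to `μ`, because each group contains a strongly convex cost; its fourth moment
is therefore eventually `O(μ²)` (`exists_eventually_fourth_moment_le`).

The averages `x` obey `x' = (1 - μ H̄) x + μ q + μ Q s`, where `Q = 𝒫ᵀ 𝒯` and `q` (`driftError`) is
quadratic in the error plus linear in the deviations, so that `E‖q‖² = O(μ²)`. The noise `s` is a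
martingale difference, and its covariance gets close to `R_s`: the error is small in fourth moment
and the conditional covariance is Hölder (`eventually_noise_moment_sub_le`). Consequently `Y = μ⁻¹
E[x xᵀ]` satisfies `Y' = (1 - μ H̄) Y (1 - μ H̄) + μ Q R_s Qᵀ + o(μ)`. The Lyapunov equation says
precisely that `Φ` is a fixed point of this recursion up to order `μ²`. Thus `Y - Φ` contracts by `1
- λ μ` with forcing `o(μ)` and is eventually small (`eventually_avg_moment_sub_le`). Spreading `Φ`
over the groups gives the block matrix. -/

namespace DiffusionNet

/-! ### Existence and uniqueness of the Perron vector. -/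

section Perron

variable {N G M : ℕ} {T : SimpleGraph (Fin N)} {grp : Fin N → Fin G}
  {A : Matrix (Fin N) (Fin N) ℝ} {wo : Fin N → Vec M}

/-- A property that passes to neighbours in the same group holds on the whole group. -/
theorem IsGrouping.propagate (hgrp : IsGrouping T grp wo) {f : Fin N → Prop}
    (hf : ∀ k l, T.Adj k l → grp k = grp l → f k → f l) {k l : Fin N} (hkl : grp k = grp l)
    (hk : f k) : f l := by
  have hconn := (hgrp.connected (grp l)).preconnected ⟨k, hkl⟩ ⟨l, rfl⟩
  rw [SimpleGraph.reachable_iff_reflTransGen] at hconn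
  have key : ∀ y : ({k | grp k = grp l} : Set (Fin N)),
      Relation.ReflTransGen (T.induce {k | grp k = grp l}).Adj ⟨k, hkl⟩ y → f y := by
    intro y hy
    induction hy with
    | refl => exact hk
    | @tail b c _ hbc ih =>
      have hb : grp b = grp l := b.2
      have hc : grp c = grp l := c.2
      exact hf b c hbc (hb.trans hc.symm) ih
  exact key _ hconn

theorem IsGrouping.exists_mem (hgrp : IsGrouping T grp wo) (m : Fin G) : ∃ k, grp k = m := by
  obtain ⟨k⟩ := (hgrp.connected m).nonempty
  exact ⟨k, k.2⟩

theorem IsCombination.nonneg (hA : IsCombination T grp A) (l k : Fin N) : 0 ≤ A l k := by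
  by_cases h : (l = k ∨ T.Adj l k) ∧ grp l = grp k
  · exact (hA.pos l k h).le
  · exact (hA.zero l k h).ge

theorem IsCombination.eq_zero_of_grp_ne (hA : IsCombination T grp A) {l k : Fin N}
    (h : grp l ≠ grp k) : A l k = 0 :=
  hA.zero l k fun h' => h h'.2

theorem IsCombination.sum_grp (hA : IsCombination T grp A) (m : Fin G) (k : Fin N) :
    ∑ l with grp l = m, A l k = if grp k = m then 1 else 0 := by
  split_ifs with h
  · rw [← hA.sum_one k]
    refine Finset.sum_filter_of_ne fun l _ hl => ?_
    by_contra h'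
    exact hl (hA.eq_zero_of_grp_ne fun h'' => h' (h''.trans h))
  · refine Finset.sum_eq_zero fun l hl => hA.eq_zero_of_grp_ne fun h' => h ?_
    rw [← h', (Finset.mem_filter.mp hl).2]

theorem IsCombination.sum_grp_mulVec (hA : IsCombination T grp A) (m : Fin G)
    (v : Fin N → ℝ) : ∑ k with grp k = m, A.mulVec v k = ∑ k with grp k = m, v k := by
  simp only [Matrix.mulVec, dotProduct]
  rw [Finset.sum_comm]
  simp only [← Finset.sum_mul, hA.sum_grp]
  simp [Finset.sum_filter]

/-- The absolute value of a fixed vector of a column stochastic matrix is fixed. -/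
theorem IsCombination.abs_fixed (hA : IsCombination T grp A) {v : Fin N → ℝ}
    (hv : A.mulVec v = v) : A.mulVec (fun k => |v k|) = fun k => |v k| := by
  have hle : ∀ k ∈ Finset.univ, |v k| ≤ A.mulVec (fun k => |v k|) k := by
    intro k _
    conv_lhs => rw [← hv]
    simp only [Matrix.mulVec, dotProduct]
    refine (Finset.abs_sum_le_sum_abs (fun l => A k l * v l) Finset.univ).trans_eq ?_
    refine Finset.sum_congr rfl fun l _ => ?_
    rw [abs_mul, abs_of_nonneg (hA.nonneg k l)]
  have hsum : ∑ k, |v k| = ∑ k, A.mulVec (fun k => |v k|) k := by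
    simp only [Matrix.mulVec, dotProduct]
    rw [Finset.sum_comm]
    simp only [← Finset.sum_mul, hA.sum_one, one_mul]
  -- The triangle inequality gives `|v| ≤ A |v|` entrywise, and unit column sums make the totals
  -- equal; so every entry is an equality.
  funext k
  exact ((Finset.sum_eq_sum_iff_of_le hle).mp hsum k (Finset.mem_univ k)).symm

/-- Positivity travels along edges: `v b = ∑ j, A b j * v j` is at least `A b a * v a`, positive
when `a` is a neighbour of `b` in its group. Connectedness does the rest. -/
theorem IsCombination.pos_of_fixed (hgrp : IsGrouping T grp wo) (hA : IsCombination T grp A)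
    {v : Fin N → ℝ} (hv : A.mulVec v = v) (hv0 : ∀ k, 0 ≤ v k) {k l : Fin N}
    (hkl : grp k = grp l) (hk : 0 < v k) : 0 < v l := by
  refine hgrp.propagate (f := fun k => 0 < v k) (fun a b hab hg ha => ?_) hkl hk
  rw [← hv]
  refine lt_of_lt_of_le (mul_pos (hA.pos b a ⟨Or.inr hab.symm, hg.symm⟩) ha) ?_
  exact Finset.single_le_sum (f := fun j => A b j * v j)
    (fun j _ => mul_nonneg (hA.nonneg b j) (hv0 j)) (Finset.mem_univ a)

/-- A fixed vector with a positive entry is positive on the whole group of that entry. -/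
theorem IsCombination.pos_of_pos (hgrp : IsGrouping T grp wo) (hA : IsCombination T grp A)
    {v : Fin N → ℝ} (hv : A.mulVec v = v) {k l : Fin N} (hkl : grp k = grp l) (hk : 0 < v k) :
    0 < v l := by
  -- Twice the positive part of `v` is a nonnegative fixed vector, and it vanishes wherever `v` is
  -- nonpositive.
  have h1 : A.mulVec (fun k => |v k| + v k) = fun k => |v k| + v k := by
    have := Matrix.mulVec_add A (fun k => |v k|) v
    rw [hA.abs_fixed hv, hv] at this
    exact this
  have h2 := hA.pos_of_fixed hgrp h1 (fun k => by linarith [neg_abs_le (v k)]) hkl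
    (by have := abs_nonneg (v k); linarith)
  by_contra h
  push Not at h
  simp only [abs_of_nonpos h] at h2
  linarith

/-- A positive entry would make `v` positive on its whole group, contradicting the zero sum there;
the same applies to `-v`. -/
theorem IsCombination.eq_zero_of_fixed (hgrp : IsGrouping T grp wo) (hA : IsCombination T grp A)
    {v : Fin N → ℝ} (hv : A.mulVec v = v) (hsum : ∀ m, ∑ k with grp k = m, v k = 0) :
    v = 0 := by
  have key : ∀ u : Fin N → ℝ, A.mulVec u = u → (∀ m, ∑ k with grp k = m, u k = 0) →
      ∀ k, u k ≤ 0 := by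
    intro u hu hs k
    by_contra h
    push Not at h
    have : 0 < ∑ l with grp l = grp k, u l :=
      Finset.sum_pos (fun l hl => hA.pos_of_pos hgrp hu (Finset.mem_filter.mp hl).2.symm h)
        ⟨k, by simp⟩
    exact this.ne' (hs _)
  funext k
  refine le_antisymm (key v hv hsum k) ?_
  have := key (-v) (by rw [Matrix.mulVec_neg, hv]) (by simpa using hsum) k
  simpa using this

theorem IsCombination.existsUnique_perron (hgrp : IsGrouping T grp wo)
    (hA : IsCombination T grp A) : ∃! p, IsPerron grp A p := by
  -- Adding the group sums to `1 - A` makes it invertible. Since `A` preserves group sums, those of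
  -- `L v` are the group sizes times those of `v`, so `L v = 0` forces `v` to be fixed with zero
  -- sums, and `L p = 1` forces `p` to be fixed with unit sums.
  let L : (Fin N → ℝ) →ₗ[ℝ] (Fin N → ℝ) :=
    { toFun := fun v k => v k - A.mulVec v k + ∑ l with grp l = grp k, v l
      map_add' := fun u v => by
        funext k; simp only [Matrix.mulVec_add, Pi.add_apply, Finset.sum_add_distrib]; ring
      map_smul' := fun c v => by
        funext k
        simp only [Matrix.mulVec_smul, Pi.smul_apply, smul_eq_mul, RingHom.id_apply,
          ← Finset.mul_sum]
        ring }
  have hLsum : ∀ v m, ∑ k with grp k = m, L v k =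
      (Finset.card {k | grp k = m} : ℝ) * ∑ k with grp k = m, v k := by
    intro v m
    have : ∀ k ∈ Finset.univ.filter (fun k => grp k = m), L v k =
        v k - A.mulVec v k + ∑ l with grp l = m, v l := by
      intro k hk
      simp only [L, LinearMap.coe_mk, AddHom.coe_mk, (Finset.mem_filter.mp hk).2]
    rw [Finset.sum_congr rfl this, Finset.sum_add_distrib, Finset.sum_sub_distrib,
      hA.sum_grp_mulVec]
    simp
  have hcard : ∀ m, (Finset.card {k | grp k = m} : ℝ) ≠ 0 := by
    intro m
    obtain ⟨k, hk⟩ := hgrp.exists_mem m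
    exact Nat.cast_ne_zero.mpr (Finset.card_ne_zero.mpr ⟨k, by simpa using hk⟩)
  have hinj : Function.Injective L := by
    rw [← LinearMap.ker_eq_bot, LinearMap.ker_eq_bot']
    intro v hv
    have hs : ∀ m, ∑ k with grp k = m, v k = 0 := fun m => by
      have h := hLsum v m
      rw [hv] at h
      simpa [hcard m] using h.symm
    refine hA.eq_zero_of_fixed hgrp ?_ hs
    funext k
    have := congrFun hv k
    simp only [L, LinearMap.coe_mk, AddHom.coe_mk, hs, Pi.zero_apply] at this
    linarith
  obtain ⟨p, hp⟩ := (LinearMap.injective_iff_surjective.mp hinj) 1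
  have hs : ∀ m, ∑ k with grp k = m, p k = 1 := fun m => by
    have h := hLsum p m
    rw [hp] at h
    simp only [Pi.one_apply, Finset.sum_const, nsmul_eq_mul, mul_one] at h
    exact (mul_left_cancel₀ (hcard m) (by rw [mul_one]; exact h)).symm
  have hfix : A.mulVec p = p := by
    funext k
    have := congrFun hp k
    simp only [L, LinearMap.coe_mk, AddHom.coe_mk, hs, Pi.one_apply] at this
    linarith
  refine ⟨p, ⟨fun k => ?_, hfix, hs⟩, fun q hq => ?_⟩
  · obtain ⟨l, hl, hpl⟩ : ∃ l, grp l = grp k ∧ 0 < p l := by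
      by_contra h
      push Not at h
      have : ∑ l with grp l = grp k, p l ≤ 0 :=
        Finset.sum_nonpos fun l hl => h l (Finset.mem_filter.mp hl).2
      linarith [hs (grp k)]
    exact hA.pos_of_pos hgrp hfix hl hpl
  · refine sub_eq_zero.mp (hA.eq_zero_of_fixed hgrp (v := q - p) ?_ fun m => ?_)
    · rw [Matrix.mulVec_sub, hq.eigen, hfix]
    · simp [Finset.sum_sub_distrib, hq.sum_one, hs]

end Perron

/-! ### Group averages, deviations, and contraction of the deviations by combination. -/

section Groups

variable {N G M : ℕ}

/-- The combination step `(comb A e)_k = ∑_l a_{lk} e_l`. -/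
noncomputable def comb (A : Matrix (Fin N) (Fin N) ℝ) :
    (Fin N → Vec M) →ₗ[ℝ] (Fin N → Vec M) :=
  LinearMap.pi fun k => ∑ l, A l k • LinearMap.proj l

/-- The group averages with weights `p`. -/
noncomputable def avg (grp : Fin N → Fin G) (p : Fin N → ℝ) :
    (Fin N → Vec M) →ₗ[ℝ] (Fin G → Vec M) :=
  LinearMap.pi fun m => ∑ k with grp k = m, p k • LinearMap.proj k

/-- Every agent of a group receives the vector of the group. -/
def spread (grp : Fin N → Fin G) : (Fin G → Vec M) →ₗ[ℝ] (Fin N → Vec M) :=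
  LinearMap.funLeft ℝ (Vec M) grp

/-- The deviation from the group averages. -/
noncomputable def dev (grp : Fin N → Fin G) (p : Fin N → ℝ) :
    (Fin N → Vec M) →ₗ[ℝ] (Fin N → Vec M) :=
  LinearMap.id - spread grp ∘ₗ avg grp p

/-- The weighted sum of squares `∑_k p_k ‖e_k‖²`. -/
noncomputable def wsq (p : Fin N → ℝ) (e : Fin N → Vec M) : ℝ := ∑ k, p k * ‖e k‖ ^ 2

theorem comb_apply (A : Matrix (Fin N) (Fin N) ℝ) (e : Fin N → Vec M) (k : Fin N) :
    comb A e k = ∑ l, A l k • e l := by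
  simp [comb]

theorem avg_apply (grp : Fin N → Fin G) (p : Fin N → ℝ) (e : Fin N → Vec M) (m : Fin G) :
    avg grp p e m = ∑ k with grp k = m, p k • e k := by
  simp [avg]

theorem dev_apply (grp : Fin N → Fin G) (p : Fin N → ℝ) (e : Fin N → Vec M) (k : Fin N) :
    dev grp p e k = e k - avg grp p e (grp k) := by
  simp [dev, spread, LinearMap.funLeft_apply]

theorem spread_apply (grp : Fin N → Fin G) (x : Fin G → Vec M) (k : Fin N) :
    spread grp x k = x (grp k) := rfl

theorem spread_avg_add_dev (grp : Fin N → Fin G) (p : Fin N → ℝ) (e : Fin N → Vec M) :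
    spread grp (avg grp p e) + dev grp p e = e := by
  simp [dev]

variable {T : SimpleGraph (Fin N)} {grp : Fin N → Fin G}
  {A : Matrix (Fin N) (Fin N) ℝ} {wo : Fin N → Vec M} {p : Fin N → ℝ}

theorem wsq_nonneg (hp : ∀ k, 0 ≤ p k) (e : Fin N → Vec M) : 0 ≤ wsq p e :=
  Finset.sum_nonneg fun k _ => mul_nonneg (hp k) (sq_nonneg _)

theorem wsq_smul (p : Fin N → ℝ) (c : ℝ) (e : Fin N → Vec M) :
    wsq p (c • e) = c ^ 2 * wsq p e := by
  simp only [wsq, Pi.smul_apply, norm_smul, mul_pow, Finset.mul_sum, Real.norm_eq_abs, sq_abs]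
  exact Finset.sum_congr rfl fun k _ => by ring

theorem continuous_wsq (p : Fin N → ℝ) : Continuous (wsq (M := M) p) := by
  unfold wsq
  fun_prop

theorem IsPerron.sum_fiber (hp : IsPerron grp A p) (f : Fin G → ℝ) :
    ∑ k, p k * f (grp k) = ∑ m, f m := by
  rw [← Finset.sum_fiberwise Finset.univ grp]
  refine Finset.sum_congr rfl fun m _ => ?_
  rw [Finset.sum_congr rfl fun k hk => by rw [(Finset.mem_filter.mp hk).2], ← Finset.sum_mul,
    hp.sum_one, one_mul]

theorem IsPerron.avg_spread (hp : IsPerron grp A p) (x : Fin G → Vec M) :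
    avg grp p (spread grp x) = x := by
  funext m
  rw [avg_apply, Finset.sum_congr rfl (g := fun k => p k • x m) fun k hk => by
    rw [spread_apply, (Finset.mem_filter.mp hk).2], ← Finset.sum_smul, hp.sum_one, one_smul]

theorem IsPerron.avg_dev (hp : IsPerron grp A p) (e : Fin N → Vec M) :
    avg grp p (dev grp p e) = 0 := by
  have h := congrArg (avg grp p) (spread_avg_add_dev grp p e)
  rw [map_add, hp.avg_spread] at h
  simpa using h

/-- The decomposition into group averages and deviations is orthogonal. -/
theorem IsPerron.wsq_spread_add (hp : IsPerron grp A p) (x : Fin G → Vec M)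
    {y : Fin N → Vec M} (hy : avg grp p y = 0) :
    wsq p (spread grp x + y) = ∑ m, ‖x m‖ ^ 2 + wsq p y := by
  have hcross : ∑ k, p k * inner ℝ (x (grp k)) (y k) = 0 := by
    rw [← Finset.sum_fiberwise Finset.univ grp]
    refine Finset.sum_eq_zero fun m _ => ?_
    have : ∑ k with grp k = m, p k * inner ℝ (x (grp k)) (y k) =
        inner ℝ (x m) (avg grp p y m) := by
      rw [avg_apply, inner_sum]
      refine Finset.sum_congr rfl fun k hk => ?_
      rw [real_inner_smul_right, (Finset.mem_filter.mp hk).2]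
    rw [this, hy]
    simp
  have h1 : ∑ k, p k * ‖x (grp k)‖ ^ 2 = ∑ m, ‖x m‖ ^ 2 := hp.sum_fiber fun m => ‖x m‖ ^ 2
  have : wsq p (spread grp x + y) = ∑ k, p k * ‖x (grp k)‖ ^ 2
      + 2 * ∑ k, p k * inner ℝ (x (grp k)) (y k) + wsq p y := by
    simp only [wsq, Finset.mul_sum, ← Finset.sum_add_distrib]
    refine Finset.sum_congr rfl fun k _ => ?_
    rw [Pi.add_apply, spread_apply, norm_add_sq_real]
    ring
  rw [this, hcross, h1]
  ring

theorem IsPerron.wsq_eq (hp : IsPerron grp A p) (e : Fin N → Vec M) :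
    wsq p e = ∑ m, ‖avg grp p e m‖ ^ 2 + wsq p (dev grp p e) := by
  conv_lhs => rw [← spread_avg_add_dev grp p e]
  exact hp.wsq_spread_add _ (hp.avg_dev e)

theorem IsPerron.avg_comb (hA : IsCombination T grp A) (hp : IsPerron grp A p)
    (e : Fin N → Vec M) : avg grp p (comb A e) = avg grp p e := by
  funext m
  simp only [avg_apply, comb_apply, Finset.smul_sum, smul_smul]
  rw [Finset.sum_comm]
  simp only [← Finset.sum_smul]
  rw [Finset.sum_filter]
  refine Finset.sum_congr rfl fun l _ => ?_
  -- The equation `A p = p` read within one group: invariance of the Perron weights is what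
  -- preserves the averages.
  have h : ∑ k with grp k = m, p k * A l k = if grp l = m then p l else 0 := by
    split_ifs with h
    · conv_rhs => rw [← hp.eigen]
      simp only [Matrix.mulVec, dotProduct]
      rw [Finset.sum_filter]
      refine Finset.sum_congr rfl fun k _ => ?_
      split_ifs with hk
      · ring
      · rw [hA.eq_zero_of_grp_ne fun h' => hk (h'.symm.trans h)]; ring
    · refine Finset.sum_eq_zero fun k hk => ?_
      rw [hA.eq_zero_of_grp_ne fun h' => h (h'.trans (Finset.mem_filter.mp hk).2), mul_zero]
  rw [h]
  split_ifs <;> simp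

theorem IsCombination.comb_spread (hA : IsCombination T grp A) (x : Fin G → Vec M) :
    comb A (spread grp x) = spread grp x := by
  funext k
  rw [comb_apply, spread_apply]
  conv_rhs => rw [← one_smul ℝ (x (grp k)), ← hA.sum_one k, Finset.sum_smul]
  refine Finset.sum_congr rfl fun l _ => ?_
  by_cases h : grp l = grp k
  · rw [spread_apply, h]
  · rw [hA.eq_zero_of_grp_ne h, zero_smul, zero_smul]

theorem IsPerron.dev_comb (hA : IsCombination T grp A) (hp : IsPerron grp A p)
    (e : Fin N → Vec M) : dev grp p (comb A e) = comb A (dev grp p e) := by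
  simp only [dev, LinearMap.sub_apply, LinearMap.id_apply, LinearMap.comp_apply, map_sub,
    hp.avg_comb hA, hA.comb_spread]

/-- The defect in Jensen's inequality for the square is a variance. Each `comb A e k` is a convex
combination with weights `A l k`, and `A p = p` turns the weighted sum of mean squares back into
`wsq p e`. -/
theorem IsPerron.wsq_sub_wsq_comb (hA : IsCombination T grp A) (hp : IsPerron grp A p)
    (e : Fin N → Vec M) :
    wsq p e - wsq p (comb A e) = ∑ k, p k * ∑ l, A l k * ‖e l - comb A e k‖ ^ 2 := by
  have h1 : wsq p e = ∑ k, p k * ∑ l, A l k * ‖e l‖ ^ 2 := by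
    simp only [wsq, Finset.mul_sum]
    rw [Finset.sum_comm]
    refine Finset.sum_congr rfl fun l _ => ?_
    conv_lhs => rw [← hp.eigen]
    simp only [Matrix.mulVec, dotProduct, Finset.sum_mul]
    exact Finset.sum_congr rfl fun k _ => by ring
  rw [h1]
  simp only [wsq, ← Finset.sum_sub_distrib]
  refine Finset.sum_congr rfl fun k _ => ?_
  rw [← mul_sub]
  congr 1
  have h2 : ∑ l, A l k * ‖e l - comb A e k‖ ^ 2 = ∑ l, A l k * ‖e l‖ ^ 2
      - 2 * inner ℝ (∑ l, A l k • e l) (comb A e k) + (∑ l, A l k) * ‖comb A e k‖ ^ 2 := by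
    rw [sum_inner, Finset.mul_sum, Finset.sum_mul, ← Finset.sum_sub_distrib,
      ← Finset.sum_add_distrib]
    refine Finset.sum_congr rfl fun l _ => ?_
    rw [norm_sub_sq_real, real_inner_smul_left]
    ring
  rw [h2, ← comb_apply, hA.sum_one, real_inner_self_eq_norm_sq]
  ring

theorem IsPerron.wsq_comb_le (hA : IsCombination T grp A) (hp : IsPerron grp A p)
    (e : Fin N → Vec M) : wsq p (comb A e) ≤ wsq p e := by
  have h := hp.wsq_sub_wsq_comb hA e
  have : 0 ≤ ∑ k, p k * ∑ l, A l k * ‖e l - comb A e k‖ ^ 2 :=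
    Finset.sum_nonneg fun k _ => mul_nonneg (hp.pos k).le
      (Finset.sum_nonneg fun l _ => mul_nonneg (hA.nonneg l k) (sq_nonneg _))
  linarith

/-- If the Jensen defect vanishes, all neighbours of `k` in its group, and `k` itself, carry the
value `comb A y k`. By connectedness `y` is then constant on groups, and a zero average leaves only
zero. -/
theorem IsPerron.eq_zero_of_wsq_comb_eq (hgrp : IsGrouping T grp wo)
    (hA : IsCombination T grp A) (hp : IsPerron grp A p) {y : Fin N → Vec M}
    (hy : avg grp p y = 0) (h : wsq p (comb A y) = wsq p y) : y = 0 := by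
  have h0 := hp.wsq_sub_wsq_comb hA y
  rw [h, sub_self, eq_comm, Finset.sum_eq_zero_iff_of_nonneg fun k _ =>
    mul_nonneg (hp.pos k).le
      (Finset.sum_nonneg fun l _ => mul_nonneg (hA.nonneg l k) (sq_nonneg _))] at h0
  have h1 : ∀ l k, 0 < A l k → y l = comb A y k := by
    intro l k hlk
    have h2 := (mul_eq_zero.mp (h0 k (Finset.mem_univ k))).resolve_left (hp.pos k).ne'
    rw [Finset.sum_eq_zero_iff_of_nonneg fun l _ =>
      mul_nonneg (hA.nonneg l k) (sq_nonneg _)] at h2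
    have h3 := (mul_eq_zero.mp (h2 l (Finset.mem_univ l))).resolve_left hlk.ne'
    rwa [sq_eq_zero_iff, norm_eq_zero, sub_eq_zero] at h3
  funext k
  have hconst : ∀ l, grp k = grp l → y l = y k := fun l hl =>
    hgrp.propagate (f := fun l => y l = y k) (fun a b hab hg ha => by
      rw [← ha, h1 a a (hA.pos a a ⟨Or.inl rfl, rfl⟩)]
      exact h1 b a (hA.pos b a ⟨Or.inr hab.symm, hg.symm⟩)) hl rfl
  have h4 := congrFun hy (grp k)
  rw [avg_apply, Finset.sum_congr rfl (g := fun l => p l • y k) fun l hl => by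
    rw [hconst l (Finset.mem_filter.mp hl).2.symm], ← Finset.sum_smul, hp.sum_one,
    one_smul] at h4
  exact h4

theorem IsPerron.norm_le_of_wsq (hp : IsPerron grp A p) {y : Fin N → Vec M} (k : Fin N) :
    p k * ‖y k‖ ^ 2 ≤ wsq p y :=
  Finset.single_le_sum (f := fun k => p k * ‖y k‖ ^ 2)
    (fun j _ => mul_nonneg (hp.pos j).le (sq_nonneg _)) (Finset.mem_univ k)

theorem IsPerron.isCompact_unit (hp : IsPerron grp A p) :
    IsCompact {y : Fin N → Vec M | avg grp p y = 0 ∧ wsq p y = 1} := by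
  refine Metric.isCompact_of_isClosed_isBounded ?_ ?_
  · exact (isClosed_eq (LinearMap.continuous_of_finiteDimensional _) continuous_const).inter
      (isClosed_eq (continuous_wsq p) continuous_const)
  · rw [isBounded_iff_forall_norm_le]
    refine ⟨∑ k, (1 + (p k)⁻¹), fun y hy => ?_⟩
    have hnn : ∀ k, 0 ≤ 1 + (p k)⁻¹ := fun k => by have := hp.pos k; positivity
    refine (pi_norm_le_iff_of_nonneg (Finset.sum_nonneg fun k _ => hnn k)).mpr fun k => ?_
    refine le_trans ?_ (Finset.single_le_sum (fun k _ => hnn k) (Finset.mem_univ k))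
    have h1 := hp.norm_le_of_wsq (y := y) k
    rw [hy.2] at h1
    have h2 : ‖y k‖ ^ 2 ≤ (p k)⁻¹ := by
      rw [← one_div, le_div_iff₀ (hp.pos k)]; linarith
    nlinarith [sq_nonneg (‖y k‖ - 1), norm_nonneg (y k)]

/-- The combination step is a strict contraction on deviations. -/
theorem IsPerron.exists_contraction (hgrp : IsGrouping T grp wo)
    (hA : IsCombination T grp A) (hp : IsPerron grp A p) :
    ∃ c : ℝ, 0 < c ∧ c < 1 ∧ ∀ y : Fin N → Vec M, avg grp p y = 0 →
      wsq p (comb A y) ≤ (1 - c) * wsq p y := by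
  have hcont : Continuous fun y : Fin N → Vec M => wsq p (comb A y) :=
    (continuous_wsq p).comp (LinearMap.continuous_of_finiteDimensional _)
  obtain ⟨b, hb1, hb⟩ : ∃ b : ℝ, b < 1 ∧ ∀ y : Fin N → Vec M,
      avg grp p y = 0 ∧ wsq p y = 1 → wsq p (comb A y) ≤ b := by
    rcases Set.eq_empty_or_nonempty {y : Fin N → Vec M | avg grp p y = 0 ∧ wsq p y = 1} with
      h | h
    -- The unit sphere of the deviations can be empty, for instance when all groups are singletons.
    · exact ⟨0, one_pos, fun y hy => absurd (show y ∈ {y : Fin N → Vec M |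
        avg grp p y = 0 ∧ wsq p y = 1} from hy) (by rw [h]; exact Set.notMem_empty y)⟩
    · obtain ⟨y₀, ⟨hav, hone⟩, hmax⟩ := hp.isCompact_unit.exists_isMaxOn h hcont.continuousOn
      refine ⟨wsq p (comb A y₀), ?_, fun y hy => isMaxOn_iff.mp hmax y hy⟩
      refine lt_of_le_of_ne ((hp.wsq_comb_le hA y₀).trans_eq hone) fun heq => ?_
      have := hp.eq_zero_of_wsq_comb_eq hgrp hA hav (by rw [heq, hone])
      rw [this] at hone
      simp [wsq] at hone
  -- Homogeneity extends the bound from the unit sphere; the maximum with `1 / 2` ensures that the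
  -- final constant `c` is below one.
  have hbpos : ∀ y : Fin N → Vec M, avg grp p y = 0 →
      wsq p (comb A y) ≤ max b (1 / 2) * wsq p y := by
    intro y hy
    have hnn := wsq_nonneg (fun k => (hp.pos k).le) y
    rcases hnn.eq_or_lt with h | h
    · rw [← h, mul_zero]; exact (hp.wsq_comb_le hA y).trans_eq h.symm
    · have h1 : (Real.sqrt (wsq p y))⁻¹ ^ 2 = (wsq p y)⁻¹ := by
        rw [inv_pow, Real.sq_sqrt hnn]
      have h2 := hb ((Real.sqrt (wsq p y))⁻¹ • y) ⟨by rw [map_smul, hy, smul_zero], by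
        rw [wsq_smul, h1, inv_mul_cancel₀ h.ne']⟩
      rw [map_smul, wsq_smul, h1, inv_mul_le_iff₀ h] at h2
      nlinarith [le_max_left b (1 / 2)]
  refine ⟨1 - max b (1 / 2), by simpa using ⟨hb1, by norm_num⟩, ?_, fun y hy => ?_⟩
  · have := le_max_right b (1 / 2); linarith
  · rw [sub_sub_cancel]; exact hbpos y hy

end Groups

/-! ### Stacking and Euclidean norms. -/

section Col

variable {N M : ℕ}

/-- Stacking as a continuous linear map. -/
noncomputable def colL (N M : ℕ) :
    (Fin N → Vec M) →L[ℝ] EuclideanSpace ℝ (Fin N × Fin M) :=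
  LinearMap.toContinuousLinearMap
    { toFun := col
      map_add' := fun _ _ => rfl
      map_smul' := fun _ _ => rfl }

theorem colL_apply (w : Fin N → Vec M) : colL N M w = col w := rfl

theorem col_apply (w : Fin N → Vec M) (k : Fin N) (a : Fin M) : col w (k, a) = w k a := rfl

theorem norm_col_sq (w : Fin N → Vec M) : ‖col w‖ ^ 2 = ∑ k, ‖w k‖ ^ 2 := by
  rw [EuclideanSpace.norm_sq_eq, Fintype.sum_prod_type]
  refine Finset.sum_congr rfl fun k _ => ?_
  rw [EuclideanSpace.norm_sq_eq]
  rfl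

theorem norm_apply_le_norm_col (w : Fin N → Vec M) (k : Fin N) : ‖w k‖ ≤ ‖col w‖ := by
  refine (sq_le_sq₀ (norm_nonneg _) (norm_nonneg _)).mp ?_
  rw [norm_col_sq]
  exact Finset.single_le_sum (f := fun k => ‖w k‖ ^ 2) (fun _ _ => sq_nonneg _)
    (Finset.mem_univ k)

theorem norm_col_single (k : Fin N) (u : Vec M) : ‖col (Pi.single k u)‖ = ‖u‖ := by
  refine (sq_eq_sq₀ (norm_nonneg _) (norm_nonneg _)).mp ?_
  rw [norm_col_sq, Finset.sum_eq_single k]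
  · rw [Pi.single_eq_same]
  · intro l _ hl
    rw [Pi.single_eq_of_ne hl]; simp
  · simp

end Col

/-! ### Hessian matrices as second derivatives, and gradients as duals of derivatives. -/

section Hessian

variable {M : ℕ} {f : Vec M → ℝ}

theorem fderiv_fderiv_apply (f : Vec M → ℝ) (w u v : Vec M) :
    fderiv ℝ (fderiv ℝ f) w u v
      = inner ℝ u (Matrix.toEuclideanCLM (𝕜 := ℝ) (hessian f w) v) := by
  rw [Matrix.inner_toEuclideanCLM]
  have hu : u = ∑ a, u a • EuclideanSpace.single a (1 : ℝ) := by
    ext b; simp [Finset.sum_apply, Pi.single_apply]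
  have hv : v = ∑ a, v a • EuclideanSpace.single a (1 : ℝ) := by
    ext b; simp [Finset.sum_apply, Pi.single_apply]
  conv_lhs => rw [hu, hv]
  simp only [map_sum, map_smul, _root_.sum_apply, _root_.smul_apply,
    smul_eq_mul, dotProduct, Matrix.mulVec, Finset.mul_sum, hessian, Matrix.of_apply]
  rw [Finset.sum_comm]
  refine Finset.sum_congr rfl fun a _ => Finset.sum_congr rfl fun b _ => by ring

theorem norm_fderiv_fderiv_sub_le (f : Vec M → ℝ) (w w' : Vec M) :
    ‖fderiv ℝ (fderiv ℝ f) w - fderiv ℝ (fderiv ℝ f) w'‖ ≤ ‖hessian f w - hessian f w'‖ := by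
  refine ContinuousLinearMap.opNorm_le_bound _ (norm_nonneg _) fun u => ?_
  refine ContinuousLinearMap.opNorm_le_bound _ (by positivity) fun v => ?_
  rw [_root_.sub_apply, _root_.sub_apply, fderiv_fderiv_apply,
    fderiv_fderiv_apply, ← inner_sub_right, ← _root_.sub_apply, ← map_sub]
  refine (norm_inner_le_norm _ _).trans ?_
  rw [mul_comm ‖hessian f w - hessian f w'‖, mul_assoc]
  gcongr
  exact (ContinuousLinearMap.le_opNorm _ _).trans_eq
    (by rw [Matrix.l2_opNorm_toEuclideanCLM])

theorem inner_toEuclideanCLM_nonneg {ι : Type*} [Fintype ι] [DecidableEq ι]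
    {X : Matrix ι ι ℝ} (h : X.PosSemidef) (u : EuclideanSpace ℝ ι) :
    0 ≤ inner ℝ u (Matrix.toEuclideanCLM (𝕜 := ℝ) X u) := by
  rw [Matrix.inner_toEuclideanCLM]
  simpa using h.dotProduct_mulVec_nonneg u

theorem toEuclideanCLM_sub_smul_one {ι : Type*} [Fintype ι] [DecidableEq ι]
    (X : Matrix ι ι ℝ) (c : ℝ) (u : EuclideanSpace ℝ ι) :
    inner ℝ u (Matrix.toEuclideanCLM (𝕜 := ℝ) (X - c • (1 : Matrix ι ι ℝ)) u)
      = inner ℝ u (Matrix.toEuclideanCLM (𝕜 := ℝ) X u) - c * ‖u‖ ^ 2 := by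
  rw [map_sub, map_smul, map_one, _root_.sub_apply, _root_.smul_apply,
    _root_.one_apply_eq_self, inner_sub_right, real_inner_smul_right,
    real_inner_self_eq_norm_sq]

theorem inner_toEuclideanCLM_comm {ι : Type*} [Fintype ι] [DecidableEq ι]
    {X : Matrix ι ι ℝ} (h : X.IsHermitian) (u v : EuclideanSpace ℝ ι) :
    inner ℝ u (Matrix.toEuclideanCLM (𝕜 := ℝ) X v)
      = inner ℝ v (Matrix.toEuclideanCLM (𝕜 := ℝ) X u) := by
  have h1 : ContinuousLinearMap.adjoint (Matrix.toEuclideanCLM (𝕜 := ℝ) X)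
      = Matrix.toEuclideanCLM (𝕜 := ℝ) X := by
    rw [← ContinuousLinearMap.star_eq_adjoint, ← map_star]
    exact congrArg _ h
  rw [← ContinuousLinearMap.adjoint_inner_left, h1, real_inner_comm]

/-- A positive semidefinite matrix bounded by `c • 1` has norm at most `c`. -/
theorem norm_le_of_posSemidef {ι : Type*} [Fintype ι] [DecidableEq ι]
    {X : Matrix ι ι ℝ} {c : ℝ} (hc : 0 < c) (h : X.PosSemidef)
    (h' : (c • (1 : Matrix ι ι ℝ) - X).PosSemidef) : ‖X‖ ≤ c := by
  rw [← Matrix.l2_opNorm_toEuclideanCLM]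
  refine ContinuousLinearMap.opNorm_le_bound _ hc.le fun v => ?_
  set B := Matrix.toEuclideanCLM (𝕜 := ℝ) X with hB
  have hup : ∀ u, inner ℝ u (B u) ≤ c * ‖u‖ ^ 2 := fun u => by
    have h1 := inner_toEuclideanCLM_nonneg h' u
    have h2 := toEuclideanCLM_sub_smul_one X c u
    rw [← neg_sub, map_neg, _root_.neg_apply, inner_neg_right, h2] at h1
    linarith
  -- Expanding this nonnegative form gives `2 c⁻¹ ‖B v‖² ≤ c⁻² ⟨B v, B (B v)⟩ + ⟨v, B v⟩`, and the
  -- upper bound on `B` makes the right side at most `c⁻¹ ‖B v‖² + c ‖v‖²`.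
  have h1 := inner_toEuclideanCLM_nonneg h (c⁻¹ • B v - v)
  rw [← hB, map_sub, map_smul, inner_sub_left, inner_sub_right, inner_sub_right,
    real_inner_smul_left, real_inner_smul_left, real_inner_smul_right, real_inner_smul_right,
    inner_toEuclideanCLM_comm h.1 v (B v), ← hB, real_inner_self_eq_norm_sq] at h1
  have h2 := hup (B v)
  have h3 := hup v
  have h4 : ‖B v‖ ^ 2 ≤ (c * ‖v‖) ^ 2 := by
    have e1 : c⁻¹ * (c⁻¹ * inner ℝ (B v) (B (B v))) ≤ c⁻¹ * (c⁻¹ * (c * ‖B v‖ ^ 2)) := by gcongr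
    have e2 : c⁻¹ * (c⁻¹ * (c * ‖B v‖ ^ 2)) = c⁻¹ * ‖B v‖ ^ 2 := by field_simp
    have e3 : c⁻¹ * ‖B v‖ ^ 2 ≤ c * ‖v‖ ^ 2 := by linarith
    rw [inv_mul_le_iff₀ hc] at e3
    nlinarith
  exact (sq_le_sq₀ (norm_nonneg _) (by positivity)).mp h4

theorem gradient_inner (w v : Vec M) : inner ℝ (gradient f w) v = fderiv ℝ f w v := by
  rw [← toDual_gradient, InnerProductSpace.toDual_apply_apply]

/-- The Riesz isomorphism is an isometry, so mean value estimates for `fderiv` carry over to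
gradients. -/
theorem norm_gradient_sub_sub (w w' z : Vec M) (B : Vec M →L[ℝ] Vec M →L[ℝ] ℝ)
    (K : Vec M →L[ℝ] Vec M) (hBK : ∀ u v, B u v = inner ℝ (K u) v) :
    ‖gradient f w - gradient f w' - K z‖ = ‖fderiv ℝ f w - fderiv ℝ f w' - B z‖ := by
  rw [← (InnerProductSpace.toDual ℝ (Vec M)).norm_map, map_sub, map_sub, toDual_gradient,
    toDual_gradient]
  congr 2
  ext v
  rw [InnerProductSpace.toDual_apply_apply, hBK]

theorem norm_gradient_sub (w w' : Vec M) :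
    ‖gradient f w - gradient f w'‖ = ‖fderiv ℝ f w - fderiv ℝ f w'‖ := by
  simpa using norm_gradient_sub_sub (f := f) w w' 0 0 0 (by simp)

end Hessian

/-! ### Consequences of the cost conditions for the gradients. -/

section Cost

variable {N G M : ℕ} {grp : Fin N → Fin G} {J : Fin N → Vec M → ℝ} {wo : Fin N → Vec M}
  {lamL lamU : Fin N → ℝ} {κH : ℝ}

theorem toEuclideanCLM_netHessian (J : Fin N → Vec M → ℝ) (w u : Fin N → Vec M) :
    Matrix.toEuclideanCLM (𝕜 := ℝ) (netHessian J w) (col u)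
      = col fun k => Matrix.toEuclideanCLM (𝕜 := ℝ) (hessian (J k) (w k)) (u k) := by
  ext ⟨k, a⟩
  rw [Matrix.ofLp_toEuclideanCLM, col_apply, Matrix.ofLp_toEuclideanCLM]
  simp only [Matrix.mulVec, dotProduct, netHessian, Matrix.of_apply, Fintype.sum_prod_type,
    col_apply]
  rw [Finset.sum_eq_single k]
  · simp
  · intro l _ hl
    simp [hl.symm]
  · simp

/-- The network condition is tested on two families that differ at agent `k` only, and the resulting
matrix on vectors supported at `k`. -/
theorem CostCondition.hessian_sub_le (hJ : CostCondition grp J wo lamL lamU κH) (k : Fin N)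
    (w w' : Vec M) : ‖hessian (J k) w - hessian (J k) w'‖ ≤ κH * ‖w - w'‖ := by
  have hnet := hJ.hessian_lipschitz (Function.update 0 k w) (Function.update 0 k w')
  have h1 : col (Function.update 0 k w) - col (Function.update 0 k w')
      = col (Pi.single k (w - w') : Fin N → Vec M) := by
    rw [← colL_apply, ← colL_apply, ← map_sub, ← Function.update_sub, sub_zero]
    rfl
  rw [h1, norm_col_single] at hnet
  refine le_trans ?_ hnet
  rw [← Matrix.l2_opNorm_toEuclideanCLM]
  refine ContinuousLinearMap.opNorm_le_bound _ (norm_nonneg _) fun v => ?_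
  have h2 := ContinuousLinearMap.le_opNorm (Matrix.toEuclideanCLM (𝕜 := ℝ)
    (netHessian J (Function.update 0 k w) - netHessian J (Function.update 0 k w')))
    (col (Pi.single k v))
  rw [Matrix.l2_opNorm_toEuclideanCLM, norm_col_single] at h2
  refine le_trans ?_ h2
  rw [map_sub (Matrix.toEuclideanCLM (𝕜 := ℝ)) (netHessian J _), _root_.sub_apply,
    toEuclideanCLM_netHessian, toEuclideanCLM_netHessian, ← colL_apply, ← colL_apply, ← map_sub, colL_apply]
  refine le_trans (le_of_eq ?_) (norm_apply_le_norm_col _ k)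
  simp [map_sub]

theorem CostCondition.hessian_posSemidef (hJ : CostCondition grp J wo lamL lamU κH) (k : Fin N)
    (w : Vec M) : (hessian (J k) w).PosSemidef := by
  have h := (hJ.hessian_lower k w).add
    ((Matrix.PosSemidef.one (n := Fin M) (R := ℝ)).smul (hJ.lamL_nonneg k))
  rwa [sub_add_cancel] at h

/-- The added `1` keeps the bound strictly positive when `lamU k = 0`, as `norm_le_of_posSemidef`
requires. -/
theorem CostCondition.norm_hessian_le (hJ : CostCondition grp J wo lamL lamU κH) (k : Fin N)
    (w : Vec M) : ‖hessian (J k) w‖ ≤ lamU k + 1 := by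
  have h0 : 0 ≤ lamU k := (hJ.lamL_nonneg k).trans (hJ.lamL_le_lamU k)
  refine norm_le_of_posSemidef (by linarith) (hJ.hessian_posSemidef k w) ?_
  have h := (hJ.hessian_upper k w).add (Matrix.PosSemidef.one (n := Fin M) (R := ℝ))
  rwa [sub_add_eq_add_sub, ← one_smul ℝ (1 : Matrix (Fin M) (Fin M) ℝ), smul_smul, mul_one,
    ← add_smul] at h

theorem CostCondition.gradient_wo (hJ : CostCondition grp J wo lamL lamU κH) (k : Fin N) :
    gradient (J k) (wo k) = 0 := by
  have h : fderiv ℝ (J k) (wo k) = 0 :=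
    IsLocalMin.fderiv_eq_zero ((hJ.minimizer k).isLocalMin Filter.univ_mem)
  rw [gradient, h, map_zero]

theorem CostCondition.gradient_lipschitz (hJ : CostCondition grp J wo lamL lamU κH) (k : Fin N)
    (w w' : Vec M) : ‖gradient (J k) w - gradient (J k) w'‖ ≤ (lamU k + 1) * ‖w - w'‖ := by
  rw [norm_gradient_sub]
  refine convex_univ.norm_image_sub_le_of_norm_fderiv_le
    (fun x _ => hJ.differentiable_fderiv k x) (fun x _ => ?_) (Set.mem_univ _) (Set.mem_univ _)
  have h0 : 0 ≤ lamU k := (hJ.lamL_nonneg k).trans (hJ.lamL_le_lamU k)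
  refine ContinuousLinearMap.opNorm_le_bound _ (by linarith) fun u => ?_
  refine ContinuousLinearMap.opNorm_le_bound _ (by positivity) fun v => ?_
  rw [fderiv_fderiv_apply]
  refine (norm_inner_le_norm _ _).trans ?_
  rw [mul_comm (lamU k + 1), mul_assoc]
  gcongr
  refine (ContinuousLinearMap.le_opNorm _ _).trans ?_
  rw [Matrix.l2_opNorm_toEuclideanCLM]
  gcongr
  exact hJ.norm_hessian_le k x

theorem CostCondition.continuous_gradient (hJ : CostCondition grp J wo lamL lamU κH)
    (k : Fin N) : Continuous (gradient (J k)) :=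
  (LipschitzWith.of_dist_le_mul (K := ⟨lamU k + 1,
    add_nonneg ((hJ.lamL_nonneg k).trans (hJ.lamL_le_lamU k)) zero_le_one⟩) fun w w' => by
    rw [dist_eq_norm, dist_eq_norm]
    exact hJ.gradient_lipschitz k w w').continuous

theorem CostCondition.norm_gradient_le (hJ : CostCondition grp J wo lamL lamU κH) (k : Fin N)
    (e : Vec M) : ‖gradient (J k) (wo k - e)‖ ≤ (lamU k + 1) * ‖e‖ := by
  have h := hJ.gradient_lipschitz k (wo k - e) (wo k)
  rwa [hJ.gradient_wo, sub_zero, sub_sub_cancel_left, norm_neg] at h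

/-- The quadratic error of the linearization of the gradient at the minimizer. -/
theorem CostCondition.norm_gradient_add_hessian_le
    (hJ : CostCondition grp J wo lamL lamU κH) (k : Fin N) (e : Vec M) :
    ‖gradient (J k) (wo k - e) + Matrix.toEuclideanCLM (𝕜 := ℝ) (hessian (J k) (wo k)) e‖
      ≤ κH * ‖e‖ ^ 2 := by
  have h1 := norm_gradient_sub_sub (f := J k) (wo k - e) (wo k) (-e)
    (fderiv ℝ (fderiv ℝ (J k)) (wo k)) (Matrix.toEuclideanCLM (𝕜 := ℝ) (hessian (J k) (wo k)))
    (fun u v => by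
      rw [fderiv_fderiv_apply, inner_toEuclideanCLM_comm (hJ.hessian_posSemidef k _).1,
        real_inner_comm])
  rw [hJ.gradient_wo, sub_zero, map_neg, sub_neg_eq_add] at h1
  rw [h1]
  -- On the ball of radius `‖e‖` about the minimizer the second derivative moves by at most `κH *
  -- ‖e‖`; the mean value inequality supplies the other factor `‖e‖`.
  have h2 := (convex_closedBall (wo k) ‖e‖).norm_image_sub_le_of_norm_fderiv_le'
    (f := fderiv ℝ (J k)) (φ := fderiv ℝ (fderiv ℝ (J k)) (wo k)) (C := κH * ‖e‖)
    (x := wo k) (y := wo k - e)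
    (fun x _ => hJ.differentiable_fderiv k x) (fun x hx => by
      refine (norm_fderiv_fderiv_sub_le _ _ _).trans ((hJ.hessian_sub_le k _ _).trans ?_)
      have := hJ.κH_nonneg
      gcongr
      rwa [mem_closedBall_iff_norm] at hx) (by simp) (by simp)
  rw [sub_sub_cancel_left, norm_neg] at h2
  exact h2.trans_eq (by ring)

/-- Strong monotonicity of the gradient at the minimizer. -/
theorem CostCondition.inner_gradient_le (hJ : CostCondition grp J wo lamL lamU κH) (k : Fin N)
    (e : Vec M) : inner ℝ (gradient (J k) (wo k - e)) e ≤ -(lamL k * ‖e‖ ^ 2) := by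
  -- The directional derivative along `e` is followed on the segment from `wo k`, where it is zero,
  -- to `wo k - e`; its slope is at most `-(lamL k * ‖e‖ ^ 2)`.
  have hderiv : ∀ t : ℝ, HasDerivAt (fun t : ℝ => fderiv ℝ (J k) (wo k - t • e) e)
      (-(fderiv ℝ (fderiv ℝ (J k)) (wo k - t • e) e e)) t := by
    intro t
    have h1 : HasDerivAt (fun t : ℝ => wo k - t • e) (-e) t := by
      simpa using ((hasDerivAt_id t).smul_const e).const_sub (wo k)
    have h2 := (hJ.differentiable_fderiv k (wo k - t • e)).hasFDerivAt.comp_hasDerivAt t h1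
    have h3 := (ContinuousLinearMap.apply ℝ ℝ e).hasFDerivAt.comp_hasDerivAt t h2
    have h4 : (ContinuousLinearMap.apply ℝ ℝ e) (fderiv ℝ (fderiv ℝ (J k)) (wo k - t • e) (-e))
        = -(fderiv ℝ (fderiv ℝ (J k)) (wo k - t • e) e e) := by simp
    rw [← h4]
    exact h3
  have hle : ∀ t : ℝ, -(fderiv ℝ (fderiv ℝ (J k)) (wo k - t • e) e e) ≤ -(lamL k * ‖e‖ ^ 2) := by
    intro t
    have h1 := inner_toEuclideanCLM_nonneg (hJ.hessian_lower k (wo k - t • e)) e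
    rw [toEuclideanCLM_sub_smul_one] at h1
    rw [fderiv_fderiv_apply]
    linarith
  have h := image_sub_le_mul_sub_of_deriv_le (f := fun t : ℝ => fderiv ℝ (J k) (wo k - t • e) e)
    (C := -(lamL k * ‖e‖ ^ 2)) (fun t => (hderiv t).differentiableAt)
    (fun t => by rw [(hderiv t).deriv]; exact hle t) zero_le_one
  have h0 : fderiv ℝ (J k) (wo k) = 0 :=
    IsLocalMin.fderiv_eq_zero ((hJ.minimizer k).isLocalMin Filter.univ_mem)
  rw [gradient_inner]
  simpa [h0] using h

end Cost

/-! ### The noiseless step: contraction of the error and of its deviations. -/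

section Step

theorem norm_add_sq_le_young {E : Type*} [SeminormedAddCommGroup E] (a b : E) {t : ℝ}
    (ht : 0 < t) : ‖a + b‖ ^ 2 ≤ (1 + t) * ‖a‖ ^ 2 + (1 + t⁻¹) * ‖b‖ ^ 2 := by
  have h1 : ‖a + b‖ ^ 2 ≤ (‖a‖ + ‖b‖) ^ 2 := by gcongr; exact norm_add_le a b
  have h2 : 0 ≤ t⁻¹ * (t * ‖a‖ - ‖b‖) ^ 2 := by positivity
  have h3 : t⁻¹ * (t * ‖a‖ - ‖b‖) ^ 2 = t * ‖a‖ ^ 2 - 2 * ‖a‖ * ‖b‖ + t⁻¹ * ‖b‖ ^ 2 := by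
    field_simp
    ring
  nlinarith

theorem eventually_lt_nhdsGT_zero {a : ℝ} (ha : 0 < a) : ∀ᶠ μ in 𝓝[>] (0 : ℝ), μ < a :=
  nhdsWithin_le_nhds (eventually_lt_nhds ha)

theorem exists_pos_le_of_fintype {ι : Type*} [Finite ι] {f : ι → ℝ} (hf : ∀ i, 0 < f i) :
    ∃ c, 0 < c ∧ ∀ i, c ≤ f i := by
  cases nonempty_fintype ι
  -- This lower bound also makes sense for an empty index type, where there is no minimum.
  refine ⟨(1 + ∑ i, (f i)⁻¹)⁻¹, ?_, fun i => ?_⟩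
  · have : 0 ≤ ∑ i, (f i)⁻¹ := Finset.sum_nonneg fun i _ => (inv_pos.mpr (hf i)).le
    positivity
  · refine inv_le_of_inv_le₀ (hf i) ?_
    have := Finset.single_le_sum (f := fun i => (f i)⁻¹)
      (fun i _ => (inv_pos.mpr (hf i)).le) (Finset.mem_univ i)
    linarith

variable {N G M : ℕ} {T : SimpleGraph (Fin N)} {grp : Fin N → Fin G}
  {A : Matrix (Fin N) (Fin N) ℝ} {J : Fin N → Vec M → ℝ} {wo : Fin N → Vec M}
  {lamL lamU : Fin N → ℝ} {κH : ℝ} {τ p : Fin N → ℝ}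

/-- The direction of the noiseless adaptation step, in terms of the error `e = w° - w`. -/
noncomputable def drift (J : Fin N → Vec M → ℝ) (wo : Fin N → Vec M) (τ : Fin N → ℝ)
    (e : Fin N → Vec M) : Fin N → Vec M :=
  fun k => τ k • gradient (J k) (wo k - e k)

theorem CostCondition.continuous_drift (hJ : CostCondition grp J wo lamL lamU κH) :
    Continuous (drift J wo τ) := by
  refine continuous_pi fun k => ?_
  have := hJ.continuous_gradient k
  unfold drift
  fun_prop

theorem wsq_add_le (hp : ∀ k, 0 ≤ p k) (a b : Fin N → Vec M) {t : ℝ} (ht : 0 < t) :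
    wsq p (a + b) ≤ (1 + t) * wsq p a + (1 + t⁻¹) * wsq p b := by
  simp only [wsq, Finset.mul_sum, ← Finset.sum_add_distrib]
  refine Finset.sum_le_sum fun k _ => ?_
  have := mul_le_mul_of_nonneg_left (norm_add_sq_le_young (a k) (b k) ht) (hp k)
  rw [Pi.add_apply]
  linarith

theorem IsPerron.wsq_dev_le (hp : IsPerron grp A p) (e : Fin N → Vec M) :
    wsq p (dev grp p e) ≤ wsq p e := by
  rw [hp.wsq_eq e]
  have : 0 ≤ ∑ m, ‖avg grp p e m‖ ^ 2 := Finset.sum_nonneg fun m _ => sq_nonneg _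
  linarith

theorem CostCondition.lamU_add_one_le (hJ : CostCondition grp J wo lamL lamU κH) (k : Fin N) :
    lamU k + 1 ≤ ∑ l, (lamU l + 1) :=
  Finset.single_le_sum (f := fun l => lamU l + 1)
    (fun l _ => by linarith [hJ.lamL_nonneg l, hJ.lamL_le_lamU l]) (Finset.mem_univ k)

theorem CostCondition.norm_drift_le (hJ : CostCondition grp J wo lamL lamU κH)
    (hτ : IsStepProfile τ) (e : Fin N → Vec M) (k : Fin N) :
    ‖drift J wo τ e k‖ ≤ (∑ l, (lamU l + 1)) * ‖e k‖ := by
  rw [drift, norm_smul, Real.norm_of_nonneg (hτ.pos k).le]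
  calc τ k * ‖gradient (J k) (wo k - e k)‖ ≤ 1 * ((lamU k + 1) * ‖e k‖) := by
        gcongr
        · exact hτ.le_one k
        · exact hJ.norm_gradient_le k (e k)
    _ ≤ (∑ l, (lamU l + 1)) * ‖e k‖ := by
        rw [one_mul]
        gcongr
        exact hJ.lamU_add_one_le k

theorem CostCondition.wsq_drift_le (hJ : CostCondition grp J wo lamL lamU κH)
    (hτ : IsStepProfile τ) (hp : ∀ k, 0 ≤ p k) (e : Fin N → Vec M) :
    wsq p (drift J wo τ e) ≤ (∑ l, (lamU l + 1)) ^ 2 * wsq p e := by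
  simp only [wsq, Finset.mul_sum (s := Finset.univ) (f := fun k => p k * ‖e k‖ ^ 2)]
  refine Finset.sum_le_sum fun k _ => ?_
  have h := hJ.norm_drift_le hτ e k
  have h1 : ‖drift J wo τ e k‖ ^ 2 ≤ ((∑ l, (lamU l + 1)) * ‖e k‖) ^ 2 := by gcongr
  have := mul_le_mul_of_nonneg_left h1 (hp k)
  linarith

theorem wsq_add_smul (p : Fin N → ℝ) (e d : Fin N → Vec M) (μ : ℝ) :
    wsq p (e + μ • d) = wsq p e + 2 * μ * ∑ k, p k * inner ℝ (e k) (d k) + μ ^ 2 * wsq p d := by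
  simp only [wsq, Finset.mul_sum, ← Finset.sum_add_distrib]
  refine Finset.sum_congr rfl fun k _ => ?_
  rw [Pi.add_apply, Pi.smul_apply, norm_add_sq_real, real_inner_smul_right, norm_smul, mul_pow,
    Real.norm_eq_abs, sq_abs]
  ring

theorem CostCondition.exists_pos_le_sum_lamL (hJ : CostCondition grp J wo lamL lamU κH)
    (hτ : IsStepProfile τ) (hp : IsPerron grp A p) :
    ∃ lam : ℝ, 0 < lam ∧ ∀ m, lam ≤ ∑ k with grp k = m, p k * τ k * lamL k :=
  exists_pos_le_of_fintype fun m => by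
    obtain ⟨k, hk, hpos⟩ := hJ.strong m
    exact Finset.sum_pos' (fun k _ => mul_nonneg (mul_nonneg (hp.pos k).le (hτ.pos k).le)
      (hJ.lamL_nonneg k)) ⟨k, by simpa using hk, mul_pos (mul_pos (hp.pos k) (hτ.pos k)) hpos⟩

/-- The drift points towards the minimizers, up to the deviations inside the groups. -/
theorem CostCondition.exists_inner_drift_le (hJ : CostCondition grp J wo lamL lamU κH)
    (hτ : IsStepProfile τ) (hp : IsPerron grp A p) :
    ∃ lam : ℝ, 0 < lam ∧ ∀ e : Fin N → Vec M,
      ∑ k, p k * inner ℝ (e k) (drift J wo τ e k) ≤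
        -(lam * ∑ m, ‖avg grp p e m‖ ^ 2) + (∑ l, (lamU l + 1)) * wsq p (dev grp p e) := by
  have hterm : ∀ k, 0 ≤ p k * τ k * lamL k := fun k =>
    mul_nonneg (mul_nonneg (hp.pos k).le (hτ.pos k).le) (hJ.lamL_nonneg k)
  obtain ⟨lam, hlam, hle⟩ := hJ.exists_pos_le_sum_lamL hτ hp
  refine ⟨lam / 2, by positivity, fun e => ?_⟩
  set Λ := ∑ l, (lamU l + 1) with hΛ
  have h1 : ∀ k, p k * inner ℝ (e k) (drift J wo τ e k) ≤
      -(1 / 2 * (p k * τ k * lamL k * ‖avg grp p e (grp k)‖ ^ 2))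
        + Λ * (p k * ‖dev grp p e k‖ ^ 2) := by
    intro k
    have h2 := hJ.inner_gradient_le k (e k)
    have h3 : inner ℝ (e k) (drift J wo τ e k)
        = τ k * inner ℝ (gradient (J k) (wo k - e k)) (e k) := by
      rw [drift, real_inner_smul_right, real_inner_comm]
    -- Individual costs control `‖e k‖²`, some of them with `lamL k = 0`. Passing to the common
    -- group average lets one strongly convex agent serve its whole group; the factor 2 halves
    -- `lam`.
    have h4 : ‖avg grp p e (grp k)‖ ^ 2 ≤ 2 * ‖e k‖ ^ 2 + 2 * ‖dev grp p e k‖ ^ 2 := by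
      have := norm_add_sq_le_young (e k) (-dev grp p e k) one_pos
      rw [norm_neg, ← sub_eq_add_neg, dev_apply, sub_sub_cancel, ← dev_apply] at this
      norm_num at this
      linarith
    have h5 : τ k * lamL k ≤ Λ := by
      have := hτ.le_one k
      nlinarith [hJ.lamU_add_one_le k, hJ.lamL_le_lamU k, hJ.lamL_nonneg k]
    rw [h3]
    have h6 := mul_le_mul_of_nonneg_left h2 (mul_pos (hp.pos k) (hτ.pos k)).le
    have h7 := mul_le_mul_of_nonneg_left h4 (hterm k)
    have h8 : 0 ≤ p k * ‖dev grp p e k‖ ^ 2 := mul_nonneg (hp.pos k).le (sq_nonneg _)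
    nlinarith [mul_le_mul_of_nonneg_right h5 h8]
  refine (Finset.sum_le_sum fun k _ => h1 k).trans ?_
  rw [Finset.sum_add_distrib, Finset.sum_neg_distrib, ← Finset.mul_sum, ← Finset.mul_sum]
  have h9 : lam * ∑ m, ‖avg grp p e m‖ ^ 2 ≤
      ∑ k, p k * τ k * lamL k * ‖avg grp p e (grp k)‖ ^ 2 := by
    rw [← Finset.sum_fiberwise Finset.univ grp, Finset.mul_sum]
    refine Finset.sum_le_sum fun m _ => ?_
    rw [Finset.sum_congr rfl (g := fun k => p k * τ k * lamL k * ‖avg grp p e m‖ ^ 2)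
      fun k hk => by rw [(Finset.mem_filter.mp hk).2], ← Finset.sum_mul]
    exact mul_le_mul_of_nonneg_right (hle m) (sq_nonneg _)
  have h10 : wsq p (dev grp p e) = ∑ k, p k * ‖dev grp p e k‖ ^ 2 := rfl
  rw [h10]
  linarith

/-- For small step-sizes the noiseless step contracts the error. -/
theorem exists_wsq_step_le (hgrp : IsGrouping T grp wo) (hA : IsCombination T grp A)
    (hJ : CostCondition grp J wo lamL lamU κH) (hτ : IsStepProfile τ) (hp : IsPerron grp A p) :
    ∃ c : ℝ, 0 < c ∧ ∀ᶠ μ in 𝓝[>] (0 : ℝ), ∀ e : Fin N → Vec M,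
      wsq p (comb A (e + μ • drift J wo τ e)) ≤ (1 - c * μ) * wsq p e := by
  obtain ⟨c, hc0, hc1, hc⟩ := hp.exists_contraction hgrp hA
  obtain ⟨lam, hlam, hdrift⟩ := hJ.exists_inner_drift_le (τ := τ) hτ hp
  have hp0 : ∀ k, 0 ≤ p k := fun k => (hp.pos k).le
  set Λ := ∑ l, (lamU l + 1) with hΛ
  have hΛ0 : 0 ≤ Λ := Finset.sum_nonneg fun l _ => by
    linarith [hJ.lamL_nonneg l, hJ.lamL_le_lamU l]
  refine ⟨lam, hlam, ?_⟩
  -- The first threshold lets the loss of deviations under combination absorb the adverse drift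
  -- term; the second makes the term quadratic in `μ` at most half of `lam * μ * wsq p e`.
  filter_upwards [self_mem_nhdsWithin,
    eventually_lt_nhdsGT_zero (a := c / (8 * Λ + 8 * lam)) (by positivity),
    eventually_lt_nhdsGT_zero (a := lam / (2 * Λ ^ 2 + 1)) (by positivity)]
    with μ hμ hμ1 hμ2 e
  have hμ0 : 0 < μ := hμ
  rw [lt_div_iff₀ (by positivity)] at hμ1 hμ2
  set d := drift J wo τ e with hd
  set X := ∑ m, ‖avg grp p e m‖ ^ 2 with hX
  set Y := wsq p (dev grp p e) with hY
  have hX0 : 0 ≤ X := Finset.sum_nonneg fun m _ => sq_nonneg _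
  have hY0 : 0 ≤ Y := wsq_nonneg hp0 _
  have hV : wsq p e = X + Y := hp.wsq_eq e
  have hD : wsq p d ≤ Λ ^ 2 * (X + Y) := by rw [← hV]; exact hJ.wsq_drift_le hτ hp0 e
  have hD0 : 0 ≤ wsq p d := wsq_nonneg hp0 _
  -- Combination keeps the averages and removes at least the fraction `c` of the deviations.
  have h1 : wsq p (comb A (e + μ • d)) ≤ wsq p (e + μ • d) - c * wsq p (dev grp p (e + μ • d)) := by
    have h2 := hp.wsq_eq (comb A (e + μ • d))
    rw [hp.avg_comb hA, hp.dev_comb hA] at h2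
    have h3 := hp.wsq_eq (e + μ • d)
    have h4 := hc _ (hp.avg_dev (e + μ • d))
    linarith
  have h5 : Y ≤ 2 * wsq p (dev grp p (e + μ • d)) + 2 * (μ ^ 2 * wsq p d) := by
    have h6 := wsq_add_le hp0 (dev grp p (e + μ • d)) (-(μ • dev grp p d)) one_pos
    have h7 : dev grp p (e + μ • d) + -(μ • dev grp p d) = dev grp p e := by
      rw [map_add, map_smul]; abel
    rw [h7, ← neg_smul, wsq_smul, neg_sq] at h6
    rw [inv_one, one_add_one_eq_two] at h6
    nlinarith [mul_le_mul_of_nonneg_left (hp.wsq_dev_le d) (sq_nonneg μ)]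
  have h8 := wsq_add_smul p e d μ
  have h9 := mul_le_mul_of_nonneg_left (hdrift e) hμ0.le
  rw [← hd, ← hX, ← hY] at h9
  rw [hV] at h8 ⊢
  have h10 : c * Y ≤ c * (2 * wsq p (dev grp p (e + μ • d))) + 2 * (μ ^ 2 * wsq p d) := by
    have := mul_le_mul_of_nonneg_left h5 hc0.le
    have h11 : c * (2 * (μ ^ 2 * wsq p d)) ≤ 1 * (2 * (μ ^ 2 * wsq p d)) := by
      gcongr
    linarith
  have h12 : μ ^ 2 * wsq p d ≤ μ * (lam / 2 * (X + Y)) := by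
    calc μ ^ 2 * wsq p d ≤ μ ^ 2 * (Λ ^ 2 * (X + Y)) := by gcongr
      _ = μ * ((μ * Λ ^ 2) * (X + Y)) := by ring
      _ ≤ μ * (lam / 2 * (X + Y)) := by
        gcongr
        nlinarith
  have h13 : μ * (2 * Λ + 2 * lam) * Y ≤ c / 4 * Y := by
    gcongr
    linarith
  have h14 : 0 ≤ μ * Λ * Y := by positivity
  have h15 : 0 ≤ μ * lam * X := by positivity
  nlinarith

/-- The deviations contract at a rate independent of the step-size. -/
theorem exists_wsq_dev_step_le (hgrp : IsGrouping T grp wo) (hA : IsCombination T grp A)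
    (hJ : CostCondition grp J wo lamL lamU κH) (hτ : IsStepProfile τ) (hp : IsPerron grp A p) :
    ∃ c C : ℝ, 0 < c ∧ c < 1 ∧ 0 < C ∧ ∀ (μ : ℝ) (e : Fin N → Vec M),
      wsq p (dev grp p (comb A (e + μ • drift J wo τ e))) ≤
        (1 - c) * wsq p (dev grp p e) + C * μ ^ 2 * wsq p e := by
  obtain ⟨c, hc0, hc1, hc⟩ := hp.exists_contraction hgrp hA
  have hp0 : ∀ k, 0 ≤ p k := fun k => (hp.pos k).le
  -- Young's inequality with parameter `c / 2` costs half of the contraction, since `(1 - c) * (1 +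
  -- c / 2) ≤ 1 - c / 2`. The final `+ 1` in the constant only secures positivity.
  refine ⟨c / 2, (1 + (c / 2)⁻¹) * (∑ l, (lamU l + 1)) ^ 2 + 1, by positivity, by linarith,
    by positivity, fun μ e => ?_⟩
  set d := drift J wo τ e with hd
  have h1 := hc _ (hp.avg_dev (e + μ • d))
  rw [← hp.dev_comb hA] at h1
  have h2 := wsq_add_le hp0 (dev grp p e) (μ • dev grp p d) (half_pos hc0)
  rw [wsq_smul, ← map_smul, ← map_add] at h2
  have h3 : wsq p (dev grp p d) ≤ (∑ l, (lamU l + 1)) ^ 2 * wsq p e :=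
    (hp.wsq_dev_le d).trans (hJ.wsq_drift_le hτ hp0 e)
  have hY0 : 0 ≤ wsq p (dev grp p e) := wsq_nonneg hp0 _
  have hV0 : 0 ≤ wsq p e := wsq_nonneg hp0 _
  have hd0 : 0 ≤ wsq p (dev grp p d) := wsq_nonneg hp0 _
  have h4 : (1 - c) * wsq p (dev grp p (e + μ • d)) ≤ (1 - c) * ((1 + c / 2) *
      wsq p (dev grp p e) + (1 + (c / 2)⁻¹) * (μ ^ 2 * wsq p (dev grp p d))) := by
    have : 0 ≤ 1 - c := by linarith
    gcongr
  have h5 : (1 - c) * ((1 + (c / 2)⁻¹) * (μ ^ 2 * wsq p (dev grp p d))) ≤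
      1 * ((1 + (c / 2)⁻¹) * (μ ^ 2 * ((∑ l, (lamU l + 1)) ^ 2 * wsq p e))) := by
    gcongr
    linarith
  have h6 : (1 - c) * (1 + c / 2) * wsq p (dev grp p e) ≤ (1 - c / 2) * wsq p (dev grp p e) := by
    gcongr
    nlinarith
  have h7 : 0 ≤ μ ^ 2 * wsq p e := by positivity
  nlinarith

end Step

set_option linter.unusedSectionVars false

/-! ### Moments of sums with martingale differences, and second moment matrices. -/

section Moments

variable {Ω : Type*} {m mΩ : MeasurableSpace Ω} {P : Measure Ω}
  {E : Type*} [NormedAddCommGroup E] {F : Type*} [NormedAddCommGroup F]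

theorem integrable_norm_sq {f : Ω → E} (hf : MemLp f 2 P) :
    Integrable (fun ω => ‖f ω‖ ^ 2) P := by
  have := MemLp.integrable_norm_pow (p := 2) (by exact_mod_cast hf) two_ne_zero
  exact this

theorem integrable_norm_pow_four {f : Ω → E} (hf : MemLp f 4 P) :
    Integrable (fun ω => ‖f ω‖ ^ 4) P := by
  have := MemLp.integrable_norm_pow (p := 4) (by exact_mod_cast hf) four_ne_zero
  exact this

theorem memLp_two_of_four [IsFiniteMeasure P] {f : Ω → E} (hf : MemLp f 4 P) : MemLp f 2 P :=
  hf.mono_exponent (by norm_num)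

/-- The variance of `‖f‖²` is nonnegative. -/
theorem sq_integral_norm_sq_le [IsProbabilityMeasure P] {f : Ω → E} (hf : MemLp f 4 P) :
    (∫ ω, ‖f ω‖ ^ 2 ∂P) ^ 2 ≤ ∫ ω, ‖f ω‖ ^ 4 ∂P := by
  have h2 := integrable_norm_sq (memLp_two_of_four hf)
  have h4 := integrable_norm_pow_four hf
  set I := ∫ ω, ‖f ω‖ ^ 2 ∂P with hI
  have h : 0 ≤ ∫ ω, (‖f ω‖ ^ 4 - 2 * I * ‖f ω‖ ^ 2 + I ^ 2) ∂P :=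
    integral_nonneg fun ω => by
      have : ‖f ω‖ ^ 4 - 2 * I * ‖f ω‖ ^ 2 + I ^ 2 = (‖f ω‖ ^ 2 - I) ^ 2 := by ring
      rw [Pi.zero_apply, this]
      positivity
  have h24 : Integrable (fun ω => ‖f ω‖ ^ 4 - 2 * I * ‖f ω‖ ^ 2) P := h4.sub (h2.const_mul _)
  rw [integral_add h24 (integrable_const _), integral_sub h4 (h2.const_mul _), integral_const_mul, ← hI, integral_const] at h
  simp only [probReal_univ, smul_eq_mul, one_mul] at h
  nlinarith

section Orthogonality

variable [InnerProductSpace ℝ E] [CompleteSpace E]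

/-- A factor measurable with respect to `m` can be pulled out of the conditional expectation, which
leaves `P[s | m] = 0`. -/
theorem integral_inner_eq_zero [IsFiniteMeasure P] (hm : m ≤ mΩ) {Z s : Ω → E}
    (hZ : StronglyMeasurable[m] Z)
    (hs : Integrable s P) (hs0 : P[s | m] =ᵐ[P] 0) (hZs : Integrable (fun ω => inner ℝ (Z ω) (s ω)) P) :
    ∫ ω, inner ℝ (Z ω) (s ω) ∂P = 0 := by
  have h := condExp_bilin_of_stronglyMeasurable_left (innerSL ℝ) hZ hZs hs
  have h' : ∫ ω, (P[fun ω => innerSL ℝ (Z ω) (s ω) | m]) ω ∂P = 0 := by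
    rw [← integral_zero Ω ℝ (μ := P)]
    refine integral_congr_ae ?_
    filter_upwards [h, hs0] with ω h1 h2
    rw [h1, h2]
    simp
  rw [integral_condExp hm] at h'
  exact h'

theorem integrable_inner_of_memLp {a b : Ω → E} (ha : MemLp a 2 P) (hb : MemLp b 2 P) :
    Integrable (fun ω => inner ℝ (a ω) (b ω)) P := by
  refine ((integrable_norm_sq ha).add (integrable_norm_sq hb)).mono'
    (ha.1.inner hb.1) (ae_of_all _ fun ω => ?_)
  refine (norm_inner_le_norm _ _).trans ?_
  simp only [Pi.add_apply]
  nlinarith [sq_nonneg (‖a ω‖ - ‖b ω‖), sq_nonneg (‖a ω‖), sq_nonneg ‖b ω‖]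

theorem integral_norm_add_sq [IsFiniteMeasure P] (hm : m ≤ mΩ) {a b : Ω → E}
    (ha : StronglyMeasurable[m] a) (ha2 : MemLp a 2 P) (hb2 : MemLp b 2 P)
    (hb0 : P[b | m] =ᵐ[P] 0) :
    ∫ ω, ‖a ω + b ω‖ ^ 2 ∂P = ∫ ω, ‖a ω‖ ^ 2 ∂P + ∫ ω, ‖b ω‖ ^ 2 ∂P := by
  have hab := integrable_inner_of_memLp ha2 hb2
  have h0 := integral_inner_eq_zero hm ha (hb2.integrable (by norm_num)) hb0 hab
  simp only [norm_add_sq_real]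
  have h1 : Integrable (fun ω => ‖a ω‖ ^ 2 + 2 * inner ℝ (a ω) (b ω)) P :=
    (integrable_norm_sq ha2).add (hab.const_mul 2)
  rw [integral_add h1 (integrable_norm_sq hb2),
    integral_add (integrable_norm_sq ha2) (hab.const_mul 2), integral_const_mul, h0]
  ring

/-- The part linear in `b` is left as an inner product, because it integrates to zero when `b` is a
martingale difference. The remaining mixed terms amount to `8 ‖a‖² ‖b‖²` and are split by Young's
inequality. -/
theorem norm_add_pow_four_le (a b : E) {t : ℝ} (ht : 0 < t) :
    ‖a + b‖ ^ 4 ≤ (1 + t) * ‖a‖ ^ 4 + (3 + 16 / t) * ‖b‖ ^ 4 + 4 * inner ℝ (‖a‖ ^ 2 • a) b := by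
  have h1 : ‖a + b‖ ^ 4 = (‖a‖ ^ 2 + 2 * inner ℝ a b + ‖b‖ ^ 2) ^ 2 := by
    rw [← norm_add_sq_real]; ring
  have h2 := abs_real_inner_le_norm a b
  have h3 : inner ℝ a b ^ 2 ≤ (‖a‖ * ‖b‖) ^ 2 := sq_le_sq' (by linarith [neg_abs_le (inner ℝ a b)])
    (by linarith [le_abs_self (inner ℝ a b)])
  have h4 : 4 * inner ℝ a b * ‖b‖ ^ 2 ≤ 2 * ‖a‖ ^ 2 * ‖b‖ ^ 2 + 2 * ‖b‖ ^ 4 := by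
    have h5 : inner ℝ a b ≤ ‖a‖ * ‖b‖ := real_inner_le_norm a b
    have h6 : 2 * (‖a‖ * ‖b‖) ≤ ‖a‖ ^ 2 + ‖b‖ ^ 2 := by nlinarith [sq_nonneg (‖a‖ - ‖b‖)]
    nlinarith [sq_nonneg ‖b‖]
  have h7 : 8 * ‖a‖ ^ 2 * ‖b‖ ^ 2 ≤ t * ‖a‖ ^ 4 + 16 / t * ‖b‖ ^ 4 := by
    have : 0 ≤ t⁻¹ * (t * ‖a‖ ^ 2 - 4 * ‖b‖ ^ 2) ^ 2 := by positivity
    have h8 : t⁻¹ * (t * ‖a‖ ^ 2 - 4 * ‖b‖ ^ 2) ^ 2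
        = t * ‖a‖ ^ 4 + 16 / t * ‖b‖ ^ 4 - 8 * ‖a‖ ^ 2 * ‖b‖ ^ 2 := by
      field_simp
      ring
    linarith
  rw [real_inner_smul_left, h1]
  nlinarith

theorem integral_norm_add_pow_four_le [IsFiniteMeasure P] (hm : m ≤ mΩ) {a b : Ω → E}
    (ha : StronglyMeasurable[m] a) (ha4 : MemLp a 4 P) (hb4 : MemLp b 4 P)
    (hb0 : P[b | m] =ᵐ[P] 0) {t : ℝ} (ht : 0 < t) :
    ∫ ω, ‖a ω + b ω‖ ^ 4 ∂P ≤
      (1 + t) * ∫ ω, ‖a ω‖ ^ 4 ∂P + (3 + 16 / t) * ∫ ω, ‖b ω‖ ^ 4 ∂P := by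
  have hZ : StronglyMeasurable[m] fun ω => ‖a ω‖ ^ 2 • a ω := (ha.norm.pow 2).smul ha
  have hia := integrable_norm_pow_four ha4
  have hib := integrable_norm_pow_four hb4
  have hZb : Integrable (fun ω => inner ℝ (‖a ω‖ ^ 2 • a ω) (b ω)) P := by
    refine (hia.add hib).mono' ((hZ.mono hm).aestronglyMeasurable.inner hb4.1)
      (ae_of_all _ fun ω => ?_)
    refine (norm_inner_le_norm _ _).trans ?_
    rw [norm_smul, norm_pow, norm_norm, Pi.add_apply]
    have h1 : 0 ≤ (‖a ω‖ - ‖b ω‖) ^ 2 := sq_nonneg _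
    have h2 : 0 ≤ (‖a ω‖ ^ 2 - ‖b ω‖ ^ 2) ^ 2 := sq_nonneg _
    have h3 : 0 ≤ ‖a ω‖ ^ 2 * (‖a ω‖ - ‖b ω‖) ^ 2 := by positivity
    nlinarith [sq_nonneg (‖a ω‖ ^ 2), sq_nonneg (‖b ω‖ ^ 2)]
  have h0 := integral_inner_eq_zero hm hZ (hb4.integrable (by norm_num)) hb0 hZb
  have h1 : ∫ ω, ‖a ω + b ω‖ ^ 4 ∂P ≤ ∫ ω, ((1 + t) * ‖a ω‖ ^ 4 + (3 + 16 / t) * ‖b ω‖ ^ 4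
      + 4 * inner ℝ (‖a ω‖ ^ 2 • a ω) (b ω)) ∂P :=
    integral_mono (integrable_norm_pow_four (ha4.add hb4))
      (((hia.const_mul _).add (hib.const_mul _)).add (hZb.const_mul 4))
      fun ω => norm_add_pow_four_le (a ω) (b ω) ht
  have h2 : Integrable (fun ω => (1 + t) * ‖a ω‖ ^ 4 + (3 + 16 / t) * ‖b ω‖ ^ 4) P :=
    (hia.const_mul _).add (hib.const_mul _)
  rw [integral_add h2 (hZb.const_mul 4),
    integral_add (hia.const_mul _) (hib.const_mul _), integral_const_mul, integral_const_mul,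
    integral_const_mul, h0] at h1
  linarith

end Orthogonality

section Matrices

variable {ι κ ι' κ' : Type*} [Fintype ι] [Fintype κ] [Fintype ι'] [Fintype κ']
  [DecidableEq ι] [DecidableEq κ] [DecidableEq ι'] [DecidableEq κ']

theorem norm_vecMulVec_le (u : EuclideanSpace ℝ ι) (v : EuclideanSpace ℝ κ) :
    ‖Matrix.vecMulVec u v‖ ≤ ‖u‖ * ‖v‖ := by
  rw [Matrix.l2_opNorm_def]
  refine ContinuousLinearMap.opNorm_le_bound _ (by positivity) fun x => ?_
  have h : (Matrix.toEuclideanLin (𝕜 := ℝ) ≪≫ₗ LinearMap.toContinuousLinearMap)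
      (Matrix.vecMulVec u v) x = (inner ℝ v x : ℝ) • u := by
    ext i
    simp [Matrix.toEuclideanLin, Matrix.vecMulVec, Matrix.mulVec, dotProduct, PiLp.inner_apply,
      Finset.sum_mul]
    exact Finset.sum_congr rfl fun j _ => by ring
  rw [h, norm_smul]
  have := norm_inner_le_norm (𝕜 := ℝ) v x
  nlinarith [norm_nonneg u]

theorem abs_entry_le_norm (X : Matrix ι κ ℝ) (i : ι) (j : κ) : |X i j| ≤ ‖X‖ := by
  have h := Matrix.l2_opNorm_mulVec X (EuclideanSpace.single j (1 : ℝ))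
  rw [PiLp.norm_single, norm_one, mul_one] at h
  refine le_trans ?_ h
  have h2 := PiLp.norm_apply_le ((EuclideanSpace.equiv ι ℝ).symm
    (X.mulVec (EuclideanSpace.single j (1 : ℝ)))) i
  refine le_trans (le_of_eq ?_) h2
  simp

theorem norm_le_sum_abs_entry (X : Matrix ι κ ℝ) : ‖X‖ ≤ ∑ i, ∑ j, |X i j| := by
  conv_lhs => rw [Matrix.matrix_eq_sum_single X]
  refine (norm_sum_le _ _).trans (Finset.sum_le_sum fun i _ => ?_)
  refine (norm_sum_le _ _).trans (Finset.sum_le_sum fun j _ => ?_)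
  have h : Matrix.single i j (X i j) = Matrix.vecMulVec
      (EuclideanSpace.single i (X i j)) (EuclideanSpace.single j (1 : ℝ)) := by
    ext a b
    simp only [Matrix.single, Matrix.vecMulVec, Matrix.of_apply, PiLp.single_apply]
    simp only [@eq_comm ι a i, @eq_comm κ b j]
    by_cases h1 : i = a <;> by_cases h2 : j = b <;> simp [h1, h2]
  rw [h]
  refine (norm_vecMulVec_le _ _).trans ?_
  simp

/-- The second moment matrix `E[u vᵀ]`. -/
noncomputable def moment (P : Measure Ω) (u : Ω → EuclideanSpace ℝ ι)
    (v : Ω → EuclideanSpace ℝ κ) : Matrix ι κ ℝ :=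
  ∫ ω, Matrix.vecMulVec (u ω) (v ω) ∂P

theorem integrable_vecMulVec {u : Ω → EuclideanSpace ℝ ι} {v : Ω → EuclideanSpace ℝ κ}
    (hu : MemLp u 2 P) (hv : MemLp v 2 P) :
    Integrable (fun ω => Matrix.vecMulVec (u ω) (v ω)) P := by
  have hcont : Continuous fun z : EuclideanSpace ℝ ι × EuclideanSpace ℝ κ =>
      (Matrix.vecMulVec z.1 z.2 : Matrix ι κ ℝ) := by
    refine Continuous.matrix_vecMulVec ?_ ?_ <;> fun_prop
  refine ((integrable_norm_sq hu).add (integrable_norm_sq hv)).mono'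
    (hcont.comp_aestronglyMeasurable (hu.1.prodMk hv.1)) (ae_of_all _ fun ω => ?_)
  refine (norm_vecMulVec_le _ _).trans ?_
  simp only [Pi.add_apply]
  nlinarith [sq_nonneg (‖u ω‖ - ‖v ω‖), sq_nonneg (‖u ω‖), sq_nonneg ‖v ω‖]

theorem moment_apply {u : Ω → EuclideanSpace ℝ ι} {v : Ω → EuclideanSpace ℝ κ}
    (hu : MemLp u 2 P) (hv : MemLp v 2 P) (i : ι) (j : κ) :
    moment P u v i j = ∫ ω, u ω i * v ω j ∂P := by
  let L : Matrix ι κ ℝ →L[ℝ] ℝ := LinearMap.toContinuousLinearMap (Matrix.entryLinearMap ℝ ℝ i j)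
  exact (L.integral_comp_comm (integrable_vecMulVec hu hv)).symm

theorem moment_mulVec {u : Ω → EuclideanSpace ℝ ι} {v : Ω → EuclideanSpace ℝ κ}
    (hu : MemLp u 2 P) (hv : MemLp v 2 P) (B : Matrix ι' ι ℝ) (C : Matrix κ' κ ℝ) :
    moment P (fun ω => WithLp.toLp 2 (B.mulVec (u ω))) (fun ω => WithLp.toLp 2 (C.mulVec (v ω)))
      = B * moment P u v * C.transpose := by
  let L : Matrix ι κ ℝ →L[ℝ] Matrix ι' κ' ℝ := LinearMap.toContinuousLinearMap
    { toFun := fun X => B * X * C.transpose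
      map_add' := fun X Y => by rw [Matrix.mul_add, Matrix.add_mul]
      map_smul' := fun c X => by simp }
  have h := L.integral_comp_comm (integrable_vecMulVec hu hv)
  refine Eq.trans ?_ h
  refine integral_congr_ae (ae_of_all _ fun ω => ?_)
  change Matrix.vecMulVec (B.mulVec (u ω)) (C.mulVec (v ω))
    = B * Matrix.vecMulVec (u ω) (v ω) * C.transpose
  rw [Matrix.mul_vecMulVec, Matrix.vecMulVec_mul, Matrix.vecMul_transpose]

/-- A perturbation of a random vector changes its second moment matrix little. -/
theorem norm_moment_add_sub_le {u v : Ω → EuclideanSpace ℝ ι} (hu : MemLp u 2 P)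
    (hv : MemLp v 2 P) {t : ℝ} (ht : 0 < t) :
    ‖moment P (fun ω => u ω + v ω) (fun ω => u ω + v ω) - moment P u u‖ ≤
      t * ∫ ω, ‖u ω‖ ^ 2 ∂P + (1 + t⁻¹) * ∫ ω, ‖v ω‖ ^ 2 ∂P := by
  have hadd : MemLp (fun ω => u ω + v ω) 2 P := hu.add hv
  unfold moment
  rw [← integral_sub (integrable_vecMulVec hadd hadd) (integrable_vecMulVec hu hu),
    ← integral_const_mul, ← integral_const_mul,
    ← integral_add ((integrable_norm_sq hu).const_mul _) ((integrable_norm_sq hv).const_mul _)]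
  refine norm_integral_le_of_norm_le (((integrable_norm_sq hu).const_mul _).add
    ((integrable_norm_sq hv).const_mul _)) (ae_of_all _ fun ω => ?_)
  have h : Matrix.vecMulVec (u ω + v ω) (u ω + v ω) - Matrix.vecMulVec (u ω) (u ω)
      = Matrix.vecMulVec (u ω) (v ω) + Matrix.vecMulVec (v ω) (u ω)
        + Matrix.vecMulVec (v ω) (v ω) := by
    ext i j
    simp [Matrix.vecMulVec]
    ring
  change ‖Matrix.vecMulVec (u ω + v ω) (u ω + v ω) - Matrix.vecMulVec (u ω) (u ω)‖ ≤ _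
  rw [h]
  refine (norm_add₃_le).trans ?_
  have h1 := norm_vecMulVec_le (u ω) (v ω)
  have h2 := norm_vecMulVec_le (v ω) (u ω)
  have h3 := norm_vecMulVec_le (v ω) (v ω)
  have h4 : 0 ≤ t⁻¹ * (t * ‖u ω‖ - ‖v ω‖) ^ 2 := by positivity
  have h5 : t⁻¹ * (t * ‖u ω‖ - ‖v ω‖) ^ 2
      = t * ‖u ω‖ ^ 2 - 2 * ‖u ω‖ * ‖v ω‖ + t⁻¹ * ‖v ω‖ ^ 2 := by
    field_simp
    ring
  nlinarith

/-- The mixed moments vanish: each entry of `u` is known given `m`, while `v` has conditional mean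
zero. -/
theorem moment_add_of_condExp_eq_zero [IsFiniteMeasure P] (hm : m ≤ mΩ)
    {u v : Ω → EuclideanSpace ℝ ι} (hum : StronglyMeasurable[m] u) (hu : MemLp u 2 P)
    (hv : MemLp v 2 P) (hv0 : P[v | m] =ᵐ[P] 0) :
    moment P (fun ω => u ω + v ω) (fun ω => u ω + v ω) = moment P u u + moment P v v := by
  have hz : ∀ i j, ∫ ω, u ω i * v ω j ∂P = 0 := by
    intro i j
    have hZ : StronglyMeasurable[m] fun ω => u ω i • EuclideanSpace.single j (1 : ℝ) := by
      have hc : Continuous fun x : EuclideanSpace ℝ ι => x i • EuclideanSpace.single j (1 : ℝ) := by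
        fun_prop
      exact hc.comp_stronglyMeasurable hum
    have heq : ∀ ω, inner ℝ (u ω i • EuclideanSpace.single j (1 : ℝ)) (v ω) = u ω i * v ω j := by
      intro ω
      rw [real_inner_smul_left, EuclideanSpace.inner_single_left]
      simp
    have h := integral_inner_eq_zero hm hZ (hv.integrable (by norm_num)) hv0
      (integrable_inner_of_memLp ?_ hv)
    · simpa only [heq] using h
    · refine hu.of_le (hZ.mono hm).aestronglyMeasurable (ae_of_all _ fun ω => ?_)
      rw [norm_smul]
      simpa using PiLp.norm_apply_le (u ω) i
  have hi : ∀ {a b : Ω → EuclideanSpace ℝ ι}, MemLp a 2 P → MemLp b 2 P → ∀ i j,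
      Integrable (fun ω => a ω i * b ω j) P := fun {a b} ha hb i j => by
    let L : Matrix ι ι ℝ →L[ℝ] ℝ := LinearMap.toContinuousLinearMap (Matrix.entryLinearMap ℝ ℝ i j)
    exact L.integrable_comp (integrable_vecMulVec ha hb)
  have hadd : MemLp (fun ω => u ω + v ω) 2 P := hu.add hv
  ext i j
  rw [moment_apply hadd hadd, Matrix.add_apply, moment_apply hu hu,
    moment_apply hv hv]
  have : ∀ ω, (u ω + v ω) i * (u ω + v ω) j
      = u ω i * u ω j + u ω i * v ω j + u ω j * v ω i + v ω i * v ω j := fun ω => by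
    simp only [PiLp.add_apply]; ring
  simp only [this]
  rw [integral_add, integral_add, integral_add, hz i j, hz j i]
  · ring
  · exact hi hu hu i j
  · exact hi hu hv i j
  · exact (hi hu hu i j).add (hi hu hv i j)
  · exact hi hu hv j i
  · exact ((hi hu hu i j).add (hi hu hv i j)).add (hi hu hv j i)
  · exact hi hv hv i j

end Matrices

end Moments

/-! ### The error recursion and its measurability and integrability. -/

section ErrorDynamics

variable {N G M : ℕ} {Ω : Type*} {mΩ : MeasurableSpace Ω} {P : Measure Ω} {ℱ : Filtration ℕ mΩ}
  {T : SimpleGraph (Fin N)} {grp : Fin N → Fin G}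
  {A : Matrix (Fin N) (Fin N) ℝ} {J : Fin N → Vec M → ℝ} {wo : Fin N → Vec M}
  {lamL lamU : Fin N → ℝ} {κH : ℝ} {ghat : ℕ → Fin N → Vec M → Ω → Vec M} {α σs κs γs : ℝ}
  {Rs : Matrix (Fin N × Fin M) (Fin N × Fin M) ℝ} {τ p : Fin N → ℝ}

/-- The inverse of stacking. -/
def uncol (N M : ℕ) : EuclideanSpace ℝ (Fin N × Fin M) →ₗ[ℝ] (Fin N → Vec M) where
  toFun z k := WithLp.toLp 2 fun a => z (k, a)
  map_add' _ _ := rfl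
  map_smul' _ _ := rfl

theorem uncol_col (w : Fin N → Vec M) : uncol N M (col w) = w := rfl

theorem col_uncol (z : EuclideanSpace ℝ (Fin N × Fin M)) : col (uncol N M z) = z := rfl

/-- Multiplication of the agents' vectors by the step-size profile. -/
def scale (M : ℕ) (τ : Fin N → ℝ) : (Fin N → Vec M) →ₗ[ℝ] (Fin N → Vec M) :=
  LinearMap.pi fun k => τ k • LinearMap.proj k

theorem scale_apply (τ : Fin N → ℝ) (e : Fin N → Vec M) (k : Fin N) :
    scale M τ e k = τ k • e k := rfl

/-- The effect of the gradient noise on the error after one iteration, up to the step-size. -/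
noncomputable def noiseMap (M : ℕ) (A : Matrix (Fin N) (Fin N) ℝ) (τ : Fin N → ℝ) :
    EuclideanSpace ℝ (Fin N × Fin M) →ₗ[ℝ] (Fin N → Vec M) :=
  comb A ∘ₗ scale M τ ∘ₗ uncol N M

/-- A stochastic error recursion driven by martingale differences with controlled fourth
moments. -/
structure IsErrorProcess (P : Measure Ω) (ℱ : Filtration ℕ mΩ) (A : Matrix (Fin N) (Fin N) ℝ)
    (J : Fin N → Vec M → ℝ) (wo : Fin N → Vec M) (τ : Fin N → ℝ) (α σs μ : ℝ)
    (e : ℕ → Ω → Fin N → Vec M) (s : ℕ → Ω → EuclideanSpace ℝ (Fin N × Fin M)) : Prop where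
  stronglyMeasurable : ∀ n, StronglyMeasurable[ℱ n] (e n)
  memLp_error : ∀ n, MemLp (e n) 4 P
  memLp_noise : ∀ n, MemLp (s n) 4 P
  condExp_noise : ∀ n, P[s n | ℱ n] =ᵐ[P] 0
  fourth_moment : ∀ n, ∫ ω, ‖s n ω‖ ^ 4 ∂P ≤ α ^ 2 * ∫ ω, ‖col (e n ω)‖ ^ 4 ∂P + σs ^ 4
  step : ∀ n ω, e (n + 1) ω
    = comb A (e n ω + μ • drift J wo τ (e n ω)) + μ • noiseMap M A τ (s n ω)

/-- Agents combine only within their group, where the minimizer is common and the weights add up to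
one; so `wo` is fixed by combination. The approximate gradient then splits into true gradient and
noise. -/
theorem wo_sub_estimate_succ (hgrp : IsGrouping T grp wo) (hA : IsCombination T grp A)
    (J : Fin N → Vec M → ℝ) (τ : Fin N → ℝ) (ghat : ℕ → Fin N → Vec M → Ω → Vec M) (μ : ℝ) (n : ℕ)
    (ω : Ω) :
    wo - estimate A τ ghat μ (n + 1) ω
      = comb A ((wo - estimate A τ ghat μ n ω)
          + μ • drift J wo τ (wo - estimate A τ ghat μ n ω))
        + μ • noiseMap M A τ (netNoise J ghat n (estimate A τ ghat μ n ω) ω) := by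
  rw [noiseMap, LinearMap.comp_apply, LinearMap.comp_apply, ← map_smul, ← map_add]
  funext k
  have hwo : wo k = ∑ l, A l k • wo l := by
    conv_lhs => rw [← one_smul ℝ (wo k), ← hA.sum_one k, Finset.sum_smul]
    refine Finset.sum_congr rfl fun l _ => ?_
    by_cases h : grp l = grp k
    · rw [hgrp.common_minimizer l k h]
    · rw [hA.eq_zero_of_grp_ne h, zero_smul, zero_smul]
  rw [comb_apply, Pi.sub_apply]
  conv_lhs => rw [hwo]
  rw [estimate, ← Finset.sum_sub_distrib]
  refine Finset.sum_congr rfl fun l _ => ?_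
  rw [← smul_sub]
  congr 1
  simp only [Pi.add_apply, Pi.sub_apply, Pi.smul_apply, drift, scale_apply, netNoise, uncol_col,
    sub_sub_cancel, smul_sub, smul_smul]
  abel

theorem CostCondition.norm_drift_le_norm (hJ : CostCondition grp J wo lamL lamU κH)
    (hτ : IsStepProfile τ) (e : Fin N → Vec M) :
    ‖drift J wo τ e‖ ≤ (∑ l, (lamU l + 1)) * ‖e‖ := by
  have hΛ0 : 0 ≤ ∑ l, (lamU l + 1) := Finset.sum_nonneg fun l _ => by
    linarith [hJ.lamL_nonneg l, hJ.lamL_le_lamU l]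
  refine (pi_norm_le_iff_of_nonneg (by positivity)).mpr fun k =>
    (hJ.norm_drift_le hτ e k).trans ?_
  gcongr
  exact norm_le_pi_norm e k

theorem stronglyMeasurable_drift_step (hJ : CostCondition grp J wo lamL lamU κH) (μ : ℝ)
    {m : MeasurableSpace Ω} {e : Ω → Fin N → Vec M} (he : StronglyMeasurable[m] e) :
    StronglyMeasurable[m] fun ω => e ω + μ • drift J wo τ (e ω) :=
  he.add ((hJ.continuous_drift.comp_stronglyMeasurable he).const_smul μ)

theorem memLp_drift (hJ : CostCondition grp J wo lamL lamU κH) (hτ : IsStepProfile τ)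
    {e : Ω → Fin N → Vec M} {q : ℝ≥0∞} (he : MemLp e q P) :
    MemLp (fun ω => drift J wo τ (e ω)) q P :=
  he.of_le_mul (hJ.continuous_drift.comp_aestronglyMeasurable he.1)
    (ae_of_all _ fun ω => hJ.norm_drift_le_norm hτ (e ω))

theorem memLp_drift_step (hJ : CostCondition grp J wo lamL lamU κH) (hτ : IsStepProfile τ) (μ : ℝ)
    {e : Ω → Fin N → Vec M} {q : ℝ≥0∞} (he : MemLp e q P) :
    MemLp (fun ω => e ω + μ • drift J wo τ (e ω)) q P :=
  he.add ((memLp_drift hJ hτ he).const_smul μ)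

theorem memLp_linear {E F : Type*} [NormedAddCommGroup E] [NormedSpace ℝ E]
    [FiniteDimensional ℝ E] [NormedAddCommGroup F] [NormedSpace ℝ F] (L : E →ₗ[ℝ] F)
    {f : Ω → E} {q : ℝ≥0∞} (hf : MemLp f q P) : MemLp (fun ω => L (f ω)) q P :=
  (LinearMap.toContinuousLinearMap L).comp_memLp' hf

theorem stronglyMeasurable_linear {E F : Type*} [NormedAddCommGroup E] [NormedSpace ℝ E]
    [FiniteDimensional ℝ E] [NormedAddCommGroup F] [NormedSpace ℝ F] (L : E →ₗ[ℝ] F)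
    {m : MeasurableSpace Ω} {f : Ω → E} (hf : StronglyMeasurable[m] f) :
    StronglyMeasurable[m] fun ω => L (f ω) :=
  L.continuous_of_finiteDimensional.comp_stronglyMeasurable hf

theorem condExp_linear_eq_zero [IsFiniteMeasure P] {E F : Type*} [NormedAddCommGroup E]
    [NormedSpace ℝ E] [FiniteDimensional ℝ E] [NormedAddCommGroup F] [NormedSpace ℝ F]
    [CompleteSpace F] (L : E →ₗ[ℝ] F)
    {m : MeasurableSpace Ω} {f : Ω → E} (hf : Integrable f P) (h0 : P[f | m] =ᵐ[P] 0) :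
    P[fun ω => L (f ω) | m] =ᵐ[P] 0 := by
  have : CompleteSpace E := FiniteDimensional.complete ℝ E
  have h := (LinearMap.toContinuousLinearMap L).comp_condExp_comm (m := m) hf
  refine h.symm.trans ?_
  filter_upwards [h0] with ω hω
  simp [hω]

/-- Both properties must advance in one induction: the noise conditions apply only to arguments that
are adapted and have a fourth moment. -/
theorem error_measurable_memLp (hgrp : IsGrouping T grp wo)
    (hA : IsCombination T grp A) (hJ : CostCondition grp J wo lamL lamU κH)
    (hτ : IsStepProfile τ) [IsProbabilityMeasure P]
    (hS : NoiseCondition P ℱ J wo ghat α σs κs γs Rs) (μ : ℝ) (n : ℕ) :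
    StronglyMeasurable[ℱ n] (fun ω => wo - estimate A τ ghat μ n ω) ∧
      MemLp (fun ω => wo - estimate A τ ghat μ n ω) 4 P := by
  induction n with
  | zero =>
    simp only [estimate]
    exact ⟨stronglyMeasurable_const, memLp_const _⟩
  | succ n ih =>
    obtain ⟨hm, hL⟩ := ih
    have hW : StronglyMeasurable[ℱ n] (estimate A τ ghat μ n) := by
      have := (stronglyMeasurable_const (b := wo)).sub hm
      simpa [Pi.sub_def] using this
    have hWL : MemLp (estimate A τ ghat μ n) 4 P := by
      have := (memLp_const (μ := P) (p := 4) wo).sub hL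
      simpa [Pi.sub_def] using this
    have hcol : MemLp (fun ω => col (estimate A τ ghat μ n ω)) 4 P :=
      (colL N M).comp_memLp' hWL
    have hs := hS.adapted n _ hW hcol
    have hs4 := hS.memLp n _ hW hcol
    simp only [wo_sub_estimate_succ hgrp hA J]
    refine ⟨?_, ?_⟩
    · refine StronglyMeasurable.add ?_ ((stronglyMeasurable_linear _ hs).const_smul μ)
      exact (stronglyMeasurable_linear _ (stronglyMeasurable_drift_step hJ μ hm)).mono
        (ℱ.mono n.le_succ)
    · have h1 := memLp_linear (comb A) (memLp_drift_step hJ hτ μ hL)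
      have h2 := (memLp_linear (noiseMap M A τ) hs4).const_smul μ
      exact h1.add h2

theorem estimate_stronglyMeasurable (hgrp : IsGrouping T grp wo)
    (hA : IsCombination T grp A) (hJ : CostCondition grp J wo lamL lamU κH)
    (hτ : IsStepProfile τ) [IsProbabilityMeasure P]
    (hS : NoiseCondition P ℱ J wo ghat α σs κs γs Rs) (μ : ℝ) (n : ℕ) :
    StronglyMeasurable[ℱ n] (estimate A τ ghat μ n) := by
  have := (stronglyMeasurable_const (b := wo)).sub
    (error_measurable_memLp hgrp hA hJ hτ hS μ n).1
  simpa [Pi.sub_def] using this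

theorem memLp_col_estimate (hgrp : IsGrouping T grp wo)
    (hA : IsCombination T grp A) (hJ : CostCondition grp J wo lamL lamU κH)
    (hτ : IsStepProfile τ) [IsProbabilityMeasure P]
    (hS : NoiseCondition P ℱ J wo ghat α σs κs γs Rs) (μ : ℝ) (n : ℕ) :
    MemLp (fun ω => col (estimate A τ ghat μ n ω)) 4 P := by
  have h := (memLp_const (μ := P) (p := 4) wo).sub (error_measurable_memLp hgrp hA hJ hτ hS μ n).2
  have h' : MemLp (estimate A τ ghat μ n) 4 P := by simpa [Pi.sub_def] using h
  exact (colL N M).comp_memLp' h'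

theorem netError_eq (A : Matrix (Fin N) (Fin N) ℝ) (τ : Fin N → ℝ)
    (ghat : ℕ → Fin N → Vec M → Ω → Vec M) (wo : Fin N → Vec M) (μ : ℝ) (n : ℕ) (ω : Ω) :
    netError A τ ghat wo μ n ω = col (wo - estimate A τ ghat μ n ω) := rfl

/-- The moment bounds below use only this abstract recursion. The conditional fourth moment bound
enters after integration. -/
theorem isErrorProcess_estimate (hgrp : IsGrouping T grp wo)
    (hA : IsCombination T grp A) (hJ : CostCondition grp J wo lamL lamU κH)
    (hτ : IsStepProfile τ) [IsProbabilityMeasure P]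
    (hS : NoiseCondition P ℱ J wo ghat α σs κs γs Rs) (μ : ℝ) :
    IsErrorProcess P ℱ A J wo τ α σs μ (fun n ω => wo - estimate A τ ghat μ n ω)
      (fun n ω => netNoise J ghat n (estimate A τ ghat μ n ω) ω) where
  stronglyMeasurable n := (error_measurable_memLp hgrp hA hJ hτ hS μ n).1
  memLp_error n := (error_measurable_memLp hgrp hA hJ hτ hS μ n).2
  memLp_noise n := hS.memLp n _ (estimate_stronglyMeasurable hgrp hA hJ hτ hS μ n)
    (memLp_col_estimate hgrp hA hJ hτ hS μ n)
  condExp_noise n := hS.martingale_difference n _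
    (estimate_stronglyMeasurable hgrp hA hJ hτ hS μ n) (memLp_col_estimate hgrp hA hJ hτ hS μ n)
  fourth_moment n := by
    have hm := estimate_stronglyMeasurable hgrp hA hJ hτ hS μ n
    have hL := memLp_col_estimate hgrp hA hJ hτ hS μ n
    have h := hS.fourth_moment n _ hm hL
    have hint : Integrable (fun ω => α ^ 2 * ‖col (wo - estimate A τ ghat μ n ω)‖ ^ 4) P :=
      (integrable_norm_pow_four ((colL N M).comp_memLp'
        (error_measurable_memLp hgrp hA hJ hτ hS μ n).2)).const_mul _
    have hle := integral_mono_ae (integrable_condExp (m := ℱ n)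
      (f := fun ω => ‖netNoise J ghat n (estimate A τ ghat μ n ω) ω‖ ^ 4) (μ := P))
      (hint.add (integrable_const (σs ^ 4))) (h.mono fun ω hω => hω)
    rw [integral_condExp (ℱ.le n)] at hle
    refine hle.trans_eq ?_
    simp only [Pi.add_apply]
    rw [integral_add hint (integrable_const _), integral_const_mul, integral_const]
    simp
  step n ω := wo_sub_estimate_succ hgrp hA J τ ghat μ n ω

end ErrorDynamics

/-! ### Affine contractions of real sequences. -/

section Recursion

/-- A sequence satisfying an eventual affine contraction is eventually below twice the fixed
point. -/
theorem eventually_le_of_recursion {a : ℕ → ℝ} {q B : ℝ} (hq : 0 < q) (hq1 : q ≤ 1) (hB : 0 < B)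
    (h : ∀ᶠ n in atTop, a (n + 1) ≤ (1 - q) * a n + B) : ∀ᶠ n in atTop, a n ≤ 2 * B / q := by
  obtain ⟨n₀, hn₀⟩ := eventually_atTop.mp h
  -- `B / q` is the fixed point of the recursion; the second copy in `2 * B / q` dominates the
  -- geometric transient.
  have hbound : ∀ k, a (n₀ + k) ≤ (1 - q) ^ k * |a n₀| + B / q := by
    intro k
    induction k with
    | zero => simpa using (le_abs_self (a n₀)).trans (le_add_of_nonneg_right (by positivity))
    | succ k ih =>
      have h1 := hn₀ (n₀ + k) (Nat.le_add_right _ _)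
      have h2 := mul_le_mul_of_nonneg_left ih (sub_nonneg.mpr hq1)
      have h3 : (1 - q) * (B / q) + B = B / q := by field_simp; ring
      rw [← add_assoc, pow_succ]
      linarith
  have hlim : Tendsto (fun k => (1 - q) ^ k * |a n₀|) atTop (𝓝 0) := by
    simpa using (tendsto_pow_atTop_nhds_zero_of_lt_one (sub_nonneg.mpr hq1)
      (by linarith)).mul_const |a n₀|
  have hev : ∀ᶠ k in atTop, a (n₀ + k) ≤ 2 * B / q := by
    filter_upwards [hlim.eventually_lt_const (show 0 < B / q by positivity)] with k hk
    have := hbound k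
    have h4 : 2 * B / q = B / q + B / q := by ring
    linarith
  obtain ⟨k₀, hk₀⟩ := eventually_atTop.mp hev
  filter_upwards [eventually_ge_atTop (n₀ + k₀)] with n hn
  have := hk₀ (n - n₀) (by omega)
  rwa [Nat.add_sub_cancel' (by omega)] at this

end Recursion

/-! ### Orders of the fourth moment of the error and the second moment of the deviations. -/

section Stability

variable {N G M : ℕ} {Ω : Type*} {mΩ : MeasurableSpace Ω} {P : Measure Ω} {ℱ : Filtration ℕ mΩ}
  {T : SimpleGraph (Fin N)} {grp : Fin N → Fin G}
  {A : Matrix (Fin N) (Fin N) ℝ} {J : Fin N → Vec M → ℝ} {wo : Fin N → Vec M}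
  {lamL lamU : Fin N → ℝ} {κH : ℝ} {α σs : ℝ} {τ p : Fin N → ℝ}

/-- Stacking with weights, so that `‖wcol p e‖² = ∑_k p_k ‖e_k‖²`. -/
noncomputable def wcol (M : ℕ) (p : Fin N → ℝ) :
    (Fin N → Vec M) →ₗ[ℝ] EuclideanSpace ℝ (Fin N × Fin M) :=
  (colL N M).toLinearMap ∘ₗ scale M fun k => Real.sqrt (p k)

theorem norm_wcol_sq (hp : ∀ k, 0 ≤ p k) (e : Fin N → Vec M) : ‖wcol M p e‖ ^ 2 = wsq p e := by
  have : wcol M p e = col (scale M (fun k => Real.sqrt (p k)) e) := rfl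
  rw [this, norm_col_sq, wsq]
  refine Finset.sum_congr rfl fun k _ => ?_
  rw [scale_apply, norm_smul, mul_pow, Real.norm_eq_abs, sq_abs, Real.sq_sqrt (hp k)]

theorem norm_wcol_pow_four (hp : ∀ k, 0 ≤ p k) (e : Fin N → Vec M) :
    ‖wcol M p e‖ ^ 4 = wsq p e ^ 2 := by
  rw [← norm_wcol_sq hp]; ring

theorem IsPerron.exists_norm_col_sq_le (hp : IsPerron grp A p) :
    ∃ K : ℝ, 0 < K ∧ ∀ e : Fin N → Vec M, ‖col e‖ ^ 2 ≤ K * wsq p e := by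
  obtain ⟨c, hc, hle⟩ := exists_pos_le_of_fintype hp.pos
  refine ⟨c⁻¹, by positivity, fun e => ?_⟩
  rw [← div_eq_inv_mul, le_div_iff₀ hc, norm_col_sq, wsq, Finset.sum_mul]
  refine Finset.sum_le_sum fun k _ => ?_
  rw [mul_comm]
  exact mul_le_mul_of_nonneg_right (hle k) (sq_nonneg _)

theorem exists_norm_linear_le {E F : Type*} [NormedAddCommGroup E] [NormedSpace ℝ E]
    [FiniteDimensional ℝ E] [NormedAddCommGroup F] [NormedSpace ℝ F] (L : E →ₗ[ℝ] F) :
    ∃ C : ℝ, 0 < C ∧ ∀ x, ‖L x‖ ≤ C * ‖x‖ :=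
  ⟨‖LinearMap.toContinuousLinearMap L‖ + 1, by positivity, fun x =>
    ((LinearMap.toContinuousLinearMap L).le_opNorm x).trans (by gcongr; linarith)⟩

theorem IsPerron.exists_integral_norm_col_pow_four_le (hp : IsPerron grp A p) :
    ∃ K : ℝ, 0 < K ∧ ∀ f : Ω → Fin N → Vec M, MemLp f 4 P →
      ∫ ω, ‖col (f ω)‖ ^ 4 ∂P ≤ K * ∫ ω, ‖wcol M p (f ω)‖ ^ 4 ∂P := by
  obtain ⟨K, hK, hKle⟩ := hp.exists_norm_col_sq_le (M := M)
  refine ⟨K ^ 2, by positivity, fun f hf => ?_⟩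
  rw [← integral_const_mul]
  refine integral_mono (integrable_norm_pow_four ((colL N M).comp_memLp' hf))
    ((integrable_norm_pow_four (memLp_linear (wcol M p) hf)).const_mul _) fun ω => ?_
  have h2 := hKle (f ω)
  have h3 : ‖col (f ω)‖ ^ 4 = (‖col (f ω)‖ ^ 2) ^ 2 := by ring
  change ‖col (f ω)‖ ^ 4 ≤ _
  rw [h3, norm_wcol_pow_four fun k => (hp.pos k).le, ← mul_pow]
  gcongr

theorem IsErrorProcess.exists_fourth_moment_noise_le (hp : IsPerron grp A p) (α σs : ℝ) :
    ∃ C : ℝ, 0 < C ∧ ∀ (μ : ℝ) (e : ℕ → Ω → Fin N → Vec M)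
      (s : ℕ → Ω → EuclideanSpace ℝ (Fin N × Fin M)), IsErrorProcess P ℱ A J wo τ α σs μ e s →
      ∀ n, ∫ ω, ‖s n ω‖ ^ 4 ∂P ≤ C * ∫ ω, ‖wcol M p (e n ω)‖ ^ 4 ∂P + C := by
  obtain ⟨K, hK, hKle⟩ := hp.exists_integral_norm_col_pow_four_le (M := M) (P := P)
  refine ⟨α ^ 2 * K + σs ^ 4 + 1, by positivity, fun μ e s he n => ?_⟩
  have h1 := hKle (e n) (he.memLp_error n)
  have h0 : 0 ≤ ∫ ω, ‖wcol M p (e n ω)‖ ^ 4 ∂P := integral_nonneg fun ω => by positivity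
  have h4 := he.fourth_moment n
  have h5 := mul_le_mul_of_nonneg_left h1 (sq_nonneg α)
  have h6 : 0 ≤ α ^ 2 * K := by positivity
  have h7 : 0 ≤ σs ^ 4 := by positivity
  nlinarith

/-- The fourth moment of the error is eventually of order `μ²`. -/
theorem exists_eventually_fourth_moment_le [IsProbabilityMeasure P] (hgrp : IsGrouping T grp wo)
    (hA : IsCombination T grp A) (hJ : CostCondition grp J wo lamL lamU κH)
    (hτ : IsStepProfile τ) (hp : IsPerron grp A p) (α σs : ℝ) :
    ∃ C : ℝ, 0 < C ∧ ∀ᶠ μ in 𝓝[>] (0 : ℝ), ∀ (e : ℕ → Ω → Fin N → Vec M)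
      (s : ℕ → Ω → EuclideanSpace ℝ (Fin N × Fin M)), IsErrorProcess P ℱ A J wo τ α σs μ e s →
      ∀ᶠ n in atTop, ∫ ω, ‖wcol M p (e n ω)‖ ^ 4 ∂P ≤ C * μ ^ 2 := by
  obtain ⟨c, hc, hstep⟩ := exists_wsq_step_le hgrp hA hJ hτ hp
  obtain ⟨K, hK, hnoise⟩ := IsErrorProcess.exists_fourth_moment_noise_le (P := P) (ℱ := ℱ)
    (J := J) (wo := wo) (τ := τ) hp α σs
  obtain ⟨B, hB, hBle⟩ := exists_norm_linear_le (wcol M p ∘ₗ noiseMap M A τ)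
  have hp0 : ∀ k, 0 ≤ p k := fun k => (hp.pos k).le
  set D := (3 + 32 / c) * (B ^ 4 * K) with hD
  have hD0 : 0 < D := by positivity
  refine ⟨2 * D / (c / 4), by positivity, ?_⟩
  filter_upwards [hstep, self_mem_nhdsWithin, eventually_lt_nhdsGT_zero one_pos,
    eventually_lt_nhdsGT_zero (a := c / (4 * D)) (by positivity),
    eventually_lt_nhdsGT_zero (a := 1 / c) (by positivity)] with μ hμstep hμ hμ1 hμD hμc e s he
  have hμ0 : 0 < μ := hμ
  rw [lt_div_iff₀ (by positivity)] at hμD hμc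
  have hrec : ∀ n, ∫ ω, ‖wcol M p (e (n + 1) ω)‖ ^ 4 ∂P ≤
      (1 - c / 4 * μ) * ∫ ω, ‖wcol M p (e n ω)‖ ^ 4 ∂P + D * μ ^ 3 := by
    intro n
    set I := ∫ ω, ‖wcol M p (e n ω)‖ ^ 4 ∂P with hI
    have hI0 : 0 ≤ I := integral_nonneg fun ω => by positivity
    have hint := integrable_norm_pow_four (memLp_linear (wcol M p) (he.memLp_error n))
    set a : Ω → EuclideanSpace ℝ (Fin N × Fin M) := fun ω =>
      (wcol M p ∘ₗ comb A) (e n ω + μ • drift J wo τ (e n ω)) with ha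
    set b : Ω → EuclideanSpace ℝ (Fin N × Fin M) := fun ω =>
      (μ • (wcol M p ∘ₗ noiseMap M A τ)) (s n ω) with hb
    have ha_meas : StronglyMeasurable[ℱ n] a :=
      stronglyMeasurable_linear _ (stronglyMeasurable_drift_step hJ μ (he.stronglyMeasurable n))
    have ha4 : MemLp a 4 P := memLp_linear _ (memLp_drift_step hJ hτ μ (he.memLp_error n))
    have hb4 : MemLp b 4 P := memLp_linear _ (he.memLp_noise n)
    have hb0 : P[b | ℱ n] =ᵐ[P] 0 :=
      condExp_linear_eq_zero _ ((he.memLp_noise n).integrable (by norm_num)) (he.condExp_noise n)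
    have hsum : ∀ ω, wcol M p (e (n + 1) ω) = a ω + b ω := fun ω => by
      rw [he.step, map_add, map_smul]; rfl
    -- The parameter `c * μ / 2` spends half of the contraction `1 - c * μ`. The noise coefficient
    -- is then of order `μ⁻¹`, so the noise contributes order `μ³`, and division by a rate of order
    -- `μ` yields `μ²`.
    have h1 := integral_norm_add_pow_four_le (ℱ.le n) ha_meas ha4 hb4 hb0
      (t := c * μ / 2) (by positivity)
    simp only [← hsum] at h1
    have h2 : ∫ ω, ‖a ω‖ ^ 4 ∂P ≤ (1 - c * μ) * I := by
      rw [hI, ← integral_const_mul]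
      refine integral_mono (integrable_norm_pow_four ha4) (hint.const_mul _) fun ω => ?_
      have h3 := hμstep (e n ω)
      simp only [ha, LinearMap.comp_apply]
      rw [norm_wcol_pow_four hp0, norm_wcol_pow_four hp0]
      have h4 := wsq_nonneg hp0 (comb A (e n ω + μ • drift J wo τ (e n ω)))
      have h5 := wsq_nonneg hp0 (e n ω)
      have h6 : wsq p (comb A (e n ω + μ • drift J wo τ (e n ω))) ≤ wsq p (e n ω) := by
        have : 0 ≤ c * μ * wsq p (e n ω) := by positivity
        linarith
      calc wsq p (comb A (e n ω + μ • drift J wo τ (e n ω))) ^ 2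
          ≤ ((1 - c * μ) * wsq p (e n ω)) * wsq p (e n ω) := by
            rw [sq]
            exact mul_le_mul h3 h6 h4 (h4.trans h3)
        _ = (1 - c * μ) * wsq p (e n ω) ^ 2 := by ring
    have h7 : ∫ ω, ‖b ω‖ ^ 4 ∂P ≤ μ ^ 4 * B ^ 4 * (K * I + K) := by
      have h8 : ∫ ω, ‖b ω‖ ^ 4 ∂P ≤ μ ^ 4 * B ^ 4 * ∫ ω, ‖s n ω‖ ^ 4 ∂P := by
        rw [← integral_const_mul]
        refine integral_mono (integrable_norm_pow_four hb4)
          ((integrable_norm_pow_four (he.memLp_noise n)).const_mul _) fun ω => ?_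
        simp only [hb, LinearMap.smul_apply, norm_smul, Real.norm_of_nonneg hμ0.le]
        rw [← mul_pow, ← mul_pow, mul_assoc]
        gcongr
        exact hBle _
      exact h8.trans (mul_le_mul_of_nonneg_left (hnoise μ e s he n) (by positivity))
    have h9 : (3 + 16 / (c * μ / 2)) * (μ ^ 4 * B ^ 4 * (K * I + K)) ≤ D * μ ^ 3 * (I + 1) := by
      have h10 : (3 + 16 / (c * μ / 2)) * (μ ^ 4 * B ^ 4 * (K * I + K))
          = (3 * μ + 32 / c) * (B ^ 4 * K) * μ ^ 3 * (I + 1) := by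
        field_simp
        ring
      rw [h10, hD]
      gcongr
      linarith
    have h11 : (1 + c * μ / 2) * ((1 - c * μ) * I) ≤ (1 - c * μ / 2) * I := by
      rw [← mul_assoc]
      gcongr
      nlinarith [mul_pos hc hμ0]
    -- The part of the noise moment that grows with the error is paid for by a further `c / 4` of
    -- the rate.
    have h12 : D * μ ^ 3 * I ≤ c / 4 * μ * I := by
      refine mul_le_mul_of_nonneg_right ?_ hI0
      have : D * μ ^ 3 = (μ * (4 * D)) / 4 * μ * μ := by ring
      rw [this]
      have h13 : μ * (4 * D) / 4 * μ ≤ c / 4 * 1 := by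
        gcongr
      nlinarith
    have h14 : (1 + c * μ / 2) * ∫ ω, ‖a ω‖ ^ 4 ∂P ≤ (1 + c * μ / 2) * ((1 - c * μ) * I) := by
      gcongr
    have h15 : (3 + 16 / (c * μ / 2)) * ∫ ω, ‖b ω‖ ^ 4 ∂P ≤
        (3 + 16 / (c * μ / 2)) * (μ ^ 4 * B ^ 4 * (K * I + K)) := by
      gcongr
    nlinarith
  have := eventually_le_of_recursion (q := c / 4 * μ)
    (a := fun n => ∫ ω, ‖wcol M p (e n ω)‖ ^ 4 ∂P) (by positivity) (by nlinarith)
    (show 0 < D * μ ^ 3 by positivity) (Eventually.of_forall hrec)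
  filter_upwards [this] with n hn
  refine hn.trans_eq ?_
  field_simp

theorem integral_norm_sq_le_one_add [IsProbabilityMeasure P] {E : Type*} [NormedAddCommGroup E]
    {f : Ω → E} (hf : MemLp f 4 P) : ∫ ω, ‖f ω‖ ^ 2 ∂P ≤ 1 + ∫ ω, ‖f ω‖ ^ 4 ∂P := by
  have := sq_integral_norm_sq_le hf
  nlinarith [sq_nonneg (∫ ω, ‖f ω‖ ^ 2 ∂P - 1)]

/-- The second moment of the deviations inside the groups is eventually of order `μ²`. -/
theorem exists_eventually_dev_moment_le [IsProbabilityMeasure P] (hgrp : IsGrouping T grp wo)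
    (hA : IsCombination T grp A) (hJ : CostCondition grp J wo lamL lamU κH)
    (hτ : IsStepProfile τ) (hp : IsPerron grp A p) (α σs : ℝ) :
    ∃ C : ℝ, 0 < C ∧ ∀ᶠ μ in 𝓝[>] (0 : ℝ), ∀ (e : ℕ → Ω → Fin N → Vec M)
      (s : ℕ → Ω → EuclideanSpace ℝ (Fin N × Fin M)), IsErrorProcess P ℱ A J wo τ α σs μ e s →
      ∀ᶠ n in atTop, ∫ ω, ‖wcol M p (dev grp p (e n ω))‖ ^ 2 ∂P ≤ C * μ ^ 2 := by
  obtain ⟨C₄, hC₄, hfourth⟩ := exists_eventually_fourth_moment_le (P := P) (ℱ := ℱ)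
    hgrp hA hJ hτ hp α σs
  obtain ⟨c, C, hc, hc1, hC, hstep⟩ := exists_wsq_dev_step_le hgrp hA hJ hτ hp
  obtain ⟨K, hK, hnoise⟩ := IsErrorProcess.exists_fourth_moment_noise_le (P := P) (ℱ := ℱ)
    (J := J) (wo := wo) (τ := τ) hp α σs
  obtain ⟨B, hB, hBle⟩ := exists_norm_linear_le (wcol M p ∘ₗ dev grp p ∘ₗ noiseMap M A τ)
  have hp0 : ∀ k, 0 ≤ p k := fun k => (hp.pos k).le
  set D := C * (1 + C₄) + B ^ 2 * (1 + (K * C₄ + K)) with hD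
  have hD0 : 0 < D := by positivity
  refine ⟨2 * D / c, by positivity, ?_⟩
  filter_upwards [hfourth, self_mem_nhdsWithin, eventually_lt_nhdsGT_zero one_pos]
    with μ hμ4 hμ hμ1 e s he
  have hμ0 : 0 < μ := hμ
  have hrec : ∀ᶠ n in atTop, ∫ ω, ‖wcol M p (dev grp p (e (n + 1) ω))‖ ^ 2 ∂P ≤
      (1 - c) * ∫ ω, ‖wcol M p (dev grp p (e n ω))‖ ^ 2 ∂P + D * μ ^ 2 := by
    filter_upwards [hμ4 e s he] with n hn
    -- Boundedness of the fourth moment is enough here, since drift and noise already bring a factor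
    -- `μ²`.
    have hm4 : ∫ ω, ‖wcol M p (e n ω)‖ ^ 4 ∂P ≤ C₄ := by
      refine hn.trans ?_
      have : μ ^ 2 ≤ 1 := by nlinarith
      nlinarith
    set a : Ω → EuclideanSpace ℝ (Fin N × Fin M) := fun ω =>
      (wcol M p ∘ₗ dev grp p ∘ₗ comb A) (e n ω + μ • drift J wo τ (e n ω)) with ha
    set b : Ω → EuclideanSpace ℝ (Fin N × Fin M) := fun ω =>
      (μ • (wcol M p ∘ₗ dev grp p ∘ₗ noiseMap M A τ)) (s n ω) with hb
    have ha_meas : StronglyMeasurable[ℱ n] a :=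
      stronglyMeasurable_linear _ (stronglyMeasurable_drift_step hJ μ (he.stronglyMeasurable n))
    have ha2 : MemLp a 2 P :=
      memLp_two_of_four (memLp_linear _ (memLp_drift_step hJ hτ μ (he.memLp_error n)))
    have hb2 : MemLp b 2 P := memLp_two_of_four (memLp_linear _ (he.memLp_noise n))
    have hb0 : P[b | ℱ n] =ᵐ[P] 0 :=
      condExp_linear_eq_zero _ ((he.memLp_noise n).integrable (by norm_num)) (he.condExp_noise n)
    have hsum : ∀ ω, wcol M p (dev grp p (e (n + 1) ω)) = a ω + b ω := fun ω => by
      rw [he.step, map_add, map_add, map_smul, map_smul]; rfl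
    have h1 := integral_norm_add_sq (ℱ.le n) ha_meas ha2 hb2 hb0
    simp only [← hsum] at h1
    have hie := integrable_norm_sq (memLp_two_of_four
      (memLp_linear (wcol M p) (he.memLp_error n)))
    have hid : Integrable (fun ω => ‖wcol M p (dev grp p (e n ω))‖ ^ 2) P := integrable_norm_sq (memLp_two_of_four
      (memLp_linear (wcol M p ∘ₗ dev grp p) (he.memLp_error n)))
    have h2 : ∫ ω, ‖a ω‖ ^ 2 ∂P ≤ (1 - c) * ∫ ω, ‖wcol M p (dev grp p (e n ω))‖ ^ 2 ∂P
        + C * μ ^ 2 * ∫ ω, ‖wcol M p (e n ω)‖ ^ 2 ∂P := by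
      rw [← integral_const_mul, ← integral_const_mul,
        ← integral_add (hid.const_mul _) (hie.const_mul _)]
      refine integral_mono (integrable_norm_sq ha2) ((hid.const_mul _).add (hie.const_mul _))
        fun ω => ?_
      have h3 := hstep μ (e n ω)
      simp only [ha, LinearMap.comp_apply]
      rw [norm_wcol_sq hp0, norm_wcol_sq hp0, norm_wcol_sq hp0]
      exact h3
    have h4 : ∫ ω, ‖b ω‖ ^ 2 ∂P ≤ μ ^ 2 * B ^ 2 * ∫ ω, ‖s n ω‖ ^ 2 ∂P := by
      rw [← integral_const_mul]
      refine integral_mono (integrable_norm_sq hb2)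
        ((integrable_norm_sq (memLp_two_of_four (he.memLp_noise n))).const_mul _) fun ω => ?_
      simp only [hb, LinearMap.smul_apply, norm_smul, Real.norm_of_nonneg hμ0.le]
      rw [← mul_pow, ← mul_pow, mul_assoc]
      gcongr
      exact hBle _
    have h5 : ∫ ω, ‖s n ω‖ ^ 2 ∂P ≤ 1 + (K * C₄ + K) := by
      refine (integral_norm_sq_le_one_add (he.memLp_noise n)).trans ?_
      have := hnoise μ e s he n
      have h6 := mul_le_mul_of_nonneg_left hm4 hK.le
      linarith
    have h7 : ∫ ω, ‖wcol M p (e n ω)‖ ^ 2 ∂P ≤ 1 + C₄ :=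
      (integral_norm_sq_le_one_add (memLp_linear (wcol M p) (he.memLp_error n))).trans (by linarith)
    have h8 : μ ^ 2 * B ^ 2 * ∫ ω, ‖s n ω‖ ^ 2 ∂P ≤ μ ^ 2 * B ^ 2 * (1 + (K * C₄ + K)) := by
      gcongr
    have h9 : C * μ ^ 2 * ∫ ω, ‖wcol M p (e n ω)‖ ^ 2 ∂P ≤ C * μ ^ 2 * (1 + C₄) := by
      gcongr
    rw [h1, hD]
    linarith
  have := eventually_le_of_recursion
    (a := fun n => ∫ ω, ‖wcol M p (dev grp p (e n ω))‖ ^ 2 ∂P) hc hc1.le (show 0 < D * μ ^ 2 by positivity) hrec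
  filter_upwards [this] with n hn
  refine hn.trans_eq ?_
  ring

end Stability

/-! ### Convergence of the noise covariance along the iterates. -/

section NoiseCovariance

variable {N G M : ℕ} {Ω : Type*} {mΩ : MeasurableSpace Ω} {P : Measure Ω} {ℱ : Filtration ℕ mΩ}
  {T : SimpleGraph (Fin N)} {grp : Fin N → Fin G}
  {A : Matrix (Fin N) (Fin N) ℝ} {J : Fin N → Vec M → ℝ} {wo : Fin N → Vec M}
  {lamL lamU : Fin N → ℝ} {κH : ℝ} {ghat : ℕ → Fin N → Vec M → Ω → Vec M} {α σs κs γs : ℝ}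
  {Rs : Matrix (Fin N × Fin M) (Fin N × Fin M) ℝ} {τ p : Fin N → ℝ}

/-- Below the threshold `δ = η ^ γ⁻¹` the power is at most `η`; above it, `(x / δ) ^ γ ≤ (x / δ) ^
4`. This is where `γ ≤ 4` matters: the Hölder bound is turned into one by the fourth moment. -/
theorem exists_rpow_le_add_pow_four {γ : ℝ} (hγ : 0 < γ) (hγ4 : γ ≤ 4) {η : ℝ} (hη : 0 < η) :
    ∃ C : ℝ, 0 < C ∧ ∀ x : ℝ, 0 ≤ x → x ^ γ ≤ η + C * x ^ 4 := by
  set δ := η ^ γ⁻¹ with hδ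
  have hδ0 : 0 < δ := Real.rpow_pos_of_pos hη _
  have hδγ : δ ^ γ = η := by rw [hδ, ← Real.rpow_mul hη.le, inv_mul_cancel₀ hγ.ne', Real.rpow_one]
  refine ⟨η / δ ^ 4, by positivity, fun x hx => ?_⟩
  rcases le_total x δ with h | h
  · have h1 : x ^ γ ≤ η := by
      rw [← hδγ]; exact Real.rpow_le_rpow hx h hγ.le
    have h2 : 0 ≤ η / δ ^ 4 * x ^ 4 := by positivity
    linarith
  · have h1 : (x / δ) ^ γ ≤ (x / δ) ^ (4 : ℝ) :=
      Real.rpow_le_rpow_of_exponent_le ((one_le_div hδ0).mpr h) hγ4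
    rw [Real.div_rpow hx hδ0.le, hδγ, div_le_iff₀ hη] at h1
    have h2 : (x / δ) ^ (4 : ℝ) = x ^ 4 / δ ^ 4 := by
      rw [← div_pow]; exact_mod_cast Real.rpow_natCast (x / δ) 4
    rw [h2] at h1
    have h3 : x ^ 4 / δ ^ 4 * η = η / δ ^ 4 * x ^ 4 := by ring
    linarith

theorem integrable_mul_entry [IsFiniteMeasure P] {ι : Type*} [Fintype ι]
    {f : Ω → EuclideanSpace ℝ ι} (hf : MemLp f 4 P) (i j : ι) :
    Integrable (fun ω => f ω i * f ω j) P := by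
  have h2 := memLp_two_of_four hf
  have hi : ∀ i, AEStronglyMeasurable (fun ω => f ω i) P := fun i =>
    (show Continuous fun x : EuclideanSpace ℝ ι => x i by fun_prop).comp_aestronglyMeasurable hf.1
  refine (integrable_norm_sq h2).mono' ((hi i).mul (hi j)) (ae_of_all _ fun ω => ?_)
  rw [norm_mul, sq]
  exact mul_le_mul (PiLp.norm_apply_le (f ω) i) (PiLp.norm_apply_le (f ω) j) (norm_nonneg _)
    (norm_nonneg _)

theorem NoiseCondition.memLp_wo [IsFiniteMeasure P]
    (hS : NoiseCondition P ℱ J wo ghat α σs κs γs Rs) (n : ℕ) :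
    MemLp (fun ω => netNoise J ghat n wo ω) 4 P :=
  hS.memLp n (fun _ => wo) stronglyMeasurable_const (memLp_const _)

/-- A product of two entries is at most `‖S‖² ≤ 1 + ‖S‖⁴`, and the fourth moment condition at `wo`
has no error term. The constant serves as the dominating function for the limit of the covariances.
-/
theorem NoiseCondition.abs_condCov_wo_le [IsProbabilityMeasure P]
    (hS : NoiseCondition P ℱ J wo ghat α σs κs γs Rs) (n : ℕ) (i j : Fin N × Fin M) :
    ∀ᵐ ω ∂P, |condCov P (ℱ n) (fun ω' => netNoise J ghat n wo ω') ω i j| ≤ 1 + σs ^ 4 := by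
  have hL := hS.memLp_wo n
  have hint := integrable_mul_entry hL i j
  have h4 := integrable_norm_pow_four hL
  have hg : Integrable (fun ω => 1 + ‖netNoise J ghat n wo ω‖ ^ 4) P :=
    (integrable_const (1 : ℝ)).add h4
  have hle : ∀ ω, |netNoise J ghat n wo ω i * netNoise J ghat n wo ω j|
      ≤ 1 + ‖netNoise J ghat n wo ω‖ ^ 4 := fun ω => by
    have h1 : |netNoise J ghat n wo ω i * netNoise J ghat n wo ω j|
        ≤ ‖netNoise J ghat n wo ω‖ * ‖netNoise J ghat n wo ω‖ := by
      rw [abs_mul]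
      exact mul_le_mul (PiLp.norm_apply_le (netNoise J ghat n wo ω) i)
        (PiLp.norm_apply_le (netNoise J ghat n wo ω) j) (abs_nonneg _) (norm_nonneg _)
    nlinarith [sq_nonneg (‖netNoise J ghat n wo ω‖ ^ 2 - 1), sq_nonneg ‖netNoise J ghat n wo ω‖]
  have hup := condExp_mono (m := ℱ n) hint hg (ae_of_all _ fun ω => (abs_le.mp (hle ω)).2)
  have hlow := condExp_mono (m := ℱ n) hg.neg hint (ae_of_all _ fun ω => (abs_le.mp (hle ω)).1)
  have hneg := condExp_neg (μ := P) (fun ω => 1 + ‖netNoise J ghat n wo ω‖ ^ 4) (ℱ n)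
  have hadd := condExp_add (integrable_const (μ := P) (1 : ℝ)) h4 (ℱ n)
  have hconst := condExp_const (μ := P) (ℱ.le n) (1 : ℝ)
  have hfour := hS.fourth_moment n (fun _ => wo) stronglyMeasurable_const (memLp_const _)
  filter_upwards [hup, hlow, hneg, hadd, hfour] with ω h1 h2 h3 h5 h6
  have h7 : (P[fun ω => 1 + ‖netNoise J ghat n wo ω‖ ^ 4 | ℱ n]) ω ≤ 1 + σs ^ 4 := by
    have : (P[fun ω => 1 + ‖netNoise J ghat n wo ω‖ ^ 4 | ℱ n]) ω
        = 1 + (P[fun ω => ‖netNoise J ghat n wo ω‖ ^ 4 | ℱ n]) ω := by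
      refine h5.trans ?_
      rw [Pi.add_apply, hconst]
    rw [this]
    simp only [sub_self, norm_zero] at h6
    linarith
  rw [abs_le]
  have h8 : -(P[fun ω => 1 + ‖netNoise J ghat n wo ω‖ ^ 4 | ℱ n]) ω
      ≤ condCov P (ℱ n) (fun ω' => netNoise J ghat n wo ω') ω i j := by
    have := h3.symm.le.trans h2
    exact this
  have h9 : condCov P (ℱ n) (fun ω' => netNoise J ghat n wo ω') ω i j
      ≤ (P[fun ω => 1 + ‖netNoise J ghat n wo ω‖ ^ 4 | ℱ n]) ω := h1
  constructor <;> linarith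

theorem NoiseCondition.tendsto_integral_wo [IsProbabilityMeasure P]
    (hS : NoiseCondition P ℱ J wo ghat α σs κs γs Rs) (i j : Fin N × Fin M) :
    Tendsto (fun n => ∫ ω, netNoise J ghat n wo ω i * netNoise J ghat n wo ω j ∂P) atTop
      (𝓝 (Rs i j)) := by
  have h := tendsto_integral_of_dominated_convergence (μ := P)
    (F := fun n ω => condCov P (ℱ n) (fun ω' => netNoise J ghat n wo ω') ω i j)
    (f := fun _ => Rs i j) (fun _ => 1 + σs ^ 4)
    (fun n => integrable_condExp.aestronglyMeasurable) (integrable_const _)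
    (fun n => hS.abs_condCov_wo_le n i j) (by
      filter_upwards [hS.convergent_cov] with ω hω
      exact (tendsto_pi_nhds.mp (tendsto_pi_nhds.mp hω i)) j)
  have h1 : ∀ n, ∫ ω, condCov P (ℱ n) (fun ω' => netNoise J ghat n wo ω') ω i j ∂P
      = ∫ ω, netNoise J ghat n wo ω i * netNoise J ghat n wo ω j ∂P := fun n =>
    integral_condExp (ℱ.le n)
  simp only [h1] at h
  simpa using h

/-- Expectations of products are expectations of conditional covariance entries, to which the Hölder
condition applies; `hC` replaces the power `γs` by a fourth power. -/
theorem NoiseCondition.abs_integral_sub_le [IsProbabilityMeasure P]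
    (hS : NoiseCondition P ℱ J wo ghat α σs κs γs Rs) {η C : ℝ}
    (hC : ∀ x : ℝ, 0 ≤ x → x ^ γs ≤ η + C * x ^ 4) (n : ℕ) {W : Ω → Fin N → Vec M}
    (hW : StronglyMeasurable[ℱ n] W) (hWL : MemLp (fun ω => col (W ω)) 4 P)
    (i j : Fin N × Fin M) :
    |∫ ω, netNoise J ghat n (W ω) ω i * netNoise J ghat n (W ω) ω j ∂P
      - ∫ ω, netNoise J ghat n wo ω i * netNoise J ghat n wo ω j ∂P|
      ≤ κs * (η + C * ∫ ω, ‖col wo - col (W ω)‖ ^ 4 ∂P) := by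
  have hlip := hS.lipschitz_cov n W hW hWL
  have hint : Integrable (fun ω => ‖col wo - col (W ω)‖ ^ 4) P :=
    integrable_norm_pow_four ((memLp_const (col wo)).sub hWL)
  have hbound : Integrable (fun ω => κs * (η + C * ‖col wo - col (W ω)‖ ^ 4)) P :=
    ((integrable_const η).add (hint.const_mul C)).const_mul κs
  have h1 : ∫ ω, netNoise J ghat n (W ω) ω i * netNoise J ghat n (W ω) ω j ∂P
      = ∫ ω, condCov P (ℱ n) (fun ω' => netNoise J ghat n (W ω') ω') ω i j ∂P :=
    (integral_condExp (ℱ.le n)).symm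
  have h2 : ∫ ω, netNoise J ghat n wo ω i * netNoise J ghat n wo ω j ∂P
      = ∫ ω, condCov P (ℱ n) (fun ω' => netNoise J ghat n wo ω') ω i j ∂P :=
    (integral_condExp (ℱ.le n)).symm
  have hi : ∀ S : Ω → EuclideanSpace ℝ (Fin N × Fin M),
      Integrable (fun ω => condCov P (ℱ n) S ω i j) P := fun S => integrable_condExp
  rw [h1, h2, ← integral_sub (hi _) (hi _)]
  have h3 : ∫ ω, κs * (η + C * ‖col wo - col (W ω)‖ ^ 4) ∂P
      = κs * (η + C * ∫ ω, ‖col wo - col (W ω)‖ ^ 4 ∂P) := by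
    rw [integral_const_mul, integral_add (integrable_const η) (hint.const_mul C),
      integral_const_mul]
    simp
  rw [← h3, ← Real.norm_eq_abs]
  refine norm_integral_le_of_norm_le hbound ?_
  filter_upwards [hlip] with ω hω
  rw [← Matrix.sub_apply, Real.norm_eq_abs]
  refine (abs_entry_le_norm _ i j).trans ?_
  rw [norm_sub_rev]
  exact hω.trans (mul_le_mul_of_nonneg_left (hC _ (norm_nonneg _)) hS.κs_nonneg)

/-- Eventually the noise covariance is close to its limit. -/
theorem eventually_noise_moment_sub_le [IsProbabilityMeasure P] (hgrp : IsGrouping T grp wo)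
    (hA : IsCombination T grp A) (hJ : CostCondition grp J wo lamL lamU κH)
    (hS : NoiseCondition P ℱ J wo ghat α σs κs γs Rs)
    (hτ : IsStepProfile τ) (hp : IsPerron grp A p) {ε : ℝ} (hε : 0 < ε) :
    ∀ᶠ μ in 𝓝[>] (0 : ℝ), ∀ᶠ n in atTop,
      ‖moment P (fun ω => netNoise J ghat n (estimate A τ ghat μ n ω) ω)
        (fun ω => netNoise J ghat n (estimate A τ ghat μ n ω) ω) - Rs‖ ≤ ε := by
  obtain ⟨C₄, hC₄, hfourth⟩ := exists_eventually_fourth_moment_le (P := P) (ℱ := ℱ)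
    hgrp hA hJ hτ hp α σs
  obtain ⟨K, hK, hKle⟩ := hp.exists_integral_norm_col_pow_four_le (M := M) (P := P)
  set d : ℝ := (Fintype.card (Fin N × Fin M) : ℝ) ^ 2 + 1 with hd
  have hd0 : 0 < d := by positivity
  have hκ := hS.κs_nonneg
  -- Each entry receives the budget `ε / d`: one third for the convergence at `wo`, two thirds for
  -- `(κs + 1) * (η + η)`. The number `d` exceeds the number of entries.
  set η := ε / (3 * d * (κs + 1)) with hη
  have hη0 : 0 < η := by positivity
  obtain ⟨C, hC0, hC⟩ := exists_rpow_le_add_pow_four hS.γs_pos hS.γs_le hη0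
  filter_upwards [hfourth, self_mem_nhdsWithin, eventually_lt_nhdsGT_zero one_pos,
    eventually_lt_nhdsGT_zero (a := η / (C * (K * C₄))) (by positivity)] with μ hμ4 hμ hμ1 hμη
  have hμ0 : 0 < μ := hμ
  rw [lt_div_iff₀ (by positivity)] at hμη
  have hproc := isErrorProcess_estimate hgrp hA hJ hτ hS μ
  have hlim : ∀ᶠ n in atTop, ∀ i j, |∫ ω, netNoise J ghat n wo ω i * netNoise J ghat n wo ω j ∂P
      - Rs i j| < ε / (3 * d) := by
    rw [eventually_all]; intro i
    rw [eventually_all]; intro j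
    have := (hS.tendsto_integral_wo i j).sub_const (Rs i j)
    rw [sub_self] at this
    have h0 := this.abs
    rw [abs_zero] at h0
    exact h0.eventually_lt_const (by positivity)
  filter_upwards [hμ4 _ _ hproc, hlim] with n hn hnlim
  have hW := estimate_stronglyMeasurable hgrp hA hJ hτ hS μ n
  have hWL := memLp_col_estimate hgrp hA hJ hτ hS μ n
  have hs2 := memLp_two_of_four (hproc.memLp_noise n)
  have hentry : ∀ i j, |(moment P (fun ω => netNoise J ghat n (estimate A τ ghat μ n ω) ω)
        (fun ω => netNoise J ghat n (estimate A τ ghat μ n ω) ω) - Rs) i j| ≤ ε / d := by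
    intro i j
    rw [Matrix.sub_apply, moment_apply hs2 hs2]
    have h1 := hS.abs_integral_sub_le hC n hW hWL i j
    have h2 := hnlim i j
    have h3 : ∫ ω, ‖col wo - col (estimate A τ ghat μ n ω)‖ ^ 4 ∂P ≤ K * (C₄ * μ ^ 2) :=
      (hKle _ (hproc.memLp_error n)).trans (mul_le_mul_of_nonneg_left hn hK.le)
    have h4 : C * ∫ ω, ‖col wo - col (estimate A τ ghat μ n ω)‖ ^ 4 ∂P ≤ η := by
      refine (mul_le_mul_of_nonneg_left h3 hC0.le).trans ?_
      have : C * (K * (C₄ * μ ^ 2)) = (μ * (C * (K * C₄))) * μ := by ring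
      rw [this]
      nlinarith
    have h5 : κs * (η + C * ∫ ω, ‖col wo - col (estimate A τ ghat μ n ω)‖ ^ 4 ∂P)
        ≤ (κs + 1) * (η + η) := by
      gcongr
      linarith
    have h6 : (κs + 1) * (η + η) = 2 * (ε / (3 * d)) := by
      rw [hη]; field_simp; ring
    have h7 : ε / d = 3 * (ε / (3 * d)) := by field_simp
    have h8 := abs_sub_le
      (∫ ω, netNoise J ghat n (estimate A τ ghat μ n ω) ω i
        * netNoise J ghat n (estimate A τ ghat μ n ω) ω j ∂P)
      (∫ ω, netNoise J ghat n wo ω i * netNoise J ghat n wo ω j ∂P) (Rs i j)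
    linarith
  refine (norm_le_sum_abs_entry _).trans ?_
  refine (Finset.sum_le_sum fun i _ => Finset.sum_le_sum fun j _ => hentry i j).trans ?_
  simp only [Finset.sum_const, Finset.card_univ, nsmul_eq_mul]
  rw [← mul_assoc, ← sq, mul_div_assoc', div_le_iff₀ hd0, mul_comm]
  gcongr
  linarith

end NoiseCovariance

/-! ### Coercive matrices and the Lyapunov equation. -/

section Lyapunov

variable {ι : Type*} [Fintype ι] [DecidableEq ι]

/-- In `‖x‖² - 2 μ ⟨x, H x⟩ + μ² ‖H x‖²` the middle term gains `2 * lam * μ * ‖x‖²`, and for small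
`μ` the last one uses up at most half of that. -/
theorem eventually_norm_one_sub_smul_sq_le {H : Matrix ι ι ℝ} {lam : ℝ} (hlam : 0 < lam)
    (hH : ∀ x : EuclideanSpace ℝ ι,
      lam * ‖x‖ ^ 2 ≤ inner ℝ x (Matrix.toEuclideanCLM (𝕜 := ℝ) H x)) :
    ∀ᶠ μ in 𝓝[>] (0 : ℝ), ‖1 - μ • H‖ ^ 2 ≤ 1 - lam * μ := by
  filter_upwards [self_mem_nhdsWithin,
    eventually_lt_nhdsGT_zero (a := lam / (‖H‖ ^ 2 + 1)) (by positivity),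
    eventually_lt_nhdsGT_zero (a := 1 / lam) (by positivity)] with μ hμ hμ1 hμ2
  have hμ0 : 0 < μ := hμ
  rw [lt_div_iff₀ (by positivity)] at hμ1 hμ2
  have hnn : 0 ≤ 1 - lam * μ := by linarith
  have h : ‖1 - μ • H‖ ≤ Real.sqrt (1 - lam * μ) := by
    rw [← Matrix.l2_opNorm_toEuclideanCLM]
    refine ContinuousLinearMap.opNorm_le_bound _ (Real.sqrt_nonneg _) fun x => ?_
    refine (sq_le_sq₀ (norm_nonneg _) (by positivity)).mp ?_
    rw [mul_pow, Real.sq_sqrt hnn, map_sub, map_one, map_smul, _root_.sub_apply,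
      _root_.one_apply_eq_self, _root_.smul_apply, norm_sub_sq_real, real_inner_smul_right,
      norm_smul, mul_pow, Real.norm_eq_abs, sq_abs]
    have h1 := hH x
    have h2 : ‖Matrix.toEuclideanCLM (𝕜 := ℝ) H x‖ ^ 2 ≤ (‖H‖ * ‖x‖) ^ 2 := by
      gcongr
      exact (ContinuousLinearMap.le_opNorm _ _).trans_eq (by rw [Matrix.l2_opNorm_toEuclideanCLM])
    have h3 : μ ^ 2 * ‖Matrix.toEuclideanCLM (𝕜 := ℝ) H x‖ ^ 2 ≤ μ * (lam * ‖x‖ ^ 2) := by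
      calc μ ^ 2 * ‖Matrix.toEuclideanCLM (𝕜 := ℝ) H x‖ ^ 2
          ≤ μ ^ 2 * (‖H‖ * ‖x‖) ^ 2 := by gcongr
        _ = μ * ((μ * ‖H‖ ^ 2) * ‖x‖ ^ 2) := by ring
        _ ≤ μ * (lam * ‖x‖ ^ 2) := by
          gcongr
          linarith
    nlinarith
  calc ‖1 - μ • H‖ ^ 2 ≤ Real.sqrt (1 - lam * μ) ^ 2 := by gcongr
    _ = 1 - lam * μ := Real.sq_sqrt hnn

theorem one_sub_smul_mul_mul (H X : Matrix ι ι ℝ) (μ : ℝ) :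
    (1 - μ • H) * X * (1 - μ • H) = X - μ • (H * X + X * H) + μ ^ 2 • (H * X * H) := by
  have h : ∀ B : Matrix ι ι ℝ, (1 - B) * X * (1 - B) = X - (B * X + X * B) + B * X * B := by
    intro B; noncomm_ring
  rw [h, smul_mul_assoc, mul_smul_comm, smul_mul_assoc, mul_smul_comm, smul_smul, ← sq, smul_add]

theorem norm_mul_mul_le (K X : Matrix ι ι ℝ) {r : ℝ} (hK : ‖K‖ ^ 2 ≤ r) :
    ‖K * X * K‖ ≤ r * ‖X‖ := by
  have h1 := norm_mul_le (K * X) K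
  have h2 := norm_mul_le K X
  calc ‖K * X * K‖ ≤ ‖K‖ * ‖X‖ * ‖K‖ := h1.trans (by gcongr)
    _ = ‖K‖ ^ 2 * ‖X‖ := by ring
    _ ≤ r * ‖X‖ := by gcongr

/-- A continuous Lyapunov equation with a coercive coefficient has a unique solution. -/
theorem existsUnique_lyapunov {H : Matrix ι ι ℝ} {lam : ℝ} (hlam : 0 < lam)
    (hH : ∀ x : EuclideanSpace ℝ ι,
      lam * ‖x‖ ^ 2 ≤ inner ℝ x (Matrix.toEuclideanCLM (𝕜 := ℝ) H x)) (R : Matrix ι ι ℝ) :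
    ∃! X, H * X + X * H = R := by
  have hinj : Function.Injective (LinearMap.mulLeft ℝ H + LinearMap.mulRight ℝ H) := by
    rw [← LinearMap.ker_eq_bot, LinearMap.ker_eq_bot']
    intro X hX
    rw [LinearMap.add_apply, LinearMap.mulLeft_apply, LinearMap.mulRight_apply] at hX
    obtain ⟨μ, hμK, hμ0, hμH⟩ := ((eventually_norm_one_sub_smul_sq_le hlam hH).and
      ((eventually_mem_nhdsWithin (a := (0 : ℝ)) (s := Set.Ioi 0)).and (eventually_lt_nhdsGT_zero
        (a := lam / (‖H‖ ^ 2 + 1)) (by positivity)))).exists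
    have hμ : 0 < μ := hμ0
    rw [lt_div_iff₀ (by positivity)] at hμH
    have h1 := one_sub_smul_mul_mul H X μ
    rw [hX, smul_zero, sub_zero] at h1
    -- A solution of the homogeneous equation satisfies `X = (1 - μ H) X (1 - μ H) - μ² H X H`. With
    -- `μ * (‖H‖ ^ 2 + 1) < lam` the right side is strictly smaller in norm unless `X = 0`.
    have h2 : ‖X‖ ≤ (1 - lam * μ) * ‖X‖ + μ ^ 2 * (‖H‖ ^ 2 * ‖X‖) := by
      have h3 : X = (1 - μ • H) * X * (1 - μ • H) - μ ^ 2 • (H * X * H) := by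
        rw [h1, add_sub_cancel_right]
      calc ‖X‖ = ‖(1 - μ • H) * X * (1 - μ • H) - μ ^ 2 • (H * X * H)‖ := by rw [← h3]
        _ ≤ ‖(1 - μ • H) * X * (1 - μ • H)‖ + ‖μ ^ 2 • (H * X * H)‖ := norm_sub_le _ _
        _ ≤ (1 - lam * μ) * ‖X‖ + μ ^ 2 * (‖H‖ ^ 2 * ‖X‖) := by
          gcongr
          · exact norm_mul_mul_le _ _ hμK
          · rw [norm_smul, Real.norm_of_nonneg (sq_nonneg μ)]
            gcongr
            exact norm_mul_mul_le _ _ le_rfl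
    have h4 : 0 ≤ ‖X‖ := norm_nonneg X
    by_contra hne
    have h5 : 0 < ‖X‖ := norm_pos_iff.mpr hne
    have h6 : 0 < μ * ‖X‖ := mul_pos hμ h5
    nlinarith
  obtain ⟨X, hX⟩ := LinearMap.injective_iff_surjective.mp hinj R
  exact ⟨X, hX, fun Y hY => hinj (Eq.trans hY hX.symm)⟩

end Lyapunov

/-! ### The linearized recursion of the group averages. -/

section Averages

variable {N G M : ℕ} {T : SimpleGraph (Fin N)} {grp : Fin N → Fin G}
  {A : Matrix (Fin N) (Fin N) ℝ} {J : Fin N → Vec M → ℝ} {wo : Fin N → Vec M}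
  {lamL lamU : Fin N → ℝ} {κH : ℝ} {τ p : Fin N → ℝ}

theorem toEuclideanCLM_Hbar (J : Fin N → Vec M → ℝ) (wo : Fin N → Vec M) (τ p : Fin N → ℝ)
    (x : Fin G → Vec M) :
    Matrix.toEuclideanCLM (𝕜 := ℝ) (Hbar grp J wo τ p) (col x)
      = col fun m => ∑ k with grp k = m,
        (p k * τ k) • Matrix.toEuclideanCLM (𝕜 := ℝ) (hessian (J k) (wo k)) (x m) := by
  have h : ∀ m, ∑ k with grp k = m,
        (p k * τ k) • Matrix.toEuclideanCLM (𝕜 := ℝ) (hessian (J k) (wo k)) (x m)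
      = Matrix.toEuclideanCLM (𝕜 := ℝ)
        (∑ k with grp k = m, (p k * τ k) • hessian (J k) (wo k)) (x m) := by
    intro m
    rw [map_sum, _root_.sum_apply]
    refine Finset.sum_congr rfl fun k _ => ?_
    rw [map_smul, _root_.smul_apply]
  simp only [h]
  ext ⟨m, a⟩
  rw [Matrix.ofLp_toEuclideanCLM, col_apply, Matrix.ofLp_toEuclideanCLM]
  simp only [Matrix.mulVec, dotProduct, Hbar, Matrix.of_apply, Fintype.sum_prod_type, col_apply]
  rw [Finset.sum_eq_single m]
  · simp
  · intro l _ hl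
    simp [hl.symm]
  · simp

theorem inner_col (x y : Fin N → Vec M) : inner ℝ (col x) (col y) = ∑ k, inner ℝ (x k) (y k) := by
  simp only [PiLp.inner_apply, Fintype.sum_prod_type, col_apply]

/-- In each diagonal block the lower Hessian bounds add up with weights `p k * τ k`, and at least
one of them is positive. -/
theorem CostCondition.exists_Hbar_coercive (hJ : CostCondition grp J wo lamL lamU κH)
    (hτ : IsStepProfile τ) (hp : IsPerron grp A p) :
    ∃ lam : ℝ, 0 < lam ∧ ∀ x : EuclideanSpace ℝ (Fin G × Fin M), lam * ‖x‖ ^ 2 ≤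
      inner ℝ x (Matrix.toEuclideanCLM (𝕜 := ℝ) (Hbar grp J wo τ p) x) := by
  obtain ⟨lam, hlam, hle⟩ := hJ.exists_pos_le_sum_lamL hτ hp
  refine ⟨lam, hlam, fun z => ?_⟩
  rw [← col_uncol z, toEuclideanCLM_Hbar, inner_col, norm_col_sq, Finset.mul_sum]
  refine Finset.sum_le_sum fun m _ => ?_
  rw [inner_sum]
  refine (mul_le_mul_of_nonneg_right (hle m) (sq_nonneg _)).trans ?_
  rw [Finset.sum_mul]
  refine Finset.sum_le_sum fun k _ => ?_
  rw [real_inner_smul_right, mul_assoc]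
  refine mul_le_mul_of_nonneg_left ?_ (mul_pos (hp.pos k) (hτ.pos k)).le
  have h := inner_toEuclideanCLM_nonneg (hJ.hessian_lower k (wo k)) (uncol G M z m)
  rw [toEuclideanCLM_sub_smul_one] at h
  linarith

theorem CostCondition.transpose_Hbar (hJ : CostCondition grp J wo lamL lamU κH) :
    (Hbar grp J wo τ p).transpose = Hbar grp J wo τ p := by
  ext ⟨m, a⟩ ⟨r, b⟩
  rw [Matrix.transpose_apply]
  simp only [Hbar, Matrix.of_apply]
  by_cases h : m = r
  · subst h
    simp only [if_true, Matrix.sum_apply, Matrix.smul_apply]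
    refine Finset.sum_congr rfl fun k _ => ?_
    have := (hJ.hessian_posSemidef k (wo k)).1.apply a b
    simp only [star_trivial] at this
    rw [this]
  · rw [if_neg h, if_neg fun h' => h h'.symm]

/-- The matrix that maps the network noise to its group averages, `𝒫ᵀ 𝒯`. -/
noncomputable def avgNoise (M : ℕ) (grp : Fin N → Fin G) (τ p : Fin N → ℝ) :
    Matrix (Fin G × Fin M) (Fin N × Fin M) ℝ :=
  (bigP M grp p).transpose * bigT M τ

theorem Rbar_eq (grp : Fin N → Fin G) (τ p : Fin N → ℝ)
    (Rs : Matrix (Fin N × Fin M) (Fin N × Fin M) ℝ) :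
    Rbar grp τ p Rs = avgNoise M grp τ p * Rs * (avgNoise M grp τ p).transpose := by
  have hT : (bigT M τ).transpose = bigT M τ := by
    rw [bigT, ← Matrix.kroneckerMap_transpose, Matrix.diagonal_transpose, Matrix.transpose_one]
  rw [Rbar, avgNoise, Matrix.transpose_mul, Matrix.transpose_transpose, hT]
  simp only [Matrix.mul_assoc]

theorem avgNoise_mulVec (grp : Fin N → Fin G) (τ p : Fin N → ℝ)
    (z : EuclideanSpace ℝ (Fin N × Fin M)) :
    WithLp.toLp 2 ((avgNoise M grp τ p).mulVec z)
      = col (avg grp p (scale M τ (uncol N M z))) := by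
  have hT : ∀ k a, (bigT M τ).mulVec z (k, a) = τ k * z (k, a) := by
    intro k a
    simp only [Matrix.mulVec, dotProduct, bigT, Matrix.kroneckerMap_apply, Fintype.sum_prod_type]
    rw [Finset.sum_eq_single k, Finset.sum_eq_single a]
    · simp
    · intro b _ hb; simp [Matrix.one_apply_ne hb.symm]
    · simp
    · intro l _ hl; simp [Matrix.diagonal_apply_ne _ hl.symm]
    · simp
  ext ⟨m, a⟩
  rw [avgNoise, ← Matrix.mulVec_mulVec, col_apply, avg_apply]
  simp only [Matrix.mulVec, dotProduct, Matrix.transpose_apply, bigP, Matrix.kroneckerMap_apply,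
    Fintype.sum_prod_type, Matrix.of_apply]
  rw [WithLp.ofLp_sum, Finset.sum_apply, Finset.sum_filter]
  refine Finset.sum_congr rfl fun k _ => ?_
  rw [Finset.sum_eq_single a]
  · have := hT k a
    simp only [Matrix.mulVec, dotProduct, Fintype.sum_prod_type] at this
    rw [this]
    split_ifs
    · rw [Matrix.one_apply_eq, mul_one]
      rfl
    · simp
  · intro b _ hb; simp [Matrix.one_apply_ne hb]
  · simp

/-- The error of linearizing the averaged drift at the minimizers. -/
noncomputable def driftError (grp : Fin N → Fin G) (J : Fin N → Vec M → ℝ) (wo : Fin N → Vec M)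
    (τ p : Fin N → ℝ) (e : Fin N → Vec M) : EuclideanSpace ℝ (Fin G × Fin M) :=
  col (avg grp p (drift J wo τ e))
    + Matrix.toEuclideanCLM (𝕜 := ℝ) (Hbar grp J wo τ p) (col (avg grp p e))

theorem sq_sum_mul_norm_le (hp : ∀ k, 0 ≤ p k) (y : Fin N → Vec M) :
    (∑ k, p k * ‖y k‖) ^ 2 ≤ (∑ k, p k) * wsq p y :=
  Finset.sum_sq_le_sum_mul_sum_of_sq_le_mul _ (fun k _ => hp k)
    (fun k _ => mul_nonneg (hp k) (sq_nonneg _)) fun k _ => le_of_eq (by ring)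

/-- Two errors enter: the Taylor remainder of each gradient, quadratic in `e k`, and the replacement
of `e k` by its group average under the Hessian, linear in the deviation. -/
theorem CostCondition.exists_norm_driftError_sq_le (hJ : CostCondition grp J wo lamL lamU κH)
    (hτ : IsStepProfile τ) (hp : IsPerron grp A p) :
    ∃ C : ℝ, 0 < C ∧ ∀ e : Fin N → Vec M, ‖driftError grp J wo τ p e‖ ^ 2 ≤
      C * (wsq p e ^ 2 + wsq p (dev grp p e)) := by
  have hp0 : ∀ k, 0 ≤ p k := fun k => (hp.pos k).le
  have hκ := hJ.κH_nonneg
  set Λ := ∑ l, (lamU l + 1) with hΛ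
  have hΛ0 : 0 ≤ Λ := Finset.sum_nonneg fun l _ => by
    linarith [hJ.lamL_nonneg l, hJ.lamL_le_lamU l]
  have hps : 0 ≤ ∑ k, p k := Finset.sum_nonneg fun k _ => hp0 k
  refine ⟨G * (2 * κH ^ 2 + 2 * Λ ^ 2 * ∑ k, p k) + 1, by positivity, fun e => ?_⟩
  set V := wsq p e with hV
  set Y := wsq p (dev grp p e) with hY
  have hY0 : 0 ≤ Y := wsq_nonneg hp0 _
  set S := ∑ k, p k * ‖dev grp p e k‖ with hS
  have hS0 : 0 ≤ S := Finset.sum_nonneg fun k _ => mul_nonneg (hp0 k) (norm_nonneg _)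
  have hV0 : 0 ≤ V := wsq_nonneg hp0 _
  -- Cauchy–Schwarz passes from the weighted sum of norms to `wsq`.
  have hSY : S ^ 2 ≤ (∑ k, p k) * Y := sq_sum_mul_norm_le hp0 _
  have hm : ∀ m, ‖avg grp p (drift J wo τ e) m + ∑ k with grp k = m, (p k * τ k) •
      Matrix.toEuclideanCLM (𝕜 := ℝ) (hessian (J k) (wo k)) (avg grp p e m)‖ ≤ κH * V + Λ * S := by
    intro m
    rw [avg_apply grp p (drift J wo τ e), ← Finset.sum_add_distrib]
    have hk : ∀ k ∈ Finset.univ.filter (fun k => grp k = m), ‖p k • drift J wo τ e k +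
        (p k * τ k) • Matrix.toEuclideanCLM (𝕜 := ℝ) (hessian (J k) (wo k)) (avg grp p e m)‖
        ≤ κH * (p k * ‖e k‖ ^ 2) + Λ * (p k * ‖dev grp p e k‖) := by
      intro k hk
      set B := Matrix.toEuclideanCLM (𝕜 := ℝ) (hessian (J k) (wo k)) with hB
      have h1 : p k • drift J wo τ e k + (p k * τ k) • B (avg grp p e m)
          = (p k * τ k) • ((gradient (J k) (wo k - e k) + B (e k)) - B (dev grp p e k)) := by
        rw [dev_apply, (Finset.mem_filter.mp hk).2, map_sub, drift, smul_smul, ← smul_add]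
        congr 1
        abel
      rw [h1, norm_smul, Real.norm_of_nonneg (mul_pos (hp.pos k) (hτ.pos k)).le]
      have h2 := hJ.norm_gradient_add_hessian_le k (e k)
      have h3 : ‖B (dev grp p e k)‖ ≤ Λ * ‖dev grp p e k‖ := by
        refine (B.le_opNorm _).trans ?_
        gcongr
        rw [hB, Matrix.l2_opNorm_toEuclideanCLM]
        exact (hJ.norm_hessian_le k _).trans (hJ.lamU_add_one_le k)
      calc p k * τ k * ‖(gradient (J k) (wo k - e k) + B (e k)) - B (dev grp p e k)‖
          ≤ p k * 1 * (κH * ‖e k‖ ^ 2 + Λ * ‖dev grp p e k‖) := by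
            have := hp.pos k
            gcongr
            · exact hτ.le_one k
            · exact (norm_sub_le _ _).trans (add_le_add h2 h3)
        _ = κH * (p k * ‖e k‖ ^ 2) + Λ * (p k * ‖dev grp p e k‖) := by ring
    refine (norm_sum_le _ _).trans ((Finset.sum_le_sum hk).trans ?_)
    refine (Finset.sum_le_univ_sum_of_nonneg fun k => ?_).trans_eq ?_
    · have := hp0 k; positivity
    · rw [Finset.sum_add_distrib, ← Finset.mul_sum, ← Finset.mul_sum]; rfl
  have hnorm : ‖driftError grp J wo τ p e‖ ^ 2 ≤ G * (κH * V + Λ * S) ^ 2 := by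
    rw [driftError, toEuclideanCLM_Hbar, ← colL_apply, ← colL_apply, ← map_add, colL_apply,
      norm_col_sq]
    refine (Finset.sum_le_sum fun m _ => pow_le_pow_left₀ (norm_nonneg _) (hm m) 2).trans_eq ?_
    simp
  have h4 : (κH * V + Λ * S) ^ 2 ≤ 2 * κH ^ 2 * V ^ 2 + 2 * Λ ^ 2 * ((∑ k, p k) * Y) := by
    have h5 : Λ ^ 2 * S ^ 2 ≤ Λ ^ 2 * ((∑ k, p k) * Y) := by gcongr
    nlinarith [sq_nonneg (κH * V - Λ * S)]
  refine hnorm.trans ((mul_le_mul_of_nonneg_left h4 (Nat.cast_nonneg G)).trans ?_)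
  have h6 : 0 ≤ (G : ℝ) * (2 * κH ^ 2) * Y := by positivity
  have h7 : 0 ≤ (G : ℝ) * (2 * Λ ^ 2 * ∑ k, p k) * V ^ 2 := by positivity
  have h8 : 0 ≤ V ^ 2 := sq_nonneg V
  nlinarith

theorem norm_col_avg_sq_le (hp : IsPerron grp A p) (e : Fin N → Vec M) :
    ‖col (avg grp p e)‖ ^ 2 ≤ wsq p e := by
  rw [hp.wsq_eq e, norm_col_sq]
  exact le_add_of_nonneg_right (wsq_nonneg (fun k => (hp.pos k).le) _)

/-- The recursion of the group averages. -/
theorem col_avg_step (hA : IsCombination T grp A) (hp : IsPerron grp A p) (μ : ℝ)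
    (e : Fin N → Vec M) (z : EuclideanSpace ℝ (Fin N × Fin M)) :
    col (avg grp p (comb A (e + μ • drift J wo τ e) + μ • noiseMap M A τ z))
      = (WithLp.toLp 2 ((1 - μ • Hbar grp J wo τ p).mulVec (col (avg grp p e)))
          + μ • driftError grp J wo τ p e)
        + WithLp.toLp 2 ((μ • avgNoise M grp τ p).mulVec z) := by
  have h1 : WithLp.toLp 2 ((μ • avgNoise M grp τ p).mulVec z)
      = μ • col (avg grp p (scale M τ (uncol N M z))) := by
    rw [Matrix.smul_mulVec, WithLp.toLp_smul, avgNoise_mulVec]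
  have h2 : WithLp.toLp 2 ((1 - μ • Hbar grp J wo τ p).mulVec (col (avg grp p e)))
      = col (avg grp p e)
        - μ • Matrix.toEuclideanCLM (𝕜 := ℝ) (Hbar grp J wo τ p) (col (avg grp p e)) := by
    rw [Matrix.sub_mulVec, Matrix.one_mulVec, Matrix.smul_mulVec]; rfl
  rw [h1, h2, driftError, noiseMap, LinearMap.comp_apply, LinearMap.comp_apply, map_add, map_smul,
    hp.avg_comb hA, hp.avg_comb hA, map_add, map_smul]
  simp only [← colL_apply, map_add, map_smul]
  module

end Averages

/-! ### Limit of the normalized covariance. -/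

section Covariance

variable {N G M : ℕ} {Ω : Type*} {mΩ : MeasurableSpace Ω} {P : Measure Ω} {ℱ : Filtration ℕ mΩ}
  {T : SimpleGraph (Fin N)} {grp : Fin N → Fin G}
  {A : Matrix (Fin N) (Fin N) ℝ} {J : Fin N → Vec M → ℝ} {wo : Fin N → Vec M}
  {lamL lamU : Fin N → ℝ} {κH : ℝ} {ghat : ℕ → Fin N → Vec M → Ω → Vec M} {α σs κs γs : ℝ}
  {Rs : Matrix (Fin N × Fin M) (Fin N × Fin M) ℝ} {τ p : Fin N → ℝ}

theorem CostCondition.continuous_driftError (hJ : CostCondition grp J wo lamL lamU κH) :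
    Continuous (driftError grp J wo τ p) := by
  have h1 : Continuous fun e : Fin N → Vec M => col (avg grp p e) :=
    (colL G M).continuous.comp (LinearMap.continuous_of_finiteDimensional _)
  exact (h1.comp hJ.continuous_drift).add ((ContinuousLinearMap.continuous _).comp h1)

theorem memLp_driftError (hJ : CostCondition grp J wo lamL lamU κH) (hτ : IsStepProfile τ)
    {e : Ω → Fin N → Vec M} {q : ℝ≥0∞} (he : MemLp e q P) :
    MemLp (fun ω => driftError grp J wo τ p (e ω)) q P := by
  have h1 := memLp_linear ((colL G M).toLinearMap ∘ₗ avg grp p) (memLp_drift hJ hτ he)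
  have h2 := memLp_linear ((Matrix.toEuclideanCLM (𝕜 := ℝ) (Hbar grp J wo τ p)).toLinearMap ∘ₗ
    (colL G M).toLinearMap ∘ₗ avg grp p) he
  exact h1.add h2

theorem norm_toLp_mulVec_le {ι κ : Type*} [Fintype ι] [Fintype κ] [DecidableEq κ]
    (B : Matrix ι κ ℝ) (x : EuclideanSpace ℝ κ) :
    ‖(WithLp.toLp 2 (B.mulVec x) : EuclideanSpace ℝ ι)‖ ≤ ‖B‖ * ‖x‖ :=
  Matrix.l2_opNorm_mulVec B x

theorem memLp_mulVec {ι κ : Type*} [Fintype ι] [Fintype κ] [DecidableEq κ] (B : Matrix ι κ ℝ)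
    {f : Ω → EuclideanSpace ℝ κ} {q : ℝ≥0∞} (hf : MemLp f q P) :
    MemLp (fun ω => (WithLp.toLp 2 (B.mulVec (f ω)) : EuclideanSpace ℝ ι)) q P :=
  memLp_linear (Matrix.toEuclideanLin B) hf

/-- The orders of magnitude of the moments that enter the covariance recursion. -/
theorem exists_eventually_moments_le [IsProbabilityMeasure P] (hgrp : IsGrouping T grp wo)
    (hA : IsCombination T grp A) (hJ : CostCondition grp J wo lamL lamU κH)
    (hτ : IsStepProfile τ) (hp : IsPerron grp A p) (α σs : ℝ) :
    ∃ C : ℝ, 0 < C ∧ ∀ᶠ μ in 𝓝[>] (0 : ℝ), ∀ (e : ℕ → Ω → Fin N → Vec M)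
      (s : ℕ → Ω → EuclideanSpace ℝ (Fin N × Fin M)), IsErrorProcess P ℱ A J wo τ α σs μ e s →
      ∀ᶠ n in atTop, ∫ ω, ‖col (avg grp p (e n ω))‖ ^ 2 ∂P ≤ C * μ ∧
        ∫ ω, ‖driftError grp J wo τ p (e n ω)‖ ^ 2 ∂P ≤ C * μ ^ 2 ∧
        ∫ ω, ‖col (dev grp p (e n ω))‖ ^ 2 ∂P ≤ C * μ ^ 2 := by
  obtain ⟨C₄, hC₄, hfourth⟩ := exists_eventually_fourth_moment_le (P := P) (ℱ := ℱ)
    hgrp hA hJ hτ hp α σs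
  obtain ⟨Cd, hCd, hdev⟩ := exists_eventually_dev_moment_le (P := P) (ℱ := ℱ)
    hgrp hA hJ hτ hp α σs
  obtain ⟨Cq, hCq, hq⟩ := hJ.exists_norm_driftError_sq_le (τ := τ) hτ hp
  obtain ⟨K, hK, hKle⟩ := hp.exists_norm_col_sq_le (M := M)
  have hp0 : ∀ k, 0 ≤ p k := fun k => (hp.pos k).le
  refine ⟨(C₄ + 1) + Cq * (C₄ + Cd) + K * Cd, by positivity, ?_⟩
  filter_upwards [hfourth, hdev, self_mem_nhdsWithin] with μ hμ4 hμd hμ e s he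
  have hμ0 : 0 < μ := hμ
  have hCqd : 0 ≤ Cq * (C₄ + Cd) := by positivity
  have hKd : 0 ≤ K * Cd := by positivity
  filter_upwards [hμ4 e s he, hμd e s he] with n hn4 hnd
  have hw4 := memLp_linear (wcol M p) (he.memLp_error n)
  have hd2 : Integrable (fun ω => ‖wcol M p (dev grp p (e n ω))‖ ^ 2) P :=
    integrable_norm_sq (memLp_two_of_four
      (memLp_linear (wcol M p ∘ₗ dev grp p) (he.memLp_error n)))
  refine ⟨?_, ?_, ?_⟩
  · have h1 : ∫ ω, ‖col (avg grp p (e n ω))‖ ^ 2 ∂P ≤ ∫ ω, ‖wcol M p (e n ω)‖ ^ 2 ∂P := by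
      refine integral_mono (integrable_norm_sq (memLp_two_of_four
        (memLp_linear ((colL G M).toLinearMap ∘ₗ avg grp p) (he.memLp_error n))))
        (integrable_norm_sq (memLp_two_of_four hw4)) fun ω => ?_
      simp only
      rw [norm_wcol_sq hp0]
      exact norm_col_avg_sq_le hp (e n ω)
    have h2 := (sq_integral_norm_sq_le hw4).trans hn4
    have h3 : ∫ ω, ‖wcol M p (e n ω)‖ ^ 2 ∂P ≤ (C₄ + 1) * μ := by
      -- The second moment is at most the root of the fourth; `C₄ ≤ (C₄ + 1) ^ 2` avoids a square
      -- root in the constant.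
      refine le_of_sq_le_sq ?_ (by positivity)
      refine h2.trans ?_
      rw [mul_pow]
      gcongr
      nlinarith
    refine h1.trans (h3.trans (mul_le_mul_of_nonneg_right ?_ hμ0.le))
    linarith
  · have h1 : ∫ ω, ‖driftError grp J wo τ p (e n ω)‖ ^ 2 ∂P ≤
        Cq * (∫ ω, ‖wcol M p (e n ω)‖ ^ 4 ∂P
          + ∫ ω, ‖wcol M p (dev grp p (e n ω))‖ ^ 2 ∂P) := by
      rw [← integral_add (integrable_norm_pow_four hw4) hd2, ← integral_const_mul]
      refine integral_mono (integrable_norm_sq (memLp_driftError hJ hτ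
        (memLp_two_of_four (he.memLp_error n))))
        (((integrable_norm_pow_four hw4).add hd2).const_mul _) fun ω => ?_
      simp only
      rw [norm_wcol_sq hp0, norm_wcol_pow_four hp0]
      exact hq (e n ω)
    refine h1.trans ?_
    have h2 : Cq * (∫ ω, ‖wcol M p (e n ω)‖ ^ 4 ∂P
        + ∫ ω, ‖wcol M p (dev grp p (e n ω))‖ ^ 2 ∂P) ≤ Cq * (C₄ * μ ^ 2 + Cd * μ ^ 2) := by
      gcongr
    refine h2.trans ?_
    have h3 : Cq * (C₄ * μ ^ 2 + Cd * μ ^ 2) = Cq * (C₄ + Cd) * μ ^ 2 := by ring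
    rw [h3]
    refine mul_le_mul_of_nonneg_right ?_ (sq_nonneg μ)
    linarith
  · have h1 : ∫ ω, ‖col (dev grp p (e n ω))‖ ^ 2 ∂P ≤
        K * ∫ ω, ‖wcol M p (dev grp p (e n ω))‖ ^ 2 ∂P := by
      rw [← integral_const_mul]
      refine integral_mono (integrable_norm_sq (memLp_two_of_four
        (memLp_linear ((colL N M).toLinearMap ∘ₗ dev grp p) (he.memLp_error n))))
        (hd2.const_mul _) fun ω => ?_
      simp only
      rw [norm_wcol_sq hp0]
      exact hKle _
    refine h1.trans ((mul_le_mul_of_nonneg_left hnd hK.le).trans ?_)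
    rw [← mul_assoc]
    refine mul_le_mul_of_nonneg_right ?_ (sq_nonneg μ)
    linarith

/-- One step of the recursion of the second moment matrix of the group averages. -/
theorem IsErrorProcess.moment_avg_succ [IsProbabilityMeasure P]
    (hA : IsCombination T grp A) (hJ : CostCondition grp J wo lamL lamU κH)
    (hτ : IsStepProfile τ) (hp : IsPerron grp A p) {μ : ℝ} {e : ℕ → Ω → Fin N → Vec M}
    {s : ℕ → Ω → EuclideanSpace ℝ (Fin N × Fin M)}
    (he : IsErrorProcess P ℱ A J wo τ α σs μ e s) (n : ℕ) :
    moment P (fun ω => col (avg grp p (e (n + 1) ω))) (fun ω => col (avg grp p (e (n + 1) ω)))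
      = moment P
          (fun ω => WithLp.toLp 2 ((1 - μ • Hbar grp J wo τ p).mulVec (col (avg grp p (e n ω))))
            + μ • driftError grp J wo τ p (e n ω))
          (fun ω => WithLp.toLp 2 ((1 - μ • Hbar grp J wo τ p).mulVec (col (avg grp p (e n ω))))
            + μ • driftError grp J wo τ p (e n ω))
        + μ ^ 2 • (avgNoise M grp τ p * moment P (s n) (s n)
          * (avgNoise M grp τ p).transpose) := by
  have he2 := memLp_two_of_four (he.memLp_error n)
  have hx2 : MemLp (fun ω => col (avg grp p (e n ω))) 2 P :=
    memLp_linear ((colL G M).toLinearMap ∘ₗ avg grp p) he2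
  have hs2 := memLp_two_of_four (he.memLp_noise n)
  obtain ⟨u, hu⟩ : ∃ u : Ω → EuclideanSpace ℝ (Fin G × Fin M), u = fun ω =>
      WithLp.toLp 2 ((1 - μ • Hbar grp J wo τ p).mulVec (col (avg grp p (e n ω))))
        + μ • driftError grp J wo τ p (e n ω) := ⟨_, rfl⟩
  obtain ⟨v, hv⟩ : ∃ v : Ω → EuclideanSpace ℝ (Fin G × Fin M), v = fun ω =>
      WithLp.toLp 2 ((μ • avgNoise M grp τ p).mulVec (s n ω)) := ⟨_, rfl⟩
  have hu2 : MemLp u 2 P := by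
    have h1 := memLp_mulVec (1 - μ • Hbar grp J wo τ p) hx2
    have h2 := (memLp_driftError (grp := grp) (p := p) hJ hτ he2).const_smul μ
    rw [hu]
    exact h1.add h2
  have hum : StronglyMeasurable[ℱ n] u := by
    have h1 := stronglyMeasurable_linear ((Matrix.toEuclideanLin (1 - μ • Hbar grp J wo τ p)) ∘ₗ
      (colL G M).toLinearMap ∘ₗ avg grp p) (he.stronglyMeasurable n)
    have h2 := (hJ.continuous_driftError (τ := τ) (p := p)).comp_stronglyMeasurable
      (he.stronglyMeasurable n)
    rw [hu]
    exact h1.add (h2.const_smul μ)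
  have hv2 : MemLp v 2 P := by
    rw [hv]
    exact memLp_mulVec (μ • avgNoise M grp τ p) hs2
  have hv0 : P[v | ℱ n] =ᵐ[P] 0 := by
    rw [hv]
    exact condExp_linear_eq_zero (Matrix.toEuclideanLin (μ • avgNoise M grp τ p))
      (hs2.integrable (by norm_num)) (he.condExp_noise n)
  have hsum : (fun ω => col (avg grp p (e (n + 1) ω))) = fun ω => u ω + v ω := by
    funext ω
    rw [he.step, col_avg_step hA hp, hu, hv]
  have hvv : moment P v v = μ ^ 2 • (avgNoise M grp τ p * moment P (s n) (s n)
      * (avgNoise M grp τ p).transpose) := by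
    rw [hv, moment_mulVec hs2 hs2, Matrix.transpose_smul, Matrix.smul_mul, Matrix.smul_mul,
      Matrix.mul_smul, smul_smul, sq]
  rw [hsum, moment_add_of_condExp_eq_zero (ℱ.le n) hum hu2 hv2 hv0, hvv, hu]

/-- The normalized covariance of the group averages approaches the Lyapunov solution. -/
theorem eventually_avg_moment_sub_le [IsProbabilityMeasure P] (hgrp : IsGrouping T grp wo)
    (hA : IsCombination T grp A) (hJ : CostCondition grp J wo lamL lamU κH)
    (hS : NoiseCondition P ℱ J wo ghat α σs κs γs Rs)
    (hτ : IsStepProfile τ) (hp : IsPerron grp A p)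
    {Φ : Matrix (Fin G × Fin M) (Fin G × Fin M) ℝ} (hΦ : IsLyapunovSolution grp J wo τ p Rs Φ)
    {ε : ℝ} (hε : 0 < ε) :
    ∀ᶠ μ in 𝓝[>] (0 : ℝ), ∀ᶠ n in atTop,
      ‖μ⁻¹ • moment P (fun ω => col (avg grp p (wo - estimate A τ ghat μ n ω)))
        (fun ω => col (avg grp p (wo - estimate A τ ghat μ n ω))) - Φ‖ ≤ ε := by
  obtain ⟨C, hC, hmom⟩ := exists_eventually_moments_le (P := P) (ℱ := ℱ) hgrp hA hJ hτ hp α σs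
  obtain ⟨lam, hlam, hcoer⟩ := hJ.exists_Hbar_coercive (τ := τ) hτ hp
  set H := Hbar grp J wo τ p with hH
  set Q := avgNoise M grp τ p with hQ
  set D := ‖Q‖ * ‖Q.transpose‖ + ‖H * Φ * H‖ + (C + 1) with hD
  have hD0 : 0 < D := by positivity
  -- Chosen so that twice the forcing `μ * (δ * D)` divided by the rate `lam * μ` is exactly `ε`.
  set δ := ε * lam / (2 * D) with hδ
  have hδ0 : 0 < δ := by positivity
  filter_upwards [hmom, eventually_norm_one_sub_smul_sq_le hlam hcoer,
    eventually_noise_moment_sub_le hgrp hA hJ hS hτ hp hδ0, self_mem_nhdsWithin,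
    eventually_lt_nhdsGT_zero one_pos, eventually_lt_nhdsGT_zero hδ0,
    eventually_lt_nhdsGT_zero (a := 1 / lam) (by positivity),
    eventually_lt_nhdsGT_zero (a := δ / (C * (1 + δ⁻¹))) (by positivity)]
    with μ hμmom hμK hμnoise hμ hμ1 hμδ hμlam hμC
  have hμ0 : 0 < μ := hμ
  rw [lt_div_iff₀ (by positivity)] at hμC hμlam
  have hproc := isErrorProcess_estimate hgrp hA hJ hτ hS μ
  set e : ℕ → Ω → Fin N → Vec M := fun n ω => wo - estimate A τ ghat μ n ω with he
  set s : ℕ → Ω → EuclideanSpace ℝ (Fin N × Fin M) :=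
    fun n ω => netNoise J ghat n (estimate A τ ghat μ n ω) ω with hs
  set X : ℕ → Matrix (Fin G × Fin M) (Fin G × Fin M) ℝ := fun n =>
    moment P (fun ω => col (avg grp p (e n ω))) (fun ω => col (avg grp p (e n ω))) with hX
  change ∀ᶠ n in atTop, ‖μ⁻¹ • X n - Φ‖ ≤ ε
  have hrec : ∀ᶠ n in atTop, ‖μ⁻¹ • X (n + 1) - Φ‖ ≤
      (1 - lam * μ) * ‖μ⁻¹ • X n - Φ‖ + μ * (δ * D) := by
    filter_upwards [hμmom e s hproc, hμnoise] with n hn hnoise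
    obtain ⟨hnx, hnq, -⟩ := hn
    have he2 := memLp_two_of_four (hproc.memLp_error n)
    have hx2 : MemLp (fun ω => col (avg grp p (e n ω))) 2 P :=
      memLp_linear ((colL G M).toLinearMap ∘ₗ avg grp p) he2
    have hKx2 := memLp_mulVec (1 - μ • H) hx2
    have hq2 := (memLp_driftError (grp := grp) (p := p) hJ hτ he2).const_smul μ
    -- With parameter `δ * μ` the two contributions of the linearization error are of order `δ μ²`
    -- and `δ⁻¹ μ³`; the threshold on `μ` brings the second below `δ μ²` as well.
    have hpert := norm_moment_add_sub_le hKx2 hq2 (t := δ * μ) (by positivity)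
    rw [moment_mulVec hx2 hx2] at hpert
    have hKt : (1 - μ • H).transpose = 1 - μ • H := by
      rw [Matrix.transpose_sub, Matrix.transpose_one, Matrix.transpose_smul, hH,
        hJ.transpose_Hbar]
    rw [hKt] at hpert
    have hsucc := hproc.moment_avg_succ hA hJ hτ hp n
    set U := moment P
      (fun ω => WithLp.toLp 2 ((1 - μ • H).mulVec (col (avg grp p (e n ω))))
        + μ • driftError grp J wo τ p (e n ω))
      (fun ω => WithLp.toLp 2 ((1 - μ • H).mulVec (col (avg grp p (e n ω))))
        + μ • driftError grp J wo τ p (e n ω)) with hU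
    have hK1 : ‖1 - μ • H‖ ≤ 1 := by
      have : 0 ≤ lam * μ := by positivity
      nlinarith [norm_nonneg (1 - μ • H)]
    have hKx : ∫ ω, ‖(WithLp.toLp 2 ((1 - μ • H).mulVec (col (avg grp p (e n ω))))
        : EuclideanSpace ℝ (Fin G × Fin M))‖ ^ 2 ∂P ≤ C * μ := by
      refine le_trans ?_ hnx
      refine integral_mono (integrable_norm_sq hKx2) (integrable_norm_sq hx2) fun ω => ?_
      refine pow_le_pow_left₀ (norm_nonneg _) ((norm_toLp_mulVec_le _ _).trans ?_) 2
      nlinarith [norm_nonneg (col (avg grp p (e n ω)))]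
    have hq : ∫ ω, ‖μ • driftError grp J wo τ p (e n ω)‖ ^ 2 ∂P ≤ μ ^ 2 * (C * μ ^ 2) := by
      simp only [norm_smul, mul_pow, Real.norm_eq_abs, sq_abs]
      rw [integral_const_mul]
      gcongr
    have hpert' : ‖U - (1 - μ • H) * X n * (1 - μ • H)‖ ≤ μ ^ 2 * (δ * (C + 1)) := by
      refine hpert.trans ?_
      have h1 : δ * μ * ∫ ω, ‖(WithLp.toLp 2 ((1 - μ • H).mulVec (col (avg grp p (e n ω))))
          : EuclideanSpace ℝ (Fin G × Fin M))‖ ^ 2 ∂P ≤ δ * μ * (C * μ) := by gcongr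
      have h2 : (1 + (δ * μ)⁻¹) * ∫ ω, ‖μ • driftError grp J wo τ p (e n ω)‖ ^ 2 ∂P
          ≤ (1 + (δ * μ)⁻¹) * (μ ^ 2 * (C * μ ^ 2)) := by gcongr
      have h3 : (1 + (δ * μ)⁻¹) * (μ ^ 2 * (C * μ ^ 2)) = μ ^ 2 * (μ * (C * (μ + δ⁻¹))) := by
        field_simp
      have h4 : μ * (C * (μ + δ⁻¹)) ≤ δ := by
        refine le_trans ?_ hμC.le
        gcongr
      have h5 : μ ^ 2 * (μ * (C * (μ + δ⁻¹))) ≤ μ ^ 2 * δ := by gcongr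
      have h6 : δ * μ * (C * μ) = μ ^ 2 * (δ * C) := by ring
      have h7 : μ ^ 2 * (δ * (C + 1)) = μ ^ 2 * (δ * C) + μ ^ 2 * δ := by ring
      rw [h7]
      exact add_le_add (h1.trans_eq h6) (h2.trans (h3.trans_le h5))
    -- By the Lyapunov equation, conjugating `Φ` by `1 - μ H` gives `Φ - μ Q R_s Qᵀ` plus `μ² H Φ
    -- H`. The limiting noise cancels, leaving its covariance error and terms that are small
    -- relative to `μ`.
    have hid : μ⁻¹ • X (n + 1) - Φ = (1 - μ • H) * (μ⁻¹ • X n - Φ) * (1 - μ • H)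
        + (μ⁻¹ • (U - (1 - μ • H) * X n * (1 - μ • H))
        + (μ • (Q * (moment P (s n) (s n) - Rs) * Q.transpose) + μ ^ 2 • (H * Φ * H))) := by
      have h1 : X (n + 1) = U + μ ^ 2 • (Q * moment P (s n) (s n) * Q.transpose) := hsucc
      have h2 : (1 - μ • H) * Φ * (1 - μ • H)
          = Φ - μ • (Q * Rs * Q.transpose) + μ ^ 2 • (H * Φ * H) := by
        rw [one_sub_smul_mul_mul, ← Rbar_eq]
        congr 3
      have h3 : μ⁻¹ • μ ^ 2 • (Q * moment P (s n) (s n) * Q.transpose)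
          = μ • (Q * moment P (s n) (s n) * Q.transpose) := by
        rw [smul_smul, sq, inv_mul_cancel_left₀ hμ0.ne']
      have h4 : ∀ K : Matrix (Fin G × Fin M) (Fin G × Fin M) ℝ,
          K * (μ⁻¹ • X n - Φ) * K = μ⁻¹ • (K * X n * K) - K * Φ * K := fun K => by
        rw [mul_sub, sub_mul, mul_smul_comm, smul_mul_assoc]
      have h5 : Q * (moment P (s n) (s n) - Rs) * Q.transpose
          = Q * moment P (s n) (s n) * Q.transpose - Q * Rs * Q.transpose := by
        rw [Matrix.mul_sub, Matrix.sub_mul]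
      rw [h1, smul_add, h3, h4, h2, h5, smul_sub, smul_sub]
      abel
    have hn1 : ‖(1 - μ • H) * (μ⁻¹ • X n - Φ) * (1 - μ • H)‖ ≤
        (1 - lam * μ) * ‖μ⁻¹ • X n - Φ‖ := norm_mul_mul_le _ _ hμK
    have hn2 : ‖μ⁻¹ • (U - (1 - μ • H) * X n * (1 - μ • H))‖ ≤ μ * (δ * (C + 1)) := by
      rw [norm_smul, Real.norm_of_nonneg (inv_pos.mpr hμ0).le, inv_mul_le_iff₀ hμ0]
      exact hpert'.trans_eq (by ring)
    have hn3 : ‖μ • (Q * (moment P (s n) (s n) - Rs) * Q.transpose)‖ ≤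
        μ * (δ * (‖Q‖ * ‖Q.transpose‖)) := by
      rw [norm_smul, Real.norm_of_nonneg hμ0.le]
      gcongr
      calc ‖Q * (moment P (s n) (s n) - Rs) * Q.transpose‖
          ≤ ‖Q‖ * ‖moment P (s n) (s n) - Rs‖ * ‖Q.transpose‖ :=
            (Matrix.l2_opNorm_mul _ _).trans (by gcongr; exact Matrix.l2_opNorm_mul _ _)
        _ ≤ ‖Q‖ * δ * ‖Q.transpose‖ := by gcongr
        _ = δ * (‖Q‖ * ‖Q.transpose‖) := by ring
    have hn4 : ‖μ ^ 2 • (H * Φ * H)‖ ≤ μ * (δ * ‖H * Φ * H‖) := by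
      rw [norm_smul, Real.norm_of_nonneg (sq_nonneg μ), sq, mul_assoc]
      gcongr
    rw [hid]
    refine (norm_add_le _ _).trans (add_le_add hn1 ((norm_add_le _ _).trans ?_))
    refine (add_le_add hn2 ((norm_add_le _ _).trans (add_le_add hn3 hn4))).trans_eq ?_
    rw [hD]
    ring
  have := eventually_le_of_recursion (a := fun n => ‖μ⁻¹ • X n - Φ‖) (q := lam * μ)
    (by positivity) (by linarith) (show 0 < μ * (δ * D) by positivity) hrec
  filter_upwards [this] with n hn
  refine hn.trans_eq ?_
  rw [hδ]
  field_simp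

/-- The matrix that hands every agent the vector of its group. -/
def spreadMatrix (M : ℕ) (grp : Fin N → Fin G) : Matrix (Fin N × Fin M) (Fin G × Fin M) ℝ :=
  (1 : Matrix (Fin G × Fin M) (Fin G × Fin M) ℝ).submatrix (fun x => (grp x.1, x.2)) id

theorem spreadMatrix_mulVec (grp : Fin N → Fin G) (x : Fin G → Vec M) :
    WithLp.toLp 2 ((spreadMatrix M grp).mulVec (col x)) = col (spread grp x) := by
  ext ⟨k, a⟩
  change (spreadMatrix M grp).mulVec (col x) (k, a) = x (grp k) a
  simp [spreadMatrix, Matrix.mulVec, dotProduct, Matrix.one_apply, col_apply]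

theorem spreadMatrix_mul_mul (grp : Fin N → Fin G)
    (X : Matrix (Fin G × Fin M) (Fin G × Fin M) ℝ) :
    spreadMatrix M grp * X * (spreadMatrix M grp).transpose
      = X.submatrix (fun x => (grp x.1, x.2)) (fun x => (grp x.1, x.2)) := by
  ext x y
  simp [spreadMatrix, Matrix.mul_apply, Matrix.one_apply]

theorem hasBlockStructure_spread (grp : Fin N → Fin G)
    (Φ : Matrix (Fin G × Fin M) (Fin G × Fin M) ℝ) :
    HasBlockStructure grp Φ
      (spreadMatrix M grp * Φ * (spreadMatrix M grp).transpose) := by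
  intro m r
  ext ⟨⟨k, hk⟩, a⟩ ⟨⟨l, hl⟩, b⟩
  rw [spreadMatrix_mul_mul]
  simp [groupBlock, block, hk, hl]

theorem normalizedCov_eq {ι : Type*} [Fintype ι] [DecidableEq ι] {X : Ω → EuclideanSpace ℝ ι}
    (hX : MemLp X 2 P) (c : ℝ) : normalizedCov P c X = c⁻¹ • moment P X X := by
  ext i j
  rw [Matrix.smul_apply, moment_apply hX hX]
  rfl

/-- The normalized network covariance approaches the block matrix built from the Lyapunov
solution. -/
theorem eventually_normalizedCov_sub_le [IsProbabilityMeasure P] (hgrp : IsGrouping T grp wo)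
    (hA : IsCombination T grp A) (hJ : CostCondition grp J wo lamL lamU κH)
    (hS : NoiseCondition P ℱ J wo ghat α σs κs γs Rs)
    (hτ : IsStepProfile τ) (hp : IsPerron grp A p)
    {Φ : Matrix (Fin G × Fin M) (Fin G × Fin M) ℝ} (hΦ : IsLyapunovSolution grp J wo τ p Rs Φ)
    {ε : ℝ} (hε : 0 < ε) :
    ∀ᶠ μ in 𝓝[>] (0 : ℝ), ∀ᶠ n in atTop,
      ‖normalizedCov P μ (netError A τ ghat wo μ n)
        - spreadMatrix M grp * Φ * (spreadMatrix M grp).transpose‖ ≤ ε := by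
  obtain ⟨C, hC, hmom⟩ := exists_eventually_moments_le (P := P) (ℱ := ℱ) hgrp hA hJ hτ hp α σs
  set L := spreadMatrix M grp with hL
  set D := ‖L‖ * ‖L.transpose‖ + (‖L‖ ^ 2 * C + 1) with hD
  have hD0 : 0 < D := by positivity
  -- `D` collects the amplification by `L` on both sides and the contribution of the deviations, so
  -- that the total is `δ * D = ε`.
  set δ := ε / D with hδ
  have hδ0 : 0 < δ := by positivity
  filter_upwards [hmom, eventually_avg_moment_sub_le hgrp hA hJ hS hτ hp hΦ hδ0,
    self_mem_nhdsWithin,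
    eventually_lt_nhdsGT_zero (a := δ / ((1 + δ⁻¹) * C)) (by positivity)]
    with μ hμmom hμavg hμ hμC
  have hμ0 : 0 < μ := hμ
  rw [lt_div_iff₀ (by positivity)] at hμC
  have hproc := isErrorProcess_estimate hgrp hA hJ hτ hS μ
  set e : ℕ → Ω → Fin N → Vec M := fun n ω => wo - estimate A τ ghat μ n ω with he
  filter_upwards [hμmom e _ hproc, hμavg] with n hn hnavg
  obtain ⟨hnx, -, hnd⟩ := hn
  have he2 := memLp_two_of_four (hproc.memLp_error n)
  have hx2 : MemLp (fun ω => col (avg grp p (e n ω))) 2 P :=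
    memLp_linear ((colL G M).toLinearMap ∘ₗ avg grp p) he2
  have hd2 : MemLp (fun ω => col (dev grp p (e n ω))) 2 P :=
    memLp_linear ((colL N M).toLinearMap ∘ₗ dev grp p) he2
  have hLx2 := memLp_mulVec L hx2
  have hcol : ∀ ω, netError A τ ghat wo μ n ω
      = WithLp.toLp 2 (L.mulVec (col (avg grp p (e n ω)))) + col (dev grp p (e n ω)) := by
    intro ω
    rw [hL, spreadMatrix_mulVec, ← colL_apply, ← colL_apply, ← map_add, spread_avg_add_dev,
      colL_apply, netError_eq]
  have hsum : netError A τ ghat wo μ n = fun ω =>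
      WithLp.toLp 2 (L.mulVec (col (avg grp p (e n ω)))) + col (dev grp p (e n ω)) :=
    funext hcol
  have hadd : MemLp (netError A τ ghat wo μ n) 2 P := by
    rw [hsum]; exact hLx2.add hd2
  -- Here the parameter does not shrink with `μ`: the averages contribute `δ` times order `μ`, the
  -- deviations order `μ²` for fixed `δ`. Both stay small after division by `μ`.
  have hpert := norm_moment_add_sub_le hLx2 hd2 hδ0
  rw [moment_mulVec hx2 hx2, ← hsum] at hpert
  set X := moment P (fun ω => col (avg grp p (e n ω))) (fun ω => col (avg grp p (e n ω))) with hX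
  set U := moment P (netError A τ ghat wo μ n) (netError A τ ghat wo μ n) with hU
  have hLx : ∫ ω, ‖(WithLp.toLp 2 (L.mulVec (col (avg grp p (e n ω))))
      : EuclideanSpace ℝ (Fin N × Fin M))‖ ^ 2 ∂P ≤ ‖L‖ ^ 2 * (C * μ) := by
    refine le_trans ?_ (mul_le_mul_of_nonneg_left hnx (sq_nonneg _))
    rw [← integral_const_mul]
    refine integral_mono (integrable_norm_sq hLx2) ((integrable_norm_sq hx2).const_mul _)
      fun ω => ?_
    simp only
    rw [← mul_pow]
    exact pow_le_pow_left₀ (norm_nonneg _) (norm_toLp_mulVec_le _ _) 2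
  have hpert' : ‖U - L * X * L.transpose‖ ≤ μ * (δ * (‖L‖ ^ 2 * C + 1)) := by
    refine hpert.trans ?_
    have h1 : δ * ∫ ω, ‖(WithLp.toLp 2 (L.mulVec (col (avg grp p (e n ω))))
        : EuclideanSpace ℝ (Fin N × Fin M))‖ ^ 2 ∂P ≤ δ * (‖L‖ ^ 2 * (C * μ)) := by gcongr
    have h2 : (1 + δ⁻¹) * ∫ ω, ‖col (dev grp p (e n ω))‖ ^ 2 ∂P ≤ (1 + δ⁻¹) * (C * μ ^ 2) := by
      gcongr
    have h3 : (1 + δ⁻¹) * (C * μ ^ 2) = μ * (μ * ((1 + δ⁻¹) * C)) := by ring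
    have h4 : μ * (μ * ((1 + δ⁻¹) * C)) ≤ μ * δ := by gcongr
    have h5 : μ * (δ * (‖L‖ ^ 2 * C + 1)) = δ * (‖L‖ ^ 2 * (C * μ)) + μ * δ := by ring
    rw [h5]
    exact add_le_add h1 (h2.trans (h3.trans_le h4))
  have hid : normalizedCov P μ (netError A τ ghat wo μ n) - L * Φ * L.transpose
      = L * (μ⁻¹ • X - Φ) * L.transpose + μ⁻¹ • (U - L * X * L.transpose) := by
    rw [normalizedCov_eq hadd, Matrix.mul_sub, Matrix.sub_mul, Matrix.mul_smul, Matrix.smul_mul,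
      smul_sub]
    abel
  have hn1 : ‖L * (μ⁻¹ • X - Φ) * L.transpose‖ ≤ δ * (‖L‖ * ‖L.transpose‖) :=
    calc ‖L * (μ⁻¹ • X - Φ) * L.transpose‖
        ≤ ‖L‖ * ‖μ⁻¹ • X - Φ‖ * ‖L.transpose‖ :=
          (Matrix.l2_opNorm_mul _ _).trans (by gcongr; exact Matrix.l2_opNorm_mul _ _)
      _ ≤ ‖L‖ * δ * ‖L.transpose‖ := by gcongr
      _ = δ * (‖L‖ * ‖L.transpose‖) := by ring
  have hn2 : ‖μ⁻¹ • (U - L * X * L.transpose)‖ ≤ δ * (‖L‖ ^ 2 * C + 1) := by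
    rw [norm_smul, Real.norm_of_nonneg (inv_pos.mpr hμ0).le, inv_mul_le_iff₀ hμ0]
    exact hpert'
  rw [hid]
  refine (norm_add_le _ _).trans ((add_le_add hn1 hn2).trans_eq ?_)
  rw [← mul_add, ← hD, hδ, div_mul_cancel₀ _ hD0.ne']

end Covariance

end DiffusionNet

/-! ### Assembly of the theorem. -/

theorem mainTheorem3 {N G M : ℕ} {Ω : Type*} {mΩ : MeasurableSpace Ω}
    (P : Measure Ω) [IsProbabilityMeasure P] (ℱ : Filtration ℕ mΩ)
    (T : SimpleGraph (Fin N)) (grp : Fin N → Fin G) (A : Matrix (Fin N) (Fin N) ℝ)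
    (J : Fin N → Vec M → ℝ) (wo : Fin N → Vec M) (lamL lamU : Fin N → ℝ) (κH : ℝ)
    (ghat : ℕ → Fin N → Vec M → Ω → Vec M) (α σs κs γs : ℝ)
    (Rs : Matrix (Fin N × Fin M) (Fin N × Fin M) ℝ) (τ : Fin N → ℝ)
    (hgrp : IsGrouping T grp wo) (hA : IsCombination T grp A)
    (hJ : CostCondition grp J wo lamL lamU κH)
    (hS : NoiseCondition P ℱ J wo ghat α σs κs γs Rs)
    (hτ : IsStepProfile τ) :
    (∀ (μ : ℝ) (i : ℕ), MemLp (netError A τ ghat wo μ i) 2 P) ∧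
    (∃! p, IsPerron grp A p) ∧
    ∀ p, IsPerron grp A p →
      (∃! Φ, IsLyapunovSolution grp J wo τ p Rs Φ) ∧
      ∀ Φ, IsLyapunovSolution grp J wo τ p Rs Φ →
        ∃ Pi : Matrix (Fin N × Fin M) (Fin N × Fin M) ℝ, HasBlockStructure grp Φ Pi ∧
          Tendsto (fun μ : ℝ =>
              limsup (fun i : ℕ => ‖normalizedCov P μ (netError A τ ghat wo μ i) - Pi‖ₑ) atTop)
            (𝓝[>] 0) (𝓝 0) := by
  refine ⟨fun μ i => ?_, hA.existsUnique_perron hgrp, fun p hp => ⟨?_, fun Φ hΦ => ?_⟩⟩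
  · exact memLp_two_of_four ((colL N M).comp_memLp'
      (error_measurable_memLp hgrp hA hJ hτ hS μ i).2)
  · obtain ⟨lam, hlam, hcoer⟩ := hJ.exists_Hbar_coercive (τ := τ) hτ hp
    exact existsUnique_lyapunov hlam hcoer _
  · refine ⟨_, hasBlockStructure_spread grp Φ, ENNReal.tendsto_nhds_zero.mpr fun ε hε => ?_⟩
    -- The minimum with one covers `ε = ∞`, where a direct conversion to a real number would give
    -- zero.
    obtain ⟨δ, hδ, hδε⟩ : ∃ δ : ℝ, 0 < δ ∧ ENNReal.ofReal δ ≤ ε := by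
      refine ⟨(min ε 1).toReal, ENNReal.toReal_pos (by simpa using hε.ne') (by simp), ?_⟩
      rw [ENNReal.ofReal_toReal (by simp)]
      exact min_le_left _ _
    filter_upwards [eventually_normalizedCov_sub_le hgrp hA hJ hS hτ hp hΦ hδ] with μ hμ
    refine (limsup_le_of_le (h := ?_)).trans hδε
    filter_upwards [hμ] with n hn
    rw [← ofReal_norm]
    exact ENNReal.ofReal_le_ofReal hn
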